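/- Setting. Consider a real scalar field of mass $m>0$ on the cosmological patch of de Sitter space, $ds^2=a(\eta)^2(-d\eta^2+d\vec x^{\,2})$, $a(\eta)=-1/(H\eta)$, $H>0$, in the Bunch–Davies vacuum, i.e. the Fock vacuum of the modes $e_k(\eta)=\sqrt{-\pi\eta/(4a(\eta)^2)}\,H^{(1)}_\nu(-k\eta)$ with $\nu=\sqrt{9/4-m^2/H^2}$. Put $\mu^2=\tfrac32-\sqrt{\tfrac94-m^2/H^2}$ and assume that the field is light, in the sense $0<m^2/H^2<5/4$ (equivalently $0<\mu^2<\tfrac12$). Observables are taken at the instant $\eta_0=-1/H$, where $a=1$; to $\gamma=(g,f)$ one associates $\hat O_\gamma=\hat\Phi(f)-\hat\Pi(g)$, with $\hat\Phi=\hat\phi$ and $\hat\Pi=a^2\partial_\eta\hat\phi$, and $\sigma(\gamma,\gamma')=\langle\{\hat O_\gamma,\hat O_{\gamma'}\}\rangle$. A single mode $A$ is given by two pairs $\gamma^{(i)}_A=(g^{(i)}_A,f^{(i)}_A)$, $i=1,2$, of real, integrable, compactly supported functions on $\mathbb R^3$ with $g_A^{(i)}\in\dot H_{1/2}$, $f_A^{(i)}\in\dot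 H_{-1/2}$ and $\omega(\gamma_A^{(2)},\gamma_A^{(1)})=1$, where $\omega(\gamma_1,\gamma_2)=\int (f_1g_2-g_1f_2)\,d^3x$. It is typical (non-special) if each of the functions $g_A^{(i)},f_A^{(i)}$ that does not vanish almost everywhere has non-zero spatial average. The mutual information of two modes is $\mathcal I(A,B)=S(\nu_A)+S(\nu_B)-S(\nu_+)-S(\nu_-)$, with $S(\nu)=\frac{\nu+1}2\log_2\frac{\nu+1}2-\frac{\nu-1}2\log_2\frac{\nu-1}2$ and $\nu_A,\nu_B,\nu_\pm$ the symplectic eigenvalues of the matrices $\sigma_A,\sigma_B,\sigma_{AB}$ of $\sigma$. Let $A$ and $B$ be two single modes. For $R>0$ and $d\in\mathbb R^3$ let $A_R$ be the mode $A$ dilated by the factor $R$ ($f_R(\vec x)=R^{-2}f(\vec x/R)$, $g_R(\vec x)=R^{-1}g(\vec x/R)$), and let $B_{R,d}$ be the mode $B$ displaced by $d$ and then dilated by $R$, so that $d=\Delta\vec x/R$ is the displacement in units of the scale $R$ of the supports. Proposition. Fix $m/H$ as above (hence $\mu^2$). (i) In the limit $RH\to\infty$ the mutual information becomes independent of $R$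 and $H$: there is a function $\mathcal I_\infty(d)\in[0,\infty)$ such that, for every $d$ for which the supports of $A$ and of the displaced mode $B$ are disjoint, $\mathcal I(A_R,B_{R,d})\to\mathcal I_\infty(d)$ as $RH\to\infty$. (ii) If $A$ and $B$ are typical, there is a constant $\beta>0$, depending only on $m/H$ and on the smearing functions of $A$ and $B$, such that for all sufficiently large $|d|$ one has $0<\beta|d|^{-4\mu^2}<1$, and $$\mathcal I_\infty(d)\;\sim\;-\log_2\!\bigl(1-\beta\,|d|^{-4\mu^2}\bigr)\qquad\text{as } |d|\to\infty,$$ in the sense that the ratio of the two sides tends to $1$. -/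

import Mathlib

open Filter Asymptotics MeasureTheory
open scoped Topology ComplexConjugate Nat

noncomputable section

/-! ### Bessel and Hankel functions of real order on the positive half-line -/

/-- Bessel function of the first kind,
`J_ν(x) = ∑ₙ (-1)ⁿ / (n! Γ(n+ν+1)) (x/2)^(2n+ν)`, for `x > 0`. -/
def besselJ (ν x : ℝ) : ℝ :=
  ∑' n : ℕ, (-1 : ℝ) ^ n / ((n ! : ℝ) * Real.Gamma ((n : ℝ) + ν + 1)) *
    (x / 2) ^ (2 * (n : ℝ) + ν)

/-- Bessel function of the second kind, for non-integer order `ν`. -/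
def besselY (ν x : ℝ) : ℝ :=
  (besselJ ν x * Real.cos (ν * Real.pi) - besselJ (-ν) x) / Real.sin (ν * Real.pi)

/-- Hankel function of the first kind, `H⁽¹⁾_ν = J_ν + i Y_ν`. -/
def hankel1 (ν x : ℝ) : ℂ := (besselJ ν x : ℂ) + Complex.I * (besselY ν x : ℂ)

/-! ### The classical phase space of the scalar field -/

/-- Three-dimensional Euclidean space: the spatial slice, and also the space of wave vectors. -/
abbrev Space3 : Type := EuclideanSpace ℝ (Fin 3)

/-- Fourier transform `h̃(k) = ∫ d³x e^{-i k·x} h(x)` of a real function. -/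
def ft (h : Space3 → ℝ) (k : Space3) : ℂ :=
  ∫ x : Space3, Complex.exp (-Complex.I * ((inner ℝ k x : ℝ) : ℂ)) * ((h x : ℝ) : ℂ)

/-- Finiteness of the homogeneous Sobolev norm of order `s`,
`‖h‖_s² = ∫ d³k/(2π)³ |k|^{2s} |h̃(k)|² < ∞`. -/
def FiniteSobolevNorm (s : ℝ) (h : Space3 → ℝ) : Prop :=
  Integrable (fun k : Space3 => ‖k‖ ^ (2 * s) * ‖ft h k‖ ^ 2)

/-- A pair of smearing functions `γ = (g, f)`; it labels the linear observable
`O_γ = Φ(f) - Π(g)`. -/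
structure PhaseVec where
  g : Space3 → ℝ
  f : Space3 → ℝ

namespace PhaseVec

/-- The (closed) region in which `γ = (g, f)` is supported. -/
def region (γ : PhaseVec) : Set Space3 := tsupport γ.g ∪ tsupport γ.f

/-- `γ = (g, f)` consists of compactly supported functions with `g ∈ Ḣ^{1/2}`, `f ∈ Ḣ^{-1/2}`. -/
structure Admissible (γ : PhaseVec) : Prop where
  integrable_g : Integrable γ.g
  integrable_f : Integrable γ.f
  compact_g : HasCompactSupport γ.g
  compact_f : HasCompactSupport γ.f
  sobolev_g : FiniteSobolevNorm (1 / 2) γ.g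
  sobolev_f : FiniteSobolevNorm (-1 / 2) γ.f

/-- The symplectic structure `ω(γ₁, γ₂) = ∫ d³x (f₁ g₂ - g₁ f₂)`. -/
def omega (γ₁ γ₂ : PhaseVec) : ℝ := ∫ x : Space3, (γ₁.f x * γ₂.g x - γ₁.g x * γ₂.f x)

/-- Rigid displacement by the vector `d`. -/
def translate (d : Space3) (γ : PhaseVec) : PhaseVec where
  g := fun x => γ.g (x - d)
  f := fun x => γ.f (x - d)

/-- Dilation of all lengths by `R`, normalised so that the symplectic structure is preserved:
`f_R(x) = R⁻² f(x/R)`, `g_R(x) = R⁻¹ g(x/R)`. -/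
def dilate (R : ℝ) (γ : PhaseVec) : PhaseVec where
  g := fun x => R⁻¹ * γ.g (R⁻¹ • x)
  f := fun x => (R ^ 2)⁻¹ * γ.f (R⁻¹ • x)

end PhaseVec

/-! ### Single-mode subsystems -/

/-- The pair `(γ⁽¹⁾, γ⁽²⁾)` (indices `0`, `1`) spanning the phase space of a single mode. -/
abbrev ModePair : Type := Fin 2 → PhaseVec

namespace ModePair

/-- `(γ⁽¹⁾, γ⁽²⁾)` is a canonical basis of a compactly supported single-mode subsystem. -/
structure IsSingleMode (A : ModePair) : Prop where
  admissible : ∀ i, (A i).Admissible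
  symplectic : PhaseVec.omega (A 1) (A 0) = 1

/-- Typical (non-special) mode: every smearing function that occurs in it, i.e. that does not
vanish almost everywhere, has non-vanishing spatial average. -/
def Typical (A : ModePair) : Prop :=
  ∀ i, ((A i).g =ᵐ[volume] 0 ∨ ∫ x, (A i).g x ≠ 0) ∧ ((A i).f =ᵐ[volume] 0 ∨ ∫ x, (A i).f x ≠ 0)

/-- The two modes are supported in disjoint regions. -/
def NonOverlapping (A B : ModePair) : Prop := ∀ i j, Disjoint (A i).region (B j).region

/-- Rigid displacement of a mode. -/
def translate (d : Space3) (A : ModePair) : ModePair := fun i => (A i).translate d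

/-- Dilation of a mode. -/
def dilate (R : ℝ) (A : ModePair) : ModePair := fun i => (A i).dilate R

end ModePair

/-! ### The Bunch–Davies vacuum in the cosmological patch of de Sitter space -/

namespace BunchDavies

/-- Scale factor `a(η) = -1/(Hη)`. -/
def scaleFactor (H η : ℝ) : ℝ := -1 / (H * η)

/-- Order of the Hankel function, `ν = √(9/4 - m²/H²)`. -/
def order (m H : ℝ) : ℝ := √(9 / 4 - m ^ 2 / H ^ 2)

/-- The parameter `μ² = 3/2 - √(9/4 - m²/H²)`. -/
def muSq (m H : ℝ) : ℝ := 3 / 2 - √(9 / 4 - m ^ 2 / H ^ 2)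

/-- Bunch–Davies mode function `e_k(η) = √(-πη/(4a(η)²)) H⁽¹⁾_ν(-kη)`. -/
def modeFun (m H k η : ℝ) : ℂ :=
  ((√(-Real.pi * η / (4 * scaleFactor H η ^ 2)) : ℝ) : ℂ) * hankel1 (order m H) (-k * η)

/-- The instant at which the observables are evaluated, where `a = 1`. -/
def eta0 (H : ℝ) : ℝ := -1 / H

/-- Mode function of `Φ = φ` at the instant `eta0`. -/
def fieldMode (m H k : ℝ) : ℂ := modeFun m H k (eta0 H)

/-- Mode function of `Π = √h nᵃ∇ₐφ`, with `√h = a³` and `nᵃ∇ₐ = a⁻¹ ∂_η`, at `eta0`. -/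
def momentumMode (m H k : ℝ) : ℂ :=
  ((scaleFactor H (eta0 H) ^ 3 * (scaleFactor H (eta0 H))⁻¹ : ℝ) : ℂ) *
    deriv (modeFun m H k) (eta0 H)

/-- The coefficient of the annihilation operator `A_k` in the Fock representation
`O_γ = Φ(f) - Π(g) = ∫ d³k/(2π)³ (w_γ(k) A_k + h.c.)`. -/
def amplitude (m H : ℝ) (γ : PhaseVec) (k : Space3) : ℂ :=
  fieldMode m H ‖k‖ * ft γ.f (-k) - momentumMode m H ‖k‖ * ft γ.g (-k)

/-- Two-point function `⟨0| O_γ O_γ' |0⟩ = ∫ d³k/(2π)³ w_γ(k) w_γ'(k)^*` in the state annihilated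
by all `A_k`, where `[A_k, A_k'^†] = (2π)³ δ(k - k')`. -/
def twoPoint (m H : ℝ) (γ γ' : PhaseVec) : ℂ :=
  ((((2 * Real.pi) ^ 3)⁻¹ : ℝ) : ℂ) *
    ∫ k : Space3, amplitude m H γ k * conj (amplitude m H γ' k)

/-- Covariance metric `σ(γ, γ') = ⟨0| {O_γ, O_γ'} |0⟩`. -/
def sigma (m H : ℝ) (γ γ' : PhaseVec) : ℝ :=
  (twoPoint m H γ γ' + twoPoint m H γ' γ).re

end BunchDavies

/-! ### Gaussian mutual information of two single modes -/

/-- Von Neumann entropy (in bits) of a one-mode Gaussian state with symplectic eigenvalue `ν`. -/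
def entropy (ν : ℝ) : ℝ :=
  (ν + 1) / 2 * Real.logb 2 ((ν + 1) / 2) - (ν - 1) / 2 * Real.logb 2 ((ν - 1) / 2)

/-- Mutual information `S(ν_A) + S(ν_B) - S(ν₊) - S(ν₋)` of the two-mode Gaussian state with
covariance matrix `[[σA, C], [Cᵀ, σB]]`, in terms of its symplectic eigenvalues. -/
def gaussianMutualInfo (σA σB C : Matrix (Fin 2) (Fin 2) ℝ) : ℝ :=
  let D : ℝ := σA.det + σB.det + 2 * C.det
  let detAB : ℝ := (Matrix.fromBlocks σA C C.transpose σB).det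
  let nuPlus : ℝ := √((D + √(D ^ 2 - 4 * detAB)) / 2)
  let nuMinus : ℝ := √((D - √(D ^ 2 - 4 * detAB)) / 2)
  entropy (√σA.det) + entropy (√σB.det) - entropy nuPlus - entropy nuMinus

namespace BunchDavies

/-- The matrix of values of the covariance metric on two pairs of phase space elements. -/
def covMatrix (m H : ℝ) (A B : ModePair) : Matrix (Fin 2) (Fin 2) ℝ :=
  Matrix.of fun i j => sigma m H (A i) (B j)

/-- Mutual information of the modes `A` and `B` in the Bunch–Davies vacuum. -/
def mutualInfo (m H : ℝ) (A B : ModePair) : ℝ :=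
  gaussianMutualInfo (covMatrix m H A A) (covMatrix m H B B) (covMatrix m H A B)

end BunchDavies

/-- The limit `RH → ∞` over all pairs `(R, H)` of positive numbers. -/
def superHubble : Filter (ℝ × ℝ) :=
  comap (fun p : ℝ × ℝ => p.1 * p.2) atTop ⊓ 𝓟 {p : ℝ × ℝ | 0 < p.1 ∧ 0 < p.2}

end

/-! Write `q = m/H`, `ν = √(9/4 - q²)` and `L = RH`, so that `1 < ν < 3/2` and `μ² = 3/2 - ν`. In
wave vectors rescaled by `R`, the amplitude of a dilated observable is, up to a factor common to all
observables, `a_L ((3/2 - ν) ĝ + L⁻¹ f̂) + L⁻² b_L ĝ` (`redAmp`), where `a_L → c₀ |p|^{-ν}` and `b_L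
→ c₁ |p|^{2-ν}`. Covariances are a constant times `L^{2ν+1}` times overlap integrals of these
amplitudes, so `R` and `H` enter only through `L` (`sigma_dilate`).

When all symplectic eigenvalues are large, each entropy is `log₂ ν` plus a universal constant, and
the mutual information tends to `-½ log₂` of `det σ_AB / (det σ_A det σ_B)`
(`tendsto_gaussianMutualInfo`). This quotient does not change under an invertible change of basis
inside each mode, even an `L`-dependent, non-symplectic one. A `Frame` is such a basis, chosen so
that the amplitudes have independent limits `|p|^{-ν} (c₀ ĥ + θ c₁ |p|² ĥ₀)`. If the two profiles
`g` are independent, the leading term already gives this. Otherwise one `g` can be made to vanish,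
and cancelling successive leading terms brings out `f₁`, then `f₀`, and finally `b_L ĝ`.

In the last case `|p|^{2-ν} ĝ` need not be square integrable. The normalised amplitude then keeps
norm one and tends to zero pointwise, so it decouples from every dominated amplitude. Two such
amplitudes with separated supports decouple as well: `|b_L|²` varies slowly, uniformly in `L`, so
its off-diagonal matrix elements stay bounded (`exists_offDiagonal_bound`) while the norms diverge.

The limiting 4×4 matrix is positive definite because a null combination would equate two
distributions of the form `a h - b Δg` with disjoint supports, forcing both to vanish
(`symb_ae_eq_zero_of_separated`). Hence the quotient has a positive limit. The determinants diverge
because the change of basis costs at most `L³` while `(L^{2ν+1})² = L^{4ν+2}`, and `4ν + 2 > 6`.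

For part (ii), powers of `|p|` are written as superpositions of Gaussians, which gives Riesz kernels
in the displacement. The cross block is `|d|^{-(3-2ν)}` times a rank-one matrix built from the
averages of the profiles, up to smaller terms (`tendsto_scaled_overlap`). It enters the determinant
quadratically, so the quotient is `1 - q₀ |d|^{-4μ²} (1 + o(1))`. Typicality makes the average of
the first profile nonzero, hence `q₀ > 0`, and `β = q₀ / 2`. -/

open Filter Asymptotics MeasureTheory
open scoped Topology ComplexConjugate Nat

noncomputable section

/-! ### Bessel and Hankel functions -/

/-- The entire function `∑ₙ (-1)ⁿ zⁿ / (n! Γ(n+ν+1))`, so that `J_ν(x) = (x/2)^ν` times its value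
at `(x/2)²`. -/
def besselSeries (ν z : ℝ) : ℝ :=
  ∑' n : ℕ, (-1 : ℝ) ^ n / ((n ! : ℝ) * Real.Gamma ((n : ℝ) + ν + 1)) * z ^ n

/-- Γ is at least 1 on `[2, ∞)`, so only finitely many indices matter. At the poles `Real.Gamma` is
0 and its inverse is 0, the true value of `1/Γ`, so no order `ν` has to be excluded. -/
theorem exists_bound_inv_Gamma (ν : ℝ) : ∃ C : ℝ, 0 ≤ C ∧ ∀ n : ℕ, |(Real.Gamma (n + ν + 1))⁻¹| ≤ C := by
  have h : ∀ᶠ n : ℕ in atTop, |(Real.Gamma (n + ν + 1))⁻¹| ≤ 1 := by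
    filter_upwards [eventually_ge_atTop (⌈|ν|⌉₊ + 1)] with n hn
    have h1 : (|ν| : ℝ) + 1 ≤ n := by
      have := Nat.le_ceil (|ν|)
      have h2 : ((⌈|ν|⌉₊ + 1 : ℕ) : ℝ) ≤ n := by exact_mod_cast hn
      push_cast at h2; linarith
    have h2 : (2 : ℝ) ≤ n + ν + 1 := by
      have := neg_abs_le ν; linarith
    have h3 : (1 : ℝ) ≤ Real.Gamma (n + ν + 1) := by
      have := Real.Gamma_strictMonoOn_Ici.monotoneOn (Set.self_mem_Ici) (Set.mem_Ici.2 h2) h2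
      rwa [Real.Gamma_two] at this
    rw [abs_inv, abs_of_pos (by linarith)]
    exact inv_le_one_of_one_le₀ h3
  have h2 : BddAbove (Set.range fun n : ℕ => |(Real.Gamma (n + ν + 1))⁻¹|) :=
    Filter.IsBoundedUnder.bddAbove_range ⟨1, by simpa using h⟩
  obtain ⟨C, hC⟩ := h2
  exact ⟨C, (abs_nonneg _).trans (hC ⟨0, rfl⟩), fun n => hC ⟨n, rfl⟩⟩

theorem summable_besselSeries (ν z : ℝ) :
    Summable fun n : ℕ => (-1 : ℝ) ^ n / ((n ! : ℝ) * Real.Gamma ((n : ℝ) + ν + 1)) * z ^ n := by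
  obtain ⟨C, hC0, hC⟩ := exists_bound_inv_Gamma ν
  refine Summable.of_norm_bounded ((Real.summable_pow_div_factorial |z|).mul_left C) fun n => ?_
  have h : (-1 : ℝ) ^ n / ((n ! : ℝ) * Real.Gamma ((n : ℝ) + ν + 1)) * z ^ n =
    (Real.Gamma (n + ν + 1))⁻¹ * ((-1) ^ n * z ^ n / n !) := by
    rw [div_eq_mul_inv, mul_inv]; ring
  rw [h, norm_mul]
  refine mul_le_mul (hC n) ?_ (norm_nonneg _) hC0
  simp

theorem hasDerivAt_besselSeries_aux (ν z : ℝ) :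
    (Summable fun n : ℕ => (-1 : ℝ) ^ n / ((n ! : ℝ) * Real.Gamma ((n : ℝ) + ν + 1)) *
      (n * z ^ (n - 1))) ∧
    HasDerivAt (besselSeries ν)
      (∑' n : ℕ, (-1 : ℝ) ^ n / ((n ! : ℝ) * Real.Gamma ((n : ℝ) + ν + 1)) * (n * z ^ (n - 1))) z := by
  obtain ⟨C, hC0, hC⟩ := exists_bound_inv_Gamma ν
  set r := |z| + 1
  have hr : 0 ≤ r := by positivity
  have hu : Summable fun n : ℕ => C * (n * r ^ (n - 1) / n !) := by
    refine Summable.mul_left C ?_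
    rw [← summable_nat_add_iff 1]
    refine (Real.summable_pow_div_factorial r).congr fun n => ?_
    rw [Nat.factorial_succ]; push_cast
    have : (n : ℝ) + 1 ≠ 0 := by positivity
    field_simp
  have hb : ∀ n : ℕ, ∀ y ∈ Metric.ball (0 : ℝ) r,
      ‖(-1 : ℝ) ^ n / ((n ! : ℝ) * Real.Gamma ((n : ℝ) + ν + 1)) * (n * y ^ (n - 1))‖ ≤
        C * (n * r ^ (n - 1) / n !) := by
    intro n y hy
    have h : (-1 : ℝ) ^ n / ((n ! : ℝ) * Real.Gamma ((n : ℝ) + ν + 1)) * (n * y ^ (n - 1)) =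
      (Real.Gamma (n + ν + 1))⁻¹ * ((-1) ^ n * (n * y ^ (n - 1) / n !)) := by
      rw [div_eq_mul_inv, mul_inv]; ring
    rw [h, norm_mul]
    refine mul_le_mul (hC n) ?_ (norm_nonneg _) hC0
    rw [norm_mul, norm_pow, norm_neg, norm_one, one_pow, one_mul, norm_div, norm_mul, norm_pow]
    simp only [Real.norm_natCast]
    gcongr
    simpa using (mem_ball_zero_iff.1 hy).le
  have hz : z ∈ Metric.ball (0 : ℝ) r := by simp [r]
  refine ⟨Summable.of_norm_bounded hu fun n => hb n z hz, ?_⟩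
  refine hasDerivAt_tsum_of_isPreconnected hu Metric.isOpen_ball
    (convex_ball (0 : ℝ) r).isPreconnected (fun n y _ => ?_) hb hz (summable_besselSeries ν z) hz
  exact (hasDerivAt_pow n y).const_mul _

theorem hasDerivAt_besselSeries (ν z : ℝ) :
    HasDerivAt (besselSeries ν) (-besselSeries (ν + 1) z) z := by
  obtain ⟨hs, hd⟩ := hasDerivAt_besselSeries_aux ν z
  convert! hd using 1
  rw [hs.tsum_eq_zero_add, besselSeries, ← tsum_neg]
  simp only [Nat.cast_zero, zero_mul, mul_zero, zero_add]
  refine tsum_congr fun n => ?_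
  have h1 : (n : ℝ) + 1 ≠ 0 := by positivity
  have h2 : (n ! : ℝ) ≠ 0 := by positivity
  rw [Nat.factorial_succ, Nat.add_sub_cancel]
  push_cast
  rw [show (n : ℝ) + 1 + ν + 1 = n + (ν + 1) + 1 by ring, pow_succ]
  rw [div_eq_mul_inv, div_eq_mul_inv, mul_inv, mul_inv, mul_inv]
  field_simp

/-- The factor `n + ν` in `1/Γ(n+ν) = (n+ν)/Γ(n+ν+1)` splits the series into `ν` times itself and
`z` times its derivative. -/
theorem besselSeries_sub_one (ν z : ℝ) :
    besselSeries (ν - 1) z = ν * besselSeries ν z - z * besselSeries (ν + 1) z := by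
  obtain ⟨hs, hd⟩ := hasDerivAt_besselSeries_aux ν z
  have h := hd.unique (hasDerivAt_besselSeries ν z)
  have h2 : besselSeries (ν - 1) z = ν * besselSeries ν z + z *
      ∑' n : ℕ, (-1 : ℝ) ^ n / ((n ! : ℝ) * Real.Gamma ((n : ℝ) + ν + 1)) * (n * z ^ (n - 1)) := by
    rw [besselSeries, besselSeries, ← tsum_mul_left, ← tsum_mul_left,
      ← ((summable_besselSeries ν z).mul_left ν).tsum_add (hs.mul_left z)]
    refine tsum_congr fun n => ?_
    have h3 : (Real.Gamma ((n : ℝ) + (ν - 1) + 1))⁻¹ =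
        (n + ν) * (Real.Gamma ((n : ℝ) + ν + 1))⁻¹ := by
      rw [show (n : ℝ) + (ν - 1) + 1 = n + ν by ring]
      -- At `n + ν = 0` both sides vanish because `Real.Gamma 0 = 0` and `0⁻¹ = 0`.
      rcases eq_or_ne ((n : ℝ) + ν) 0 with h0 | h0
      · simp [h0]
      · rw [Real.Gamma_add_one h0, mul_inv, mul_inv_cancel_left₀ h0]
    have h4 : z * (n * z ^ (n - 1)) = n * z ^ n := by
      rcases n with _ | n
      · simp
      · rw [Nat.add_sub_cancel, pow_succ]; ring
    rw [mul_left_comm z, h4, div_eq_mul_inv, div_eq_mul_inv, mul_inv, mul_inv, h3]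
    ring
  rw [h2, h]; ring

theorem besselSeries_zero (ν : ℝ) : besselSeries ν 0 = (Real.Gamma (ν + 1))⁻¹ := by
  rw [besselSeries, tsum_eq_single 0]
  · simp
  · intro n hn; simp [hn]

theorem continuous_besselSeries (ν : ℝ) : Continuous (besselSeries ν) :=
  continuous_iff_continuousAt.2 fun z => (hasDerivAt_besselSeries ν z).continuousAt

theorem besselJ_eq (ν : ℝ) {x : ℝ} (hx : 0 < x) :
    besselJ ν x = (x / 2) ^ ν * besselSeries ν ((x / 2) ^ 2) := by
  rw [besselJ, besselSeries, ← tsum_mul_left]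
  refine tsum_congr fun n => ?_
  have hx2 : 0 < x / 2 := by positivity
  rw [Real.rpow_add hx2, show (2 : ℝ) * n = ((2 * n : ℕ) : ℝ) by push_cast; ring,
    Real.rpow_natCast, pow_mul]
  ring

theorem besselJ_recurrence (ν : ℝ) {x : ℝ} (hx : 0 < x) :
    besselJ (ν - 1) x = 2 * ν / x * besselJ ν x - besselJ (ν + 1) x := by
  have hx2 : 0 < x / 2 := by positivity
  rw [besselJ_eq _ hx, besselJ_eq _ hx, besselJ_eq _ hx, besselSeries_sub_one,
    Real.rpow_sub_one hx2.ne', Real.rpow_add_one hx2.ne']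
  field_simp

theorem hasDerivAt_besselJ (ν : ℝ) {x : ℝ} (hx : 0 < x) :
    HasDerivAt (besselJ ν) (ν / x * besselJ ν x - besselJ (ν + 1) x) x := by
  have hx2 : 0 < x / 2 := by positivity
  have h1 : HasDerivAt (fun y : ℝ => y / 2) (1 / 2) x := (hasDerivAt_id x).div_const 2
  have h2 := h1.rpow_const (p := ν) (Or.inl hx2.ne')
  have h3 := (hasDerivAt_besselSeries ν ((x / 2) ^ 2)).comp x (h1.fun_pow 2)
  have h4 := h2.mul h3
  have h5 : HasDerivAt (besselJ ν) _ x := h4.congr_of_eventuallyEq (by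
    filter_upwards [lt_mem_nhds hx] with y hy
    simp [besselJ_eq ν hy])
  convert! h5 using 1
  rw [besselJ_eq _ hx, besselJ_eq _ hx, Real.rpow_sub_one hx2.ne', Real.rpow_add_one hx2.ne']
  simp only [Function.comp_apply, Nat.cast_ofNat]
  field_simp
  ring

theorem hasDerivAt_besselJ' (ν : ℝ) {x : ℝ} (hx : 0 < x) :
    HasDerivAt (besselJ ν) (besselJ (ν - 1) x - ν / x * besselJ ν x) x := by
  convert! hasDerivAt_besselJ ν hx using 1
  rw [besselJ_recurrence ν hx]; ring

/-! ### Functions of the second kind and Hankel functions. -/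

theorem sin_sub_one_mul_pi (ν : ℝ) : Real.sin ((ν - 1) * Real.pi) = -Real.sin (ν * Real.pi) := by
  rw [sub_mul, one_mul, Real.sin_sub_pi]

theorem cos_sub_one_mul_pi (ν : ℝ) : Real.cos ((ν - 1) * Real.pi) = -Real.cos (ν * Real.pi) := by
  rw [sub_mul, one_mul, Real.cos_sub_pi]

/-- `J_ν` is differentiated by lowering its order and `J_{-ν}` by raising it, so that the orders `ν
- 1` and `-(ν - 1)` appear together. The sign changes of sine and cosine then reassemble them into
`Y_{ν-1}`. Integer `ν` causes no trouble: both quotients are then 0. -/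
theorem hasDerivAt_besselY (ν : ℝ) {x : ℝ} (hx : 0 < x) :
    HasDerivAt (besselY ν) (besselY (ν - 1) x - ν / x * besselY ν x) x := by
  have h := (((hasDerivAt_besselJ' ν hx).mul_const (Real.cos (ν * Real.pi))).sub
    (hasDerivAt_besselJ (-ν) hx)).div_const (Real.sin (ν * Real.pi))
  convert! h using 1
  rw [besselY, besselY, sin_sub_one_mul_pi, cos_sub_one_mul_pi,
    show -(ν - 1) = -ν + 1 by ring]
  simp only [div_eq_mul_inv, inv_neg]
  ring

theorem hasDerivAt_besselY_sub_one (ν : ℝ) {x : ℝ} (hx : 0 < x) :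
    HasDerivAt (besselY (ν - 1)) (-besselY ν x + (ν - 1) / x * besselY (ν - 1) x) x := by
  have h := (((hasDerivAt_besselJ (ν - 1) hx).mul_const (Real.cos ((ν - 1) * Real.pi))).sub
    (hasDerivAt_besselJ' (-(ν - 1)) hx)).div_const (Real.sin ((ν - 1) * Real.pi))
  convert! h using 1
  rw [besselY, besselY, sin_sub_one_mul_pi, cos_sub_one_mul_pi,
    show -(ν - 1) - 1 = -ν by ring, sub_add_cancel]
  simp only [div_eq_mul_inv, inv_neg]
  ring

theorem hasDerivAt_hankel1 (ν : ℝ) {x : ℝ} (hx : 0 < x) :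
    HasDerivAt (hankel1 ν) (hankel1 (ν - 1) x - (ν / x : ℝ) * hankel1 ν x) x := by
  have h := (hasDerivAt_besselJ' ν hx).ofReal_comp.add
    ((hasDerivAt_besselY ν hx).ofReal_comp.const_mul Complex.I)
  convert! h using 1
  simp only [hankel1]; push_cast; ring

theorem continuousOn_hankel1 (ν : ℝ) : ContinuousOn (hankel1 ν) (Set.Ioi 0) := fun _ hx =>
  (hasDerivAt_hankel1 ν hx).continuousAt.continuousWithinAt

/-- Solutions of the first-order system equivalent to Bessel's equation are `O(x^{-1/2})`. -/
theorem exists_bound_of_bessel_system {ν : ℝ} {p q : ℝ → ℝ}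
    (hp : ∀ x, 0 < x → HasDerivAt p (q x - ν / x * p x) x)
    (hq : ∀ x, 0 < x → HasDerivAt q (-p x + (ν - 1) / x * q x) x) :
    ∃ C : ℝ, ∀ x, 1 + |2 * ν - 1| ≤ x → x * (p x ^ 2 + q x ^ 2) ≤ C := by
  set a := 2 * ν - 1 with ha
  set x₀ := 1 + |a| with hx₀
  have ha0 := abs_nonneg a
  -- The derivative of `x (p² + q²)` is `a (q² - p²)`, which does not decay relative to `p² + q²`.
  -- Subtracting `a p q` cancels it and leaves only `(a/x) p q`.
  set E : ℝ → ℝ := fun x => x * (p x ^ 2 + q x ^ 2) - a * (p x * q x) with hE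
  have hEd : ∀ x, 0 < x → HasDerivAt E (a / x * (p x * q x)) x := by
    intro x hx
    have h := ((hasDerivAt_id x).mul (((hp x hx).fun_pow 2).add ((hq x hx).fun_pow 2))).sub
      (((hp x hx).mul (hq x hx)).const_mul a)
    convert! h using 1
    simp only [id, Pi.add_apply]
    rw [ha]; field_simp; ring
  have hE1 : ∀ x, x₀ ≤ x → x * (p x ^ 2 + q x ^ 2) ≤ 2 * E x := by
    intro x hx
    have h1 : a * (p x * q x) ≤ |a| * ((p x ^ 2 + q x ^ 2) / 2) := by
      refine (le_abs_self _).trans ?_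
      rw [abs_mul]
      refine mul_le_mul_of_nonneg_left ?_ ha0
      rw [abs_le]; constructor <;> nlinarith [sq_nonneg (p x + q x), sq_nonneg (p x - q x)]
    have h2 : |a| * ((p x ^ 2 + q x ^ 2) / 2) ≤ x * ((p x ^ 2 + q x ^ 2) / 2) := by
      refine mul_le_mul_of_nonneg_right (by linarith) (by positivity)
    simp only [hE]; linarith
  -- From `x (p² + q²) ≤ 2E` follows `E' ≤ (|a|/x²) E`, and `exp(|a|/x)` is the integrating factor
  -- of this inequality.
  have hanti : AntitoneOn (fun x => E x * Real.exp (|a| / x)) (Set.Ici x₀) := by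
    refine antitoneOn_of_hasDerivWithinAt_nonpos (f' := fun x => (a / x * (p x * q x)) * Real.exp (|a| / x) + E x * (Real.exp (|a| / x) * (-|a| / x ^ 2))) (convex_Ici x₀) ?_ ?_ ?_
    · intro x hx
      have hx0 : 0 < x := by have := Set.mem_Ici.1 hx; linarith
      have := ((hEd x hx0).continuousAt.mul
        ((continuousAt_const (y := |a|)).div continuousAt_id hx0.ne').rexp)
      exact this.continuousWithinAt
    · intro x hx
      rw [interior_Ici] at hx
      have hx0 : 0 < x := by have := Set.mem_Ioi.1 hx; linarith
      have h1 : HasDerivAt (fun x : ℝ => |a| / x) (-|a| / x ^ 2) x := by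
        have := (hasDerivAt_inv hx0.ne').const_mul |a|
        convert! this using 1; field_simp
      exact ((hEd x hx0).mul h1.exp).hasDerivWithinAt
    · intro x hx
      rw [interior_Ici] at hx
      have hx1 : x₀ ≤ x := (Set.mem_Ioi.1 hx).le
      have hx0 : 0 < x := by linarith
      have h1 : a / x * (p x * q x) ≤ |a| / x ^ 2 * E x := by
        have h2 : a * (p x * q x) ≤ |a| * ((p x ^ 2 + q x ^ 2) / 2) := by
          refine (le_abs_self _).trans ?_
          rw [abs_mul]
          refine mul_le_mul_of_nonneg_left ?_ ha0
          rw [abs_le]; constructor <;> nlinarith [sq_nonneg (p x + q x), sq_nonneg (p x - q x)]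
        have h3 : |a| / x ^ 2 * E x ≥ |a| / x ^ 2 * (x * (p x ^ 2 + q x ^ 2) / 2) :=
          mul_le_mul_of_nonneg_left (by linarith [hE1 x hx1]) (by positivity)
        have h4 : |a| / x ^ 2 * (x * (p x ^ 2 + q x ^ 2) / 2) =
            (|a| * ((p x ^ 2 + q x ^ 2) / 2)) / x := by field_simp
        have h5 : a / x * (p x * q x) = (a * (p x * q x)) / x := by ring
        rw [h5]; rw [h4] at h3
        exact (div_le_div_of_nonneg_right h2 hx0.le).trans h3
      have h6 : (a / x * (p x * q x)) * Real.exp (|a| / x) +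
          E x * (Real.exp (|a| / x) * (-|a| / x ^ 2)) =
          (a / x * (p x * q x) - |a| / x ^ 2 * E x) * Real.exp (|a| / x) := by ring
      rw [h6]
      exact mul_nonpos_of_nonpos_of_nonneg (by linarith) (Real.exp_pos _).le
  refine ⟨2 * (E x₀ * Real.exp (|a| / x₀)), fun x hx => (hE1 x hx).trans ?_⟩
  have h1 : E x * Real.exp (|a| / x) ≤ E x₀ * Real.exp (|a| / x₀) := hanti Set.self_mem_Ici hx hx
  have hx0 : 0 < x := by linarith
  have hEx : 0 ≤ E x := by
    have := hE1 x hx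
    have : 0 ≤ x * (p x ^ 2 + q x ^ 2) := by positivity
    linarith
  have h2 : E x ≤ E x * Real.exp (|a| / x) :=
    le_mul_of_one_le_right hEx (Real.one_le_exp (by positivity))
  linarith

/-! ### Size of the Hankel functions at infinity and at the origin. -/

theorem norm_hankel1_sq (ν x : ℝ) : ‖hankel1 ν x‖ ^ 2 = besselJ ν x ^ 2 + besselY ν x ^ 2 := by
  rw [hankel1, mul_comm, ← Complex.normSq_eq_norm_sq, Complex.normSq_add_mul_I]

theorem exists_bound_hankel1_atTop (ν : ℝ) : ∃ C : ℝ, ∀ x, 1 + |2 * ν - 1| ≤ x →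
    x * (‖hankel1 ν x‖ ^ 2 + ‖hankel1 (ν - 1) x‖ ^ 2) ≤ C := by
  obtain ⟨C₁, h₁⟩ := exists_bound_of_bessel_system (ν := ν)
    (fun x hx => hasDerivAt_besselJ' ν hx) (fun x hx => by
      have := hasDerivAt_besselJ (ν - 1) hx
      rw [sub_add_cancel] at this
      convert! this using 1; ring)
  obtain ⟨C₂, h₂⟩ := exists_bound_of_bessel_system (ν := ν)
    (fun x hx => hasDerivAt_besselY ν hx) (fun x hx => hasDerivAt_besselY_sub_one ν hx)
  refine ⟨C₁ + C₂, fun x hx => ?_⟩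
  rw [norm_hankel1_sq, norm_hankel1_sq]
  linarith [h₁ x hx, h₂ x hx]

/-- The singular part comes from `J_{-ν}` inside `Y_ν`, since `x^ν J_ν → 0`. The limit is `-i 2^ν /
(Γ(1-ν) sin νπ)`; a non-integer `ν` keeps the sine away from zero and `1 - ν` away from the poles of
Γ. -/
theorem exists_tendsto_hankel1_zero {ν : ℝ} (hν : 0 < ν) (hν' : ∀ n : ℕ, ν ≠ n) :
    ∃ c : ℂ, c ≠ 0 ∧
      Tendsto (fun x : ℝ => ((x ^ ν : ℝ) : ℂ) * hankel1 ν x) (𝓝[>] 0) (𝓝 c) := by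
  have hsin : Real.sin (ν * Real.pi) ≠ 0 := by
    intro h
    obtain ⟨n, hn⟩ := Real.sin_eq_zero_iff.1 h
    have h2 : (n : ℝ) = ν := mul_right_cancel₀ Real.pi_ne_zero hn
    have h3 : 0 ≤ n := by
      have : (0 : ℝ) < n := by rw [h2]; exact hν
      exact_mod_cast this.le
    lift n to ℕ using h3
    exact hν' n (by rw [← h2]; simp)
  have hG : Real.Gamma (-ν + 1) ≠ 0 := by
    refine Real.Gamma_ne_zero fun m hm => hν' (m + 1) ?_
    push_cast; linarith
  have hsq : Tendsto (fun x : ℝ => (x / 2) ^ 2) (𝓝[>] 0) (𝓝 0) := by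
    have : Tendsto (fun x : ℝ => (x / 2) ^ 2) (𝓝 0) (𝓝 ((0 / 2) ^ 2)) :=
      (Continuous.tendsto (by fun_prop) 0)
    simpa using this.mono_left nhdsWithin_le_nhds
  have hJ : Tendsto (fun x : ℝ => x ^ ν * besselJ ν x) (𝓝[>] 0) (𝓝 0) := by
    have h1 : Tendsto (fun x : ℝ => x ^ ν * (x / 2) ^ ν * besselSeries ν ((x / 2) ^ 2)) (𝓝[>] 0)
        (𝓝 (0 ^ ν * (0 / 2) ^ ν * besselSeries ν 0)) := by
      have hb := ((continuous_besselSeries ν).tendsto 0).comp hsq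
      have hc : Tendsto (fun x : ℝ => x ^ ν * (x / 2) ^ ν) (𝓝 0) (𝓝 (0 ^ ν * (0 / 2) ^ ν)) :=
        ((Real.continuousAt_rpow_const _ _ (Or.inr hν.le)).mul
          ((continuousAt_id.div_const 2).rpow_const (Or.inr hν.le)))
      exact (hc.mono_left nhdsWithin_le_nhds).mul hb
    rw [Real.zero_rpow hν.ne', zero_mul, zero_mul] at h1
    refine h1.congr' ?_
    filter_upwards [self_mem_nhdsWithin] with x hx
    rw [besselJ_eq ν hx, mul_assoc]
  have hJ' : Tendsto (fun x : ℝ => x ^ ν * besselJ (-ν) x) (𝓝[>] 0)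
      (𝓝 (2 ^ ν * (Real.Gamma (-ν + 1))⁻¹)) := by
    have h1 := (((continuous_besselSeries (-ν)).tendsto 0).comp hsq).const_mul ((2 : ℝ) ^ ν)
    rw [besselSeries_zero] at h1
    refine h1.congr' ?_
    filter_upwards [self_mem_nhdsWithin] with x (hx : 0 < x)
    rw [besselJ_eq (-ν) hx, Real.rpow_neg (by positivity), Real.div_rpow hx.le zero_le_two,
      Function.comp_apply]
    have : (0 : ℝ) < x ^ ν := by positivity
    field_simp
  have hY : Tendsto (fun x : ℝ => x ^ ν * besselY ν x) (𝓝[>] 0)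
      (𝓝 ((0 * Real.cos (ν * Real.pi) - 2 ^ ν * (Real.Gamma (-ν + 1))⁻¹) /
        Real.sin (ν * Real.pi))) := by
    refine (((hJ.mul_const _).sub hJ').div_const _).congr fun x => ?_
    rw [besselY]; ring
  refine ⟨Complex.I * (((0 * Real.cos (ν * Real.pi) - 2 ^ ν * (Real.Gamma (-ν + 1))⁻¹) /
        Real.sin (ν * Real.pi) : ℝ) : ℂ), ?_, ?_⟩
  · refine mul_ne_zero Complex.I_ne_zero ?_
    rw [Complex.ofReal_ne_zero]
    refine div_ne_zero ?_ hsin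
    rw [zero_mul, zero_sub]
    exact neg_ne_zero.2 (mul_ne_zero (by positivity) (inv_ne_zero hG))
  · have hcont := (Complex.continuous_ofReal.tendsto _).comp hJ
    have hcont2 := ((Complex.continuous_ofReal.tendsto _).comp hY).const_mul Complex.I
    have := hcont.add hcont2
    simp only [Complex.ofReal_zero, zero_add] at this
    refine this.congr fun x => ?_
    simp only [Function.comp_apply, hankel1]; push_cast; ring

/-- A continuous function on the half-line behaving like `x^{-α}` at the origin and
`O(x^{-1/2})` at infinity. -/
theorem exists_global_bound {h : ℝ → ℂ} {α x₀ C : ℝ} {c : ℂ} (hc : ContinuousOn h (Set.Ioi 0))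
    (h0 : Tendsto (fun x : ℝ => ((x ^ α : ℝ) : ℂ) * h x) (𝓝[>] 0) (𝓝 c))
    (hx₀ : 1 ≤ x₀) (hC : ∀ x, x₀ ≤ x → x * ‖h x‖ ^ 2 ≤ C) :
    ∃ K : ℝ, 0 ≤ K ∧ (∀ x, 0 < x → x ≤ 1 → ‖h x‖ ≤ K * x ^ (-α)) ∧
      ∀ x, 1 ≤ x → ‖h x‖ ≤ K * x ^ (-(1 / 2) : ℝ) := by
  have h1 : ∀ᶠ x : ℝ in 𝓝[>] 0, ‖((x ^ α : ℝ) : ℂ) * h x‖ < ‖c‖ + 1 :=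
    h0.norm.eventually (gt_mem_nhds (by linarith))
  obtain ⟨δ, hδ, hδ'⟩ := mem_nhdsGT_iff_exists_Ioo_subset.1 h1
  have hδ0 : 0 < δ := hδ
  set δ' := min (δ / 2) 1
  have hδ'0 : 0 < δ' := by positivity
  obtain ⟨K₁, hK₁⟩ := (isCompact_Icc (a := δ') (b := x₀)).exists_bound_of_continuousOn
    (f := fun x : ℝ => (((x ^ α + x ^ (1 / 2 : ℝ)) : ℝ) : ℂ) * h x) (by
      refine ContinuousOn.mul ?_ (hc.mono fun x hx => lt_of_lt_of_le hδ'0 hx.1)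
      refine Complex.continuous_ofReal.comp_continuousOn ?_
      refine ContinuousOn.add ?_ ?_ <;>
      exact fun x hx => (Real.continuousAt_rpow_const _ _
        (Or.inl (lt_of_lt_of_le hδ'0 hx.1).ne')).continuousWithinAt)
  have hK₁0 : 0 ≤ K₁ := (norm_nonneg _).trans (hK₁ δ' ⟨le_rfl, (min_le_right _ _).trans hx₀⟩)
  have hmid : ∀ x, δ' ≤ x → x ≤ x₀ → x ^ α * ‖h x‖ ≤ K₁ ∧ x ^ (1 / 2 : ℝ) * ‖h x‖ ≤ K₁ := by
    intro x hx hx'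
    have hx0 : 0 < x := hδ'0.trans_le hx
    have h2 := hK₁ x ⟨hx, hx'⟩
    have h3 : 0 < x ^ α := by positivity
    have h4 : 0 < x ^ (1 / 2 : ℝ) := by positivity
    rw [norm_mul, Complex.norm_real, Real.norm_of_nonneg (by positivity), add_mul] at h2
    have := mul_nonneg h3.le (norm_nonneg (h x))
    have := mul_nonneg h4.le (norm_nonneg (h x))
    constructor <;> linarith
  have hC0 : 0 ≤ C := le_trans (by positivity) (hC x₀ le_rfl)
  refine ⟨‖c‖ + 1 + K₁ + √C, by positivity, fun x hx hx1 => ?_, fun x hx => ?_⟩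
  · rw [Real.rpow_neg hx.le, ← div_eq_mul_inv, le_div_iff₀ (by positivity), mul_comm]
    rcases lt_or_ge x δ' with hxδ | hxδ
    · have h2 : ‖((x ^ α : ℝ) : ℂ) * h x‖ < ‖c‖ + 1 := hδ' ⟨hx, hxδ.trans_le ((min_le_left _ _).trans
        (by linarith))⟩
      rw [norm_mul, Complex.norm_real, Real.norm_of_nonneg (by positivity)] at h2
      have := Real.sqrt_nonneg C
      linarith
    · have := (hmid x hxδ (hx1.trans hx₀)).1
      have := Real.sqrt_nonneg C
      have := norm_nonneg c
      linarith
  · have hx0 : 0 < x := by linarith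
    rw [Real.rpow_neg hx0.le, ← div_eq_mul_inv, le_div_iff₀ (by positivity), mul_comm]
    rcases le_or_gt x x₀ with hxx | hxx
    · have := (hmid x ((min_le_right _ _).trans hx) hxx).2
      have := Real.sqrt_nonneg C
      have := norm_nonneg c
      linarith
    · have h2 : x ^ (1 / 2 : ℝ) * ‖h x‖ ≤ √C := by
        refine Real.le_sqrt_of_sq_le ?_
        rw [mul_pow, ← Real.sqrt_eq_rpow, Real.sq_sqrt hx0.le]
        exact hC x hxx.le
      have := norm_nonneg c
      linarith

/-- The uniform estimates on `H_ν` and `H_{ν-1}` that are used for `1 < ν < 3/2`. -/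
structure HankelBounds (ν K : ℝ) : Prop where
  nonneg : 0 ≤ K
  bound : ∀ x, 0 < x → ‖hankel1 ν x‖ ≤ K * (x ^ (-ν) + x ^ (-(1 / 2) : ℝ))
  bound_half : ∀ x, 0 < x → x * ‖hankel1 (ν - 1) x‖ ≤ K * x ^ (1 / 2 : ℝ)
  bound_rpow : ∀ x, 0 < x → x * ‖hankel1 (ν - 1) x‖ ≤ K * x ^ (2 - ν)
  deriv_bound : ∀ x, 0 < x →
    ∃ M', HasDerivAt (fun y => y ^ 2 * ‖hankel1 (ν - 1) y‖ ^ 2) M' x ∧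
      |M'| ≤ K * (x ^ (3 - 2 * ν) + x)

/-- Near the origin `x |H_{ν-1}|` is of order `x^{2-ν}`, at infinity of order `x^{1/2}`. As `1/2 < 2
- ν` for `ν < 3/2`, each of the two powers bounds it on the whole half-line. -/
theorem exists_hankelBounds {ν : ℝ} (h1 : 1 < ν) (h2 : ν < 3 / 2) : ∃ K, HankelBounds ν K := by
  have hn : ∀ n : ℕ, ν ≠ n := by
    rintro n rfl
    have : 1 < n := by exact_mod_cast h1
    have : (2 : ℝ) ≤ n := by exact_mod_cast this
    linarith
  have hn' : ∀ n : ℕ, ν - 1 ≠ n := by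
    intro n hn'
    exact hn (n + 1) (by push_cast; linarith)
  obtain ⟨c, -, hc⟩ := exists_tendsto_hankel1_zero (by linarith) hn
  obtain ⟨c', -, hc'⟩ := exists_tendsto_hankel1_zero (by linarith) hn'
  obtain ⟨C, hC⟩ := exists_bound_hankel1_atTop ν
  have hx0 : (1 : ℝ) ≤ 1 + |2 * ν - 1| := by linarith [abs_nonneg (2 * ν - 1)]
  obtain ⟨K₁, hK₁, hP, hP'⟩ := exists_global_bound (continuousOn_hankel1 ν) hc hx0
    (fun x hx => (by
      have := hC x hx
      have h3 : 0 ≤ x * ‖hankel1 (ν - 1) x‖ ^ 2 := mul_nonneg (by linarith) (by positivity)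
      linarith : x * ‖hankel1 ν x‖ ^ 2 ≤ C))
  obtain ⟨K₂, hK₂, hQ, hQ'⟩ := exists_global_bound (continuousOn_hankel1 (ν - 1)) hc' hx0
    (fun x hx => (by
      have := hC x hx
      have h3 : 0 ≤ x * ‖hankel1 ν x‖ ^ 2 := mul_nonneg (by linarith) (by positivity)
      linarith : x * ‖hankel1 (ν - 1) x‖ ^ 2 ≤ C))
  have hhalf : ∀ x, 0 < x → x * ‖hankel1 (ν - 1) x‖ ≤ K₂ * x ^ (1 / 2 : ℝ) := by
    intro x hx
    rcases le_total x 1 with h | h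
    · calc x * ‖hankel1 (ν - 1) x‖ ≤ x * (K₂ * x ^ (-(ν - 1))) :=
            mul_le_mul_of_nonneg_left (hQ x hx h) hx.le
        _ = K₂ * x ^ (1 + -(ν - 1)) := by rw [Real.rpow_add hx, Real.rpow_one]; ring
        _ ≤ K₂ * x ^ (1 / 2 : ℝ) := mul_le_mul_of_nonneg_left
            (Real.rpow_le_rpow_of_exponent_ge hx h (by linarith)) hK₂
    · calc x * ‖hankel1 (ν - 1) x‖ ≤ x * (K₂ * x ^ (-(1 / 2) : ℝ)) :=
            mul_le_mul_of_nonneg_left (hQ' x h) hx.le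
        _ = K₂ * x ^ (1 + -(1 / 2) : ℝ) := by rw [Real.rpow_add hx, Real.rpow_one]; ring
        _ = K₂ * x ^ (1 / 2 : ℝ) := by norm_num
  have hrpow : ∀ x, 0 < x → x * ‖hankel1 (ν - 1) x‖ ≤ K₂ * x ^ (2 - ν) := by
    intro x hx
    rcases le_total x 1 with h | h
    · calc x * ‖hankel1 (ν - 1) x‖ ≤ x * (K₂ * x ^ (-(ν - 1))) :=
            mul_le_mul_of_nonneg_left (hQ x hx h) hx.le
        _ = K₂ * x ^ (1 + -(ν - 1)) := by rw [Real.rpow_add hx, Real.rpow_one]; ring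
        _ = K₂ * x ^ (2 - ν) := by congr 2; ring
    · exact (hhalf x hx).trans (mul_le_mul_of_nonneg_left
        (Real.rpow_le_rpow_of_exponent_le h (by linarith)) hK₂)
  have hb : ∀ x, 0 < x → ‖hankel1 ν x‖ ≤ K₁ * (x ^ (-ν) + x ^ (-(1 / 2) : ℝ)) := by
    intro x hx
    have h3 : 0 < x ^ (-ν) := by positivity
    have h4 : 0 < x ^ (-(1 / 2) : ℝ) := by positivity
    rcases le_total x 1 with h | h
    · exact (hP x hx h).trans (mul_le_mul_of_nonneg_left (by linarith) hK₁)
    · exact (hP' x h).trans (mul_le_mul_of_nonneg_left (by linarith) hK₁)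
  have hprod : ∀ x, 0 < x → x ^ 2 * (‖hankel1 (ν - 1) x‖ * ‖hankel1 ν x‖) ≤
      2 * K₂ * K₁ * (x ^ (3 - 2 * ν) + x) := by
    intro x hx
    have e0 : 0 ≤ x ^ (3 - 2 * ν) := by positivity
    have hnn := norm_nonneg (hankel1 ν x)
    rcases le_total x 1 with h | h
    · calc x ^ 2 * (‖hankel1 (ν - 1) x‖ * ‖hankel1 ν x‖)
          = x * ((x * ‖hankel1 (ν - 1) x‖) * ‖hankel1 ν x‖) := by ring
        _ ≤ x * ((K₂ * x ^ (2 - ν)) * (K₁ * x ^ (-ν))) := by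
            refine mul_le_mul_of_nonneg_left ?_ hx.le
            exact mul_le_mul (hrpow x hx) (hP x hx h) hnn (by positivity)
        _ = K₂ * K₁ * x ^ (3 - 2 * ν) := by
            rw [show 3 - 2 * ν = 1 + (2 - ν) + -ν by ring, Real.rpow_add hx, Real.rpow_add hx,
              Real.rpow_one]; ring
        _ ≤ _ := by
            have := mul_nonneg hK₂ hK₁
            nlinarith [mul_nonneg this e0, mul_nonneg this hx.le]
    · calc x ^ 2 * (‖hankel1 (ν - 1) x‖ * ‖hankel1 ν x‖)
          = x * ((x * ‖hankel1 (ν - 1) x‖) * ‖hankel1 ν x‖) := by ring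
        _ ≤ x * ((K₂ * x ^ (1 / 2 : ℝ)) * (K₁ * x ^ (-(1 / 2) : ℝ))) := by
            refine mul_le_mul_of_nonneg_left ?_ hx.le
            exact mul_le_mul (hhalf x hx) (hP' x h) hnn (by positivity)
        _ = K₂ * K₁ * x * (x ^ (1 / 2 : ℝ) * x ^ (-(1 / 2) : ℝ)) := by ring
        _ = K₂ * K₁ * x := by rw [← Real.rpow_add hx]; norm_num
        _ ≤ _ := by
            have := mul_nonneg hK₂ hK₁
            nlinarith [mul_nonneg this e0, mul_nonneg this hx.le]
  have hsq : ∀ x, 0 < x → x * ‖hankel1 (ν - 1) x‖ ^ 2 ≤ K₂ ^ 2 * (x ^ (3 - 2 * ν) + x) := by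
    intro x hx
    have e0 : 0 ≤ x ^ (3 - 2 * ν) := by positivity
    have h3 := hrpow x hx
    have h4 : (x * ‖hankel1 (ν - 1) x‖) ^ 2 ≤ (K₂ * x ^ (2 - ν)) ^ 2 :=
      pow_le_pow_left₀ (by positivity) h3 2
    have h5 : (x ^ (2 - ν)) ^ 2 = x * x ^ (3 - 2 * ν) := by
      rw [← Real.rpow_natCast, ← Real.rpow_mul hx.le]
      nth_rewrite 2 [← Real.rpow_one x]
      rw [← Real.rpow_add hx]; congr 1; push_cast; ring
    have h6 : x * (x * ‖hankel1 (ν - 1) x‖ ^ 2) ≤ x * (K₂ ^ 2 * x ^ (3 - 2 * ν)) := by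
      rw [mul_pow, mul_pow, h5] at h4; nlinarith
    have h7 := le_of_mul_le_mul_left h6 hx
    nlinarith [mul_nonneg (sq_nonneg K₂) hx.le]
  set K := max K₁ (max K₂ (2 * ν * K₂ ^ 2 + 2 * (2 * K₂ * K₁))) with hK
  have hK1 : K₁ ≤ K := le_max_left _ _
  have hK2 : K₂ ≤ K := (le_max_left _ _).trans (le_max_right _ _)
  have hK3 : 2 * ν * K₂ ^ 2 + 2 * (2 * K₂ * K₁) ≤ K := (le_max_right _ _).trans (le_max_right _ _)
  refine ⟨K, hK₁.trans hK1, fun x hx => (hb x hx).trans ?_, fun x hx => (hhalf x hx).trans ?_,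
    fun x hx => (hrpow x hx).trans ?_, fun x hx => ?_⟩
  · exact mul_le_mul_of_nonneg_right hK1 (by positivity)
  · exact mul_le_mul_of_nonneg_right hK2 (by positivity)
  · exact mul_le_mul_of_nonneg_right hK2 (by positivity)
  · have hJ := hasDerivAt_besselJ (ν - 1) hx
    rw [sub_add_cancel] at hJ
    have hY := hasDerivAt_besselY_sub_one ν hx
    have hd := ((hasDerivAt_id x).fun_pow 2).mul ((hJ.fun_pow 2).add (hY.fun_pow 2))
    -- The derivative of `x² |H_{ν-1}|²` is `2ν x |H_{ν-1}|² - 2x² Re(H_{ν-1} conj H_ν)`. Near the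
    -- origin both terms are of order `x^{3-2ν}`, at infinity at most of order `x`.
    refine ⟨2 * ν * (x * ‖hankel1 (ν - 1) x‖ ^ 2) - 2 * (x ^ 2 *
      (besselJ (ν - 1) x * besselJ ν x + besselY (ν - 1) x * besselY ν x)), ?_, ?_⟩
    · simp only [norm_hankel1_sq]
      convert! hd using 1
      simp only [id, Pi.add_apply, Nat.cast_ofNat]
      field_simp; ring
    · have h3 : |besselJ (ν - 1) x * besselJ ν x + besselY (ν - 1) x * besselY ν x| ≤
          ‖hankel1 (ν - 1) x‖ * ‖hankel1 ν x‖ := by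
        refine abs_le_of_sq_le_sq ?_ (by positivity)
        rw [mul_pow, norm_hankel1_sq, norm_hankel1_sq]
        nlinarith [sq_nonneg (besselJ (ν - 1) x * besselY ν x - besselY (ν - 1) x * besselJ ν x)]
      have h4 := hprod x hx
      have h5 := hsq x hx
      have h6 : 0 ≤ x * ‖hankel1 (ν - 1) x‖ ^ 2 := by positivity
      have h7 : 0 ≤ x ^ (3 - 2 * ν) + x := by positivity
      calc |2 * ν * (x * ‖hankel1 (ν - 1) x‖ ^ 2) - 2 * (x ^ 2 *
            (besselJ (ν - 1) x * besselJ ν x + besselY (ν - 1) x * besselY ν x))|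
          ≤ |2 * ν * (x * ‖hankel1 (ν - 1) x‖ ^ 2)| + |2 * (x ^ 2 *
            (besselJ (ν - 1) x * besselJ ν x + besselY (ν - 1) x * besselY ν x))| := abs_sub _ _
        _ ≤ 2 * ν * (K₂ ^ 2 * (x ^ (3 - 2 * ν) + x)) +
            2 * (2 * K₂ * K₁ * (x ^ (3 - 2 * ν) + x)) := by
            refine add_le_add ?_ ?_
            · rw [abs_of_nonneg (by positivity)]
              exact mul_le_mul_of_nonneg_left h5 (by linarith)
            · rw [abs_mul, abs_mul, abs_two, abs_of_nonneg (sq_nonneg x)]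
              refine mul_le_mul_of_nonneg_left (le_trans ?_ h4) zero_le_two
              exact mul_le_mul_of_nonneg_left h3 (sq_nonneg x)
        _ = (2 * ν * K₂ ^ 2 + 2 * (2 * K₂ * K₁)) * (x ^ (3 - 2 * ν) + x) := by ring
        _ ≤ K * (x ^ (3 - 2 * ν) + x) := mul_le_mul_of_nonneg_right hK3 h7

/-! ### Two-mode covariance matrices -/

/-- The expansion is sorted by degree in the correlation block `C`. The quadratic trace term governs
both the inequalities below and the long-distance behaviour; the quartic remainder is only `(det
C)²`. -/
theorem det_fromBlocks_fin_two (A B C : Matrix (Fin 2) (Fin 2) ℝ) :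
    (Matrix.fromBlocks A C C.transpose B).det =
      A.det * B.det - (A.adjugate * C * B.adjugate * C.transpose).trace + C.det ^ 2 := by
  rw [← Matrix.det_reindex_self finSumFinEquiv]
  have h : Matrix.reindex finSumFinEquiv finSumFinEquiv (Matrix.fromBlocks A C C.transpose B) =
      !![A 0 0, A 0 1, C 0 0, C 0 1; A 1 0, A 1 1, C 1 0, C 1 1;
        C 0 0, C 1 0, B 0 0, B 0 1; C 0 1, C 1 1, B 1 0, B 1 1] := by
    ext i j; fin_cases i <;> fin_cases j <;> rfl
  rw [h, Matrix.adjugate_fin_two, Matrix.adjugate_fin_two, Matrix.det_fin_two, Matrix.det_fin_two,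
    Matrix.det_fin_two, Matrix.det_succ_row_zero]
  simp only [Matrix.trace_fin_two, Matrix.mul_apply, Fin.sum_univ_two, Matrix.transpose_apply]
  simp [Fin.sum_univ_succ, Matrix.det_fin_three, Fin.succAbove]
  ring

/-- Multiplying by `A₁₁ B₁₁` completes the squares: the trace becomes `x² + b y² + a z² + a b w²`,
with `x w - y z = A₁₁ B₁₁ det C`. The arithmetic-geometric mean inequality for the pairs `(x, w)`
and `(y, z)` does the rest. -/
theorem two_mul_sqrt_mul_abs_le_trace {A B : Matrix (Fin 2) (Fin 2) ℝ} (C : Matrix (Fin 2) (Fin 2) ℝ)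
    (hA : A.PosDef) (hB : B.PosDef) :
    2 * √(A.det * B.det) * |C.det| ≤ (A.adjugate * C * B.adjugate * C.transpose).trace := by
  have ha := hA.det_pos
  have hb := hB.det_pos
  have ha1 : 0 < A 1 1 := hA.diag_pos
  have hb1 : 0 < B 1 1 := hB.diag_pos
  have hAs : A 1 0 = A 0 1 := by simpa using (hA.1.apply 0 1)
  have hBs : B 1 0 = B 0 1 := by simpa using (hB.1.apply 0 1)
  set s := √(A.det * B.det) with hs
  have hss : s ^ 2 = A.det * B.det := Real.sq_sqrt (by positivity)
  set a := A.det with hadef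
  set b := B.det with hbdef
  have hadet : a = A 0 0 * A 1 1 - A 0 1 * A 0 1 := by rw [hadef, Matrix.det_fin_two, hAs]
  have hbdet : b = B 0 0 * B 1 1 - B 0 1 * B 0 1 := by rw [hbdef, Matrix.det_fin_two, hBs]
  set y := A 1 1 * C 0 1 - A 0 1 * C 1 1 with hy
  set z := B 1 1 * C 1 0 - B 0 1 * C 1 1 with hz
  set x := A 1 1 * (B 1 1 * C 0 0 - B 0 1 * C 0 1) - A 0 1 * z with hx
  set w := C 1 1 with hw
  have h1 : A 1 1 * B 1 1 * (A.adjugate * C * B.adjugate * C.transpose).trace =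
      x ^ 2 + b * y ^ 2 + a * z ^ 2 + a * b * w ^ 2 := by
    rw [Matrix.adjugate_fin_two, Matrix.adjugate_fin_two]
    simp only [Matrix.trace_fin_two, Matrix.mul_apply, Fin.sum_univ_two, Matrix.transpose_apply]
    simp [hAs, hBs]
    rw [hadet, hbdet, hx, hy, hz, hw]; ring
  have h2 : x * w - y * z = A 1 1 * B 1 1 * C.det := by
    rw [Matrix.det_fin_two, hx, hy, hz, hw]; ring
  have h3 : 2 * s * |x * w| ≤ x ^ 2 + a * b * w ^ 2 := by
    rw [← hss, abs_mul, ← sq_abs x, ← sq_abs w]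
    nlinarith [sq_nonneg (|x| - s * |w|)]
  have h4 : 2 * s * |y * z| ≤ b * y ^ 2 + a * z ^ 2 := by
    have h5 : s = √b * √a := by rw [hs, mul_comm, Real.sqrt_mul hb.le]
    have h6 := Real.sq_sqrt hb.le
    have h7 := Real.sq_sqrt ha.le
    calc 2 * s * |y * z| = 2 * (√b * |y|) * (√a * |z|) := by rw [h5, abs_mul]; ring
      _ ≤ (√b * |y|) ^ 2 + (√a * |z|) ^ 2 := two_mul_le_add_sq _ _
      _ = b * y ^ 2 + a * z ^ 2 := by rw [mul_pow, mul_pow, h6, h7, sq_abs, sq_abs]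
  have h5 : |x * w - y * z| ≤ |x * w| + |y * z| := abs_sub _ _
  have h6 : A 1 1 * B 1 1 * (2 * s * |C.det|) ≤
      A 1 1 * B 1 1 * (A.adjugate * C * B.adjugate * C.transpose).trace := by
    rw [h1]
    have h7 : A 1 1 * B 1 1 * |C.det| = |x * w - y * z| := by
      rw [h2, abs_mul, abs_of_pos (by positivity : 0 < A 1 1 * B 1 1)]
    have hs0 : 0 ≤ s := Real.sqrt_nonneg _
    nlinarith
  exact le_of_mul_le_mul_left h6 (by positivity)

theorem det_fromBlocks_le {A B : Matrix (Fin 2) (Fin 2) ℝ} (C : Matrix (Fin 2) (Fin 2) ℝ)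
    (hA : A.PosDef) (hB : B.PosDef) :
    (Matrix.fromBlocks A C C.transpose B).det ≤ (√(A.det * B.det) - |C.det|) ^ 2 := by
  have h := two_mul_sqrt_mul_abs_le_trace C hA hB
  have h2 := Real.sq_sqrt (mul_pos hA.det_pos hB.det_pos).le
  rw [det_fromBlocks_fin_two, sub_sq, sq_abs, h2]
  linarith

section Blocks

variable {A B C : Matrix (Fin 2) (Fin 2) ℝ}

theorem posDef_left_of_fromBlocks (h : (Matrix.fromBlocks A C C.transpose B).PosDef) : A.PosDef := by
  have := h.submatrix (e := Sum.inl) Sum.inl_injective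
  convert! this

theorem posDef_right_of_fromBlocks (h : (Matrix.fromBlocks A C C.transpose B).PosDef) : B.PosDef := by
  have := h.submatrix (e := Sum.inr) Sum.inr_injective
  convert! this

theorem posDef_fromBlocks_neg (h : (Matrix.fromBlocks A C C.transpose B).PosDef) :
    (Matrix.fromBlocks A (-C) (-C).transpose B).PosDef := by
  have hD : IsUnit (Matrix.fromBlocks (1 : Matrix (Fin 2) (Fin 2) ℝ) 0 0
        (-1 : Matrix (Fin 2) (Fin 2) ℝ)) := by
    refine IsUnit.of_mul_eq_one (Matrix.fromBlocks (1 : Matrix (Fin 2) (Fin 2) ℝ) 0 0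
        (-1 : Matrix (Fin 2) (Fin 2) ℝ)) ?_
    simp [Matrix.fromBlocks_multiply]
  have := (Matrix.IsUnit.posDef_star_left_conjugate_iff hD).2 h
  convert! this using 1
  rw [Matrix.star_eq_conjTranspose, Matrix.fromBlocks_conjTranspose, Matrix.fromBlocks_multiply,
    Matrix.fromBlocks_multiply]
  simp

/-- The matrix with block `tC` is the convex combination, with weights `(1 ± t)/2`, of those with
blocks `C` and `-C`. -/
theorem posDef_fromBlocks_smul (h : (Matrix.fromBlocks A C C.transpose B).PosDef) {t : ℝ}
    (ht0 : 0 < t) (ht1 : t < 1) : (Matrix.fromBlocks A (t • C) (t • C).transpose B).PosDef := by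
  have h1 := (h.smul (show 0 < (1 + t) / 2 by linarith)).add
    ((posDef_fromBlocks_neg h).smul (show 0 < (1 - t) / 2 by linarith))
  convert! h1 using 1
  rw [Matrix.fromBlocks_smul, Matrix.fromBlocks_smul, Matrix.fromBlocks_add]
  congr 1 <;> ext i j <;> simp <;> ring

/-- If `|det C|` reached `√(det A det B)`, then some scaling `t ∈ (0, 1]` of `C` would give
equality. The determinant bound would make the block determinant nonpositive there, although scaling
preserves positive definiteness. -/
theorem abs_det_lt_of_posDef_fromBlocks (h : (Matrix.fromBlocks A C C.transpose B).PosDef) :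
    |C.det| < √(A.det * B.det) := by
  have hA := posDef_left_of_fromBlocks h
  have hB := posDef_right_of_fromBlocks h
  have hs : 0 < √(A.det * B.det) := Real.sqrt_pos.2 (mul_pos hA.det_pos hB.det_pos)
  by_contra! hc
  have hpos : ∀ t : ℝ, 0 < t → t < 1 → √(A.det * B.det) ≠ t ^ 2 * |C.det| := by
    intro t h0 h1 he
    have h2 := det_fromBlocks_le (t • C) hA hB
    rw [Matrix.det_smul, Fintype.card_fin, abs_mul, abs_of_pos (by positivity), ← he, sub_self,
      zero_pow two_ne_zero] at h2
    exact h2.not_gt (posDef_fromBlocks_smul h h0 h1).det_pos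
  rcases hc.eq_or_lt with h1 | h1
  · have h2 := det_fromBlocks_le C hA hB
    rw [h1, sub_self, zero_pow two_ne_zero] at h2
    exact h2.not_gt h.det_pos
  · have hC : 0 < |C.det| := hs.trans h1
    refine hpos (√(√(A.det * B.det) / |C.det|)) (by positivity) ?_ ?_
    · rw [Real.sqrt_lt' one_pos, one_pow, div_lt_one hC]; exact h1
    · rw [Real.sq_sqrt (by positivity)]; field_simp

/-- This is Fischer's inequality; it makes the limiting mutual information nonnegative. -/
theorem det_fromBlocks_le_mul (h : (Matrix.fromBlocks A C C.transpose B).PosDef) :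
    (Matrix.fromBlocks A C C.transpose B).det ≤ A.det * B.det := by
  have hA := posDef_left_of_fromBlocks h
  have hB := posDef_right_of_fromBlocks h
  refine (det_fromBlocks_le C hA hB).trans ?_
  have := abs_det_lt_of_posDef_fromBlocks h
  conv_rhs => rw [← Real.sq_sqrt (mul_pos hA.det_pos hB.det_pos).le]
  exact pow_le_pow_left₀ (by linarith) (by linarith [abs_nonneg C.det]) 2

/-- Independent basis changes in the two modes multiply the joint determinant and the product of the
single determinants by the same factor, so their quotient is invariant. -/
theorem det_fromBlocks_conj (S T : Matrix (Fin 2) (Fin 2) ℝ) :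
    (Matrix.fromBlocks (S * A * S.transpose) (S * C * T.transpose) (S * C * T.transpose).transpose
      (T * B * T.transpose)).det =
      (S.det * T.det) ^ 2 * (Matrix.fromBlocks A C C.transpose B).det := by
  have h : Matrix.fromBlocks (S * A * S.transpose) (S * C * T.transpose)
      (S * C * T.transpose).transpose (T * B * T.transpose) =
      Matrix.fromBlocks S 0 0 T * Matrix.fromBlocks A C C.transpose B *
        (Matrix.fromBlocks S 0 0 T).transpose := by
    simp [Matrix.fromBlocks_transpose, Matrix.fromBlocks_multiply, Matrix.mul_assoc]
  rw [h, Matrix.det_mul, Matrix.det_mul, Matrix.det_transpose, Matrix.det_fromBlocks_zero₂₁]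
  ring

end Blocks

/-! ### Entropies and mutual information for large covariances. -/

/-- The value of the constant is irrelevant: it enters the mutual information twice with each sign.
-/
theorem tendsto_entropy_sub_logb :
    ∃ K : ℝ, Tendsto (fun ν : ℝ => entropy ν - Real.logb 2 ν) atTop (𝓝 K) := by
  have h1 : Tendsto (fun x : ℝ => 1 / x) atTop (𝓝 0) := tendsto_const_nhds.div_atTop tendsto_id
  have hl : ∀ t : ℝ, Tendsto (fun x : ℝ => Real.log (1 + t / x)) atTop (𝓝 0) := by
    intro t
    have h2 : Tendsto (fun x : ℝ => 1 + t / x) atTop (𝓝 (1 + 0)) :=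
      tendsto_const_nhds.add (tendsto_const_nhds.div_atTop tendsto_id)
    rw [add_zero] at h2
    have h3 := (Real.continuousAt_log one_ne_zero).tendsto.comp h2
    rwa [Real.log_one] at h3
  have h2 := (Real.tendsto_mul_log_one_add_div_atTop 1).add (hl 1)
  have h3 := (Real.tendsto_mul_log_one_add_div_atTop (-1)).sub (hl (-1))
  have h4 := (((h2.sub h3).div_const 2).sub_const (Real.log 2)).div_const (Real.log 2)
  refine ⟨_, h4.congr' ?_⟩
  filter_upwards [eventually_gt_atTop 1] with x hx
  have hx0 : 0 < x := by linarith
  have e1 : Real.log ((x + 1) / 2) = Real.log x + Real.log (1 + 1 / x) - Real.log 2 := by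
    rw [Real.log_div (by linarith) two_ne_zero, ← Real.log_mul hx0.ne' (by positivity)]
    congr 2; field_simp
  have hpos : 0 < 1 + -1 / x := by
    have : 1 / x < 1 := by rw [div_lt_one hx0]; exact hx
    rw [neg_div]; linarith
  have e2 : Real.log ((x - 1) / 2) = Real.log x + Real.log (1 + -1 / x) - Real.log 2 := by
    rw [Real.log_div (by linarith) two_ne_zero, ← Real.log_mul hx0.ne' hpos.ne']
    congr 2; field_simp; ring
  rw [entropy, Real.logb, Real.logb, Real.logb, e1, e2]
  have : Real.log 2 ≠ 0 := (Real.log_pos one_lt_two).ne'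
  field_simp
  ring

/-- Symplectic eigenvalues of a positive definite two-mode covariance matrix. -/
theorem symplectic_eigenvalues_bounds {A B C : Matrix (Fin 2) (Fin 2) ℝ} {D Δ : ℝ}
    (h : (Matrix.fromBlocks A C C.transpose B).PosDef)
    (hD : D = A.det + B.det + 2 * C.det) (hΔ : Δ = (Matrix.fromBlocks A C C.transpose B).det) :
    Δ / (2 * (A.det + B.det)) ≤ (D - √(D ^ 2 - 4 * Δ)) / 2 ∧
      (D - √(D ^ 2 - 4 * Δ)) / 2 ≤ (D + √(D ^ 2 - 4 * Δ)) / 2 ∧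
      (D - √(D ^ 2 - 4 * Δ)) / 2 * ((D + √(D ^ 2 - 4 * Δ)) / 2) = Δ := by
  have hA := (posDef_left_of_fromBlocks h).det_pos
  have hB := (posDef_right_of_fromBlocks h).det_pos
  have hc := abs_det_lt_of_posDef_fromBlocks h
  have hle := det_fromBlocks_le C (posDef_left_of_fromBlocks h) (posDef_right_of_fromBlocks h)
  have hpos := h.det_pos
  rw [← hΔ] at hle hpos
  set a := A.det
  set b := B.det
  set c := C.det
  set s := √(a * b) with hs
  have hss : s ^ 2 = a * b := Real.sq_sqrt (by positivity)
  have hs2 : 2 * s ≤ a + b := by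
    refine abs_le_of_sq_le_sq' ?_ (by positivity) |>.2
    nlinarith [sq_nonneg (a - b)]
  have hc' := abs_le.1 hc.le
  have hc1 := neg_abs_le c
  have hD1 : 2 * (s - |c|) ≤ D := by linarith
  have hD0 : 0 < D := by linarith
  have hdisc : 0 ≤ D ^ 2 - 4 * Δ := by
    have : (2 * (s - |c|)) ^ 2 ≤ D ^ 2 := pow_le_pow_left₀ (by linarith) hD1 2
    nlinarith
  set q := √(D ^ 2 - 4 * Δ) with hq
  have hq0 : 0 ≤ q := Real.sqrt_nonneg _
  have hqq : q ^ 2 = D ^ 2 - 4 * Δ := Real.sq_sqrt hdisc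
  have hqD : q < D := by
    refine lt_of_pow_lt_pow_left₀ 2 hD0.le ?_
    rw [hqq]; linarith
  have hprod : (D - q) / 2 * ((D + q) / 2) = Δ := by nlinarith
  refine ⟨?_, by linarith, hprod⟩
  -- The smaller root is `Δ` divided by the larger one, and the larger one is at most `D ≤ a + b +
  -- 2√(ab) ≤ 2(a + b)`.
  rw [div_le_iff₀ (by positivity), ← hprod]
  refine mul_le_mul_of_nonneg_left ?_ (by linarith)
  linarith

/-- Replacing each entropy by `log₂ ν` leaves `log₂` of `√(det σ_A det σ_B) / (ν₊ ν₋)`, and `(ν₊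
ν₋)²` is the joint determinant. The point to check is that the smaller eigenvalue diverges too.
Semidefiniteness suffices as input, because the positive limit `r` makes the joint determinant
eventually nonzero. -/
theorem tendsto_gaussianMutualInfo {ι : Type*} {l : Filter ι}
    {σA σB C : ι → Matrix (Fin 2) (Fin 2) ℝ} {r : ℝ} (hr : 0 < r)
    (hpsd : ∀ᶠ i in l, (Matrix.fromBlocks (σA i) (C i) (C i).transpose (σB i)).PosSemidef)
    (ha : Tendsto (fun i => (σA i).det) l atTop) (hb : Tendsto (fun i => (σB i).det) l atTop)
    (hratio : Tendsto (fun i => (Matrix.fromBlocks (σA i) (C i) (C i).transpose (σB i)).det /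
      ((σA i).det * (σB i).det)) l (𝓝 r)) :
    Tendsto (fun i => gaussianMutualInfo (σA i) (σB i) (C i)) l
      (𝓝 (-(1 / 2) * Real.logb 2 r)) := by
  set D : ι → ℝ := fun i => (σA i).det + (σB i).det + 2 * (C i).det with hD
  set Δ : ι → ℝ := fun i => (Matrix.fromBlocks (σA i) (C i) (C i).transpose (σB i)).det with hΔ
  have hgood : ∀ᶠ i in l, (Matrix.fromBlocks (σA i) (C i) (C i).transpose (σB i)).PosDef ∧
      r / 2 * ((σA i).det * (σB i).det) ≤ Δ i ∧ 0 < (σA i).det ∧ 0 < (σB i).det := by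
    filter_upwards [hpsd, hratio.eventually (lt_mem_nhds (half_lt_self hr)),
      ha.eventually_gt_atTop 0, hb.eventually_gt_atTop 0] with i h1 h2 h3 h4
    have h5 : r / 2 * ((σA i).det * (σB i).det) < Δ i := by
      rwa [lt_div_iff₀ (by positivity)] at h2
    exact ⟨h1.posDef_iff_det_ne_zero.2 (lt_trans (by positivity) h5).ne', h5.le, h3, h4⟩
  set m : ι → ℝ := fun i => (D i - √(D i ^ 2 - 4 * Δ i)) / 2 with hm
  set p : ι → ℝ := fun i => (D i + √(D i ^ 2 - 4 * Δ i)) / 2 with hp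
  have hmtop : Tendsto m l atTop := by
    -- The constant `r/8` combines `Δ ≥ (r/2) a b`, `a b ≥ ½ min(a, b) (a + b)` and the lower bound
    -- `Δ / (2(a + b))` for the smaller root.
    have hmin : Tendsto (fun i => r / 8 * min (σA i).det (σB i).det) l atTop :=
      (tendsto_inf_atTop l ha hb).const_mul_atTop (by positivity)
    refine tendsto_atTop_mono' l ?_ hmin
    filter_upwards [hgood] with i ⟨h1, h2, h3, h4⟩
    refine le_trans ?_ (symplectic_eigenvalues_bounds (D := D i) (Δ := Δ i) h1 rfl rfl).1
    rw [le_div_iff₀ (by positivity)]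
    refine le_trans ?_ h2
    have h5 : min (σA i).det (σB i).det * ((σA i).det + (σB i).det) ≤
        2 * ((σA i).det * (σB i).det) := by
      rcases le_total (σA i).det (σB i).det with h | h
      · rw [min_eq_left h]; nlinarith
      · rw [min_eq_right h]; nlinarith
    nlinarith
  have hptop : Tendsto p l atTop := by
    refine tendsto_atTop_mono' l ?_ hmtop
    filter_upwards [hgood] with i ⟨h1, _⟩
    exact (symplectic_eigenvalues_bounds (D := D i) (Δ := Δ i) h1 rfl rfl).2.1
  obtain ⟨K, hK⟩ := tendsto_entropy_sub_logb
  have hsqrt := Real.tendsto_sqrt_atTop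
  have hsum := ((((hK.comp (hsqrt.comp ha)).add (hK.comp (hsqrt.comp hb))).sub
    (hK.comp (hsqrt.comp hptop))).sub (hK.comp (hsqrt.comp hmtop)))
  have hlog := (hratio.logb hr.ne' (b := 2)).const_mul (-(1 / 2))
  have htot := hsum.add hlog
  rw [show K + K - K - K + -(1 / 2) * Real.logb 2 r = -(1 / 2) * Real.logb 2 r by ring] at htot
  refine htot.congr' ?_
  filter_upwards [hgood, hmtop.eventually_gt_atTop 0, hptop.eventually_gt_atTop 0]
    with i ⟨h1, h2, h3, h4⟩ h5 h6
  have hprod : m i * p i = Δ i :=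
    (symplectic_eigenvalues_bounds (D := D i) (Δ := Δ i) h1 rfl rfl).2.2
  have e : gaussianMutualInfo (σA i) (σB i) (C i) = entropy (√(σA i).det) + entropy (√(σB i).det) -
    entropy (√(p i)) - entropy (√(m i)) := rfl
  have e2 : Real.logb 2 (Δ i / ((σA i).det * (σB i).det)) =
      2 * (Real.logb 2 (√(m i)) + Real.logb 2 (√(p i)) - Real.logb 2 (√(σA i).det) -
        Real.logb 2 (√(σB i).det)) := by
    simp only [Real.logb, Real.log_sqrt h5.le, Real.log_sqrt h6.le, Real.log_sqrt h3.le,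
      Real.log_sqrt h4.le]
    rw [← hprod, Real.log_div (by positivity) (by positivity), Real.log_mul h5.ne' h6.ne',
      Real.log_mul h3.ne' h4.ne']
    ring
  rw [e, e2]
  simp only [Function.comp_apply]
  ring

/-! ### Fourier transforms of integrable functions -/

/-- The Fourier transform with the opposite sign, `∫ d³x e^{i p·x} h(x)`. -/
def hat (h : Space3 → ℝ) (p : Space3) : ℂ := ft h (-p)

theorem hat_eq (h : Space3 → ℝ) (p : Space3) :
    hat h p = ∫ x : Space3, Complex.exp (Complex.I * ((inner ℝ p x : ℝ) : ℂ)) * ((h x : ℝ) : ℂ) := by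
  simp [hat, ft]

theorem norm_cexp_I_mul (r : ℝ) : ‖Complex.exp (Complex.I * (r : ℂ))‖ = 1 := by
  rw [mul_comm, Complex.norm_exp_ofReal_mul_I]

theorem integrable_char_mul {h : Space3 → ℝ} (hh : Integrable h) (p : Space3) :
    Integrable fun x : Space3 => Complex.exp (Complex.I * ((inner ℝ p x : ℝ) : ℂ)) * ((h x : ℝ) : ℂ) := by
  refine hh.ofReal.bdd_mul (c := 1) (Continuous.aestronglyMeasurable (by fun_prop)) ?_
  exact Eventually.of_forall fun x => (norm_cexp_I_mul _).le

theorem norm_hat_le (h : Space3 → ℝ) (p : Space3) : ‖hat h p‖ ≤ ∫ x, |h x| := by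
  rw [hat_eq]
  refine (norm_integral_le_integral_norm _).trans_eq ?_
  refine integral_congr_ae (Eventually.of_forall fun x => ?_)
  simp only [norm_mul, norm_cexp_I_mul, one_mul, Complex.norm_real, Real.norm_eq_abs]

theorem continuous_hat {h : Space3 → ℝ} (hh : Integrable h) : Continuous (hat h) := by
  have : hat h = fun p => ∫ x : Space3,
      Complex.exp (Complex.I * ((inner ℝ p x : ℝ) : ℂ)) * ((h x : ℝ) : ℂ) := funext (hat_eq h)
  rw [this]
  refine continuous_of_dominated (bound := fun x => |h x|)
    (fun p => (integrable_char_mul hh p).aestronglyMeasurable) (fun p => ?_) hh.abs ?_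
  · refine Eventually.of_forall fun x => ?_
    simp only [norm_mul, norm_cexp_I_mul, one_mul, Complex.norm_real, Real.norm_eq_abs, le_refl]
  · exact Eventually.of_forall fun x => by fun_prop

theorem hat_congr {h h' : Space3 → ℝ} (e : h =ᵐ[volume] h') : hat h = hat h' := by
  funext p
  rw [hat_eq, hat_eq]
  refine integral_congr_ae ?_
  filter_upwards [e] with x hx
  rw [hx]

theorem hat_zero_left : hat 0 = 0 := by
  funext p; simp [hat_eq]

theorem hat_lincomb {h h' : Space3 → ℝ} (hh : Integrable h) (hh' : Integrable h') (a b : ℝ)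
    (p : Space3) : hat (fun x => a * h x + b * h' x) p = a * hat h p + b * hat h' p := by
  simp only [hat_eq]
  rw [← integral_const_mul, ← integral_const_mul,
    ← integral_add ((integrable_char_mul hh p).const_mul _) ((integrable_char_mul hh' p).const_mul _)]
  refine integral_congr_ae (Eventually.of_forall fun x => ?_)
  push_cast; ring

theorem hat_translate (h : Space3 → ℝ) (d p : Space3) :
    hat (fun x => h (x - d)) p = Complex.exp (Complex.I * ((inner ℝ p d : ℝ) : ℂ)) * hat h p := by
  rw [hat_eq, hat_eq, ← integral_const_mul, ← integral_add_right_eq_self _ d]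
  refine integral_congr_ae (Eventually.of_forall fun x => ?_)
  simp only [add_sub_cancel_right, inner_add_right, Complex.ofReal_add, mul_add, Complex.exp_add]
  ring

theorem hat_dilate (h : Space3 → ℝ) {R : ℝ} (hR : 0 < R) (c : ℝ) (p : Space3) :
    hat (fun x => c * h (R⁻¹ • x)) p = (c * R ^ 3 : ℝ) * hat h (R • p) := by
  rw [hat_eq, hat_eq]
  have := Measure.integral_comp_smul (volume : Measure Space3)
    (fun x => Complex.exp (Complex.I * ((inner ℝ (R • p) x : ℝ) : ℂ)) * ((c * h x : ℝ) : ℂ)) R⁻¹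
  have e : ∀ x : Space3, (inner ℝ (R • p) (R⁻¹ • x) : ℝ) = inner ℝ p x := by
    intro x
    rw [inner_smul_left, inner_smul_right]
    simp [hR.ne']
  simp only [e] at this
  rw [this, show Module.finrank ℝ Space3 = 3 by simp, inv_pow, inv_inv, abs_of_pos (by positivity)]
  rw [Complex.real_smul, ← integral_const_mul, ← integral_const_mul]
  refine integral_congr_ae (Eventually.of_forall fun x => ?_)
  push_cast; ring

theorem sobolev_integrable {s : ℝ} {h : Space3 → ℝ} (hs : FiniteSobolevNorm s h) :
    Integrable fun k : Space3 => ‖k‖ ^ (2 * s) * ‖hat h k‖ ^ 2 := by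
  have := hs.comp_neg
  simpa [hat] using this

/-- Injectivity of the Fourier transform on `L¹`. -/
theorem ae_eq_zero_of_hat_eq_zero {h : Space3 → ℝ} (hh : Integrable h) (h0 : ∀ p, hat h p = 0) :
    h =ᵐ[volume] 0 := by
  have hft : FourierTransform.fourier (fun x => (h x : ℂ)) = (0 : Space3 → ℂ) := by
    funext w
    have h1 := h0 (-((2 * Real.pi) • w))
    rw [hat_eq] at h1
    rw [Real.fourier_eq, Pi.zero_apply, ← h1]
    refine integral_congr_ae (Eventually.of_forall fun x => ?_)
    simp only [Circle.smul_def, Real.fourierChar_apply, smul_eq_mul, inner_neg_left,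
      real_inner_smul_left, real_inner_comm w x]
    congr 2; push_cast; ring
  have key : ∀ᵐ x : Space3, ((h x : ℝ) : ℂ) = 0 := by
    refine ae_eq_zero_of_integral_contDiff_smul_eq_zero hh.ofReal.locallyIntegrable fun g hg hgc => ?_
    have hgc' : HasCompactSupport fun x => ((g x : ℝ) : ℂ) := hgc.comp_left (g := Complex.ofReal) rfl
    let gs : SchwartzMap Space3 ℂ := hgc'.toSchwartzMap (Complex.ofRealCLM.contDiff.comp hg)
    have hφ : FourierTransform.fourier (FourierTransformInv.fourierInv gs) = gs :=
      FourierTransform.fourier_fourierInv_eq gs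
    -- The test function is the Fourier transform of a Schwartz function, so the transform can be
    -- moved onto `h`, where it vanishes.
    have h1 := VectorFourier.integral_fourierIntegral_smul_eq_flip (L := innerₗ Space3)
      Real.continuous_fourierChar continuous_inner hh.ofReal (𝕜 := ℝ)
      (FourierTransformInv.fourierInv gs : SchwartzMap Space3 ℂ).integrable (μ := volume) (ν := volume)
    have h2 : VectorFourier.fourierIntegral Real.fourierChar volume (innerₗ Space3).flip
      (FourierTransformInv.fourierInv gs : SchwartzMap Space3 ℂ) = gs := by
      rw [flip_innerₗ]
      exact congrArg (fun f : SchwartzMap Space3 ℂ => (f : Space3 → ℂ)) hφ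
    have h3 : VectorFourier.fourierIntegral Real.fourierChar volume (innerₗ Space3)
      (fun x => (h x : ℂ)) = 0 := hft
    erw [h2, h3] at h1
    simp only [Pi.zero_apply, zero_smul, integral_zero] at h1
    rw [h1]
    refine integral_congr_ae (Eventually.of_forall fun x => ?_)
    have h4 : gs x = ((g x : ℝ) : ℂ) := rfl
    simp [h4, mul_comm]
  filter_upwards [key] with x hx
  exact_mod_cast hx

/-! ### Cross spectra and Gaussian regularisation -/

/-- The cross spectrum of `h` and of `h'` displaced by `d`. -/
def crossSpec (h h' : Space3 → ℝ) (d p : Space3) : ℂ :=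
  hat h p * conj (Complex.exp (Complex.I * ((inner ℝ p d : ℝ) : ℂ)) * hat h' p)

theorem norm_crossSpec (h h' : Space3 → ℝ) (d p : Space3) :
    ‖crossSpec h h' d p‖ = ‖hat h p‖ * ‖hat h' p‖ := by
  rw [crossSpec, norm_mul, RCLike.norm_conj, norm_mul, norm_cexp_I_mul, one_mul]

theorem continuous_crossSpec {h h' : Space3 → ℝ} (hh : Integrable h) (hh' : Integrable h')
    (d : Space3) : Continuous (crossSpec h h' d) := by
  have := continuous_hat hh
  have := continuous_hat hh'
  unfold crossSpec
  fun_prop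

/-- In position space the cross spectrum depends on the two functions only through the separation `x
- y - d`. -/
theorem crossSpec_eq (h h' : Space3 → ℝ) (d p : Space3) :
    crossSpec h h' d p = ∫ z : Space3 × Space3,
      Complex.exp (Complex.I * ((inner ℝ p (z.1 - z.2 - d) : ℝ) : ℂ)) * ((h z.1 * h' z.2 : ℝ) : ℂ) := by
  rw [crossSpec, map_mul, hat_eq h', ← integral_conj, ← integral_const_mul, hat_eq,
    Measure.volume_eq_prod, ← integral_prod_mul]
  refine integral_congr_ae (Eventually.of_forall fun z => ?_)
  simp only [map_mul, Complex.conj_ofReal, ← Complex.exp_conj, Complex.conj_I]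
  rw [show Complex.I * ((inner ℝ p (z.1 - z.2 - d) : ℝ) : ℂ) = Complex.I * ((inner ℝ p z.1 : ℝ) : ℂ) +
    (-Complex.I * ((inner ℝ p d : ℝ) : ℂ) + -Complex.I * ((inner ℝ p z.2 : ℝ) : ℂ)) by
      rw [inner_sub_right, inner_sub_right]; push_cast; ring, Complex.exp_add, Complex.exp_add]
  push_cast; ring

theorem integrable_exp_neg_mul_norm_sq {t : ℝ} (ht : 0 < t) :
    Integrable fun p : Space3 => Real.exp (-t * ‖p‖ ^ 2) := by
  have := (GaussianFourier.integrable_cexp_neg_mul_sq_norm_add (V := Space3) (b := t)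
    (by simpa using ht) 0 0).norm
  refine this.congr (Eventually.of_forall fun p => ?_)
  simp only [Complex.norm_exp]
  congr 1
  simp only [zero_mul, add_zero]
  rw [show -(t : ℂ) * (‖p‖ : ℂ) ^ 2 = ((-t * ‖p‖ ^ 2 : ℝ) : ℂ) by push_cast; ring, Complex.ofReal_re]

theorem integral_gaussian_char {t : ℝ} (ht : 0 < t) (w : Space3) :
    ∫ p : Space3, ((Real.exp (-t * ‖p‖ ^ 2) : ℝ) : ℂ) *
      Complex.exp (Complex.I * ((inner ℝ p w : ℝ) : ℂ)) =
    (((Real.pi / t) ^ (3 / 2 : ℝ) * Real.exp (-‖w‖ ^ 2 / (4 * t)) : ℝ) : ℂ) := by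
  have h := GaussianFourier.integral_cexp_neg_mul_sq_norm_add (V := Space3) (b := t)
    (by simpa using ht) Complex.I w
  rw [show Module.finrank ℝ Space3 = 3 by simp] at h
  have e1 : ((Real.pi : ℂ) / t) ^ (((3 : ℕ) : ℂ) / 2) = (((Real.pi / t) ^ (3 / 2 : ℝ) : ℝ) : ℂ) := by
    rw [Complex.ofReal_cpow (by positivity)]; push_cast; rfl
  rw [e1] at h
  rw [Complex.ofReal_mul, Complex.ofReal_exp, ]
  convert! h using 1
  · refine integral_congr_ae (Eventually.of_forall fun p => ?_)
    simp only
    rw [Complex.ofReal_exp, ← Complex.exp_add, real_inner_comm]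
    push_cast; ring_nf
  · congr 2
    rw [Complex.I_sq]; push_cast; ring

/-- A Gaussian in the wave vector is a Gaussian in the separation. Through this identity the
distance between the supports becomes visible in spectral integrals. -/
theorem integral_gaussian_crossSpec {h h' : Space3 → ℝ} (hh : Integrable h) (hh' : Integrable h')
    (d : Space3) {t : ℝ} (ht : 0 < t) :
    ∫ p : Space3, ((Real.exp (-t * ‖p‖ ^ 2) : ℝ) : ℂ) * crossSpec h h' d p =
      (((Real.pi / t) ^ (3 / 2 : ℝ) * ∫ z : Space3 × Space3,
        Real.exp (-‖z.1 - z.2 - d‖ ^ 2 / (4 * t)) * (h z.1 * h' z.2) : ℝ) : ℂ) := by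
  have hprod : Integrable (fun z : Space3 × Space3 => h z.1 * h' z.2) := hh.mul_prod hh'
  have hint : Integrable (Function.uncurry fun (p : Space3) (z : Space3 × Space3) =>
      ((Real.exp (-t * ‖p‖ ^ 2) : ℝ) : ℂ) *
      (Complex.exp (Complex.I * ((inner ℝ p (z.1 - z.2 - d) : ℝ) : ℂ)) * ((h z.1 * h' z.2 : ℝ) : ℂ)))
      (volume.prod volume) := by
    have h1 : Integrable (fun q : Space3 × Space3 × Space3 =>
        ((Real.exp (-t * ‖q.1‖ ^ 2) * (h q.2.1 * h' q.2.2) : ℝ) : ℂ)) (volume.prod volume) :=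
      ((integrable_exp_neg_mul_norm_sq ht).mul_prod hprod).ofReal
    have h2 := h1.bdd_mul (c := 1) (f := fun q : Space3 × Space3 × Space3 =>
      Complex.exp (Complex.I * ((inner ℝ q.1 (q.2.1 - q.2.2 - d) : ℝ) : ℂ)))
      (Continuous.aestronglyMeasurable (by fun_prop))
      (Eventually.of_forall fun x => (norm_cexp_I_mul _).le)
    refine h2.congr (Eventually.of_forall fun q => ?_)
    simp only [Function.uncurry]
    push_cast; ring
  simp only [crossSpec_eq]
  simp only [← integral_const_mul]
  rw [integral_integral_swap hint, ← integral_complex_ofReal]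
  refine integral_congr_ae (Eventually.of_forall fun z => ?_)
  simp only
  simp only [← mul_assoc]
  rw [integral_mul_const]
  have := integral_gaussian_char ht (z.1 - z.2 - d)
  rw [this]
  push_cast; ring

/-! ### Locality of polynomial multipliers -/

/-- The Gaussian regularisation of the overlap of `h` and of `h'` displaced by `d`. -/
def gaussOverlap (h h' : Space3 → ℝ) (d : Space3) (t : ℝ) : ℝ :=
  (Real.pi / t) ^ (3 / 2 : ℝ) * ∫ z : Space3 × Space3,
    Real.exp (-‖z.1 - z.2 - d‖ ^ 2 / (4 * t)) * (h z.1 * h' z.2)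

/-- The supports of `h` and of `h'` displaced by `d` are at distance at least `δ`. -/
def Separated (h h' : Space3 → ℝ) (d : Space3) (δ : ℝ) : Prop :=
  ∀ x y, h x ≠ 0 → h' y ≠ 0 → δ ≤ ‖x - y - d‖

theorem norm_integral_gauss_overlap_le {h h' : Space3 → ℝ} (hh : Integrable h)
    (hh' : Integrable h') {d : Space3} {δ t : ℝ} (hδ : 0 ≤ δ) (ht : 0 < t)
    (hsep : Separated h h' d δ) :
    |∫ z : Space3 × Space3, Real.exp (-‖z.1 - z.2 - d‖ ^ 2 / (4 * t)) * (h z.1 * h' z.2)| ≤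
      Real.exp (-δ ^ 2 / (4 * t)) * ∫ z : Space3 × Space3, |h z.1 * h' z.2| := by
  rw [← integral_const_mul, ← Real.norm_eq_abs]
  refine norm_integral_le_of_norm_le ((hh.mul_prod hh').abs.const_mul _)
    (Eventually.of_forall fun z => ?_)
  rw [norm_mul, Real.norm_eq_abs, Real.norm_eq_abs, Real.abs_exp]
  by_cases hz : h z.1 * h' z.2 = 0
  · simp [hz]
  · refine mul_le_mul_of_nonneg_right (Real.exp_le_exp.2 ?_) (abs_nonneg _)
    have := hsep z.1 z.2 (left_ne_zero_of_mul hz) (right_ne_zero_of_mul hz)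
    rw [div_le_div_iff_of_pos_right (by positivity)]
    nlinarith

theorem exists_rpow_mul_exp_le {c : ℝ} (hc : 0 < c) (N : ℕ) :
    ∃ C : ℝ, 0 ≤ C ∧ ∀ t : ℝ, 0 < t → Real.exp (-c / t) ≤ C * t ^ N := by
  refine ⟨N ! / c ^ N, by positivity, fun t ht => ?_⟩
  have h := Real.pow_div_factorial_le_exp (x := c / t) (by positivity) N
  rw [neg_div, Real.exp_neg, inv_le_comm₀ (Real.exp_pos _) (by positivity)]
  refine le_trans (le_of_eq ?_) h
  rw [div_pow]; field_simp

/-- The separation gives a factor `exp(-δ²/4t)`, smaller than any power of `t`. The range `t ≤ 2`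
leaves room for the increment of `t` in the difference quotient below. -/
theorem exists_gaussOverlap_bound {h h' : Space3 → ℝ} (hh : Integrable h)
    (hh' : Integrable h') {d : Space3} {δ : ℝ} (hδ : 0 < δ) (hsep : Separated h h' d δ) (N : ℕ) :
    ∃ C : ℝ, 0 ≤ C ∧ ∀ t : ℝ, 0 < t → t ≤ 2 → |gaussOverlap h h' d t| ≤ C * t ^ N := by
  obtain ⟨C, hC0, hC⟩ := exists_rpow_mul_exp_le (c := δ ^ 2 / 4) (by positivity) (N + 2)
  set W := ∫ z : Space3 × Space3, |h z.1 * h' z.2|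
  have hW : 0 ≤ W := integral_nonneg fun _ => abs_nonneg _
  refine ⟨2 * Real.pi ^ 2 * (C * W), by positivity, fun t ht ht2 => ?_⟩
  have h1 := norm_integral_gauss_overlap_le hh hh' hδ.le ht hsep
  have h2 : (Real.pi / t) ^ (3 / 2 : ℝ) ≤ 2 * Real.pi ^ 2 / t ^ 2 := by
    have h3 : 1 ≤ Real.pi / t := by
      rw [one_le_div ht]; linarith [Real.pi_gt_three]
    refine (Real.rpow_le_rpow_of_exponent_le h3 (show (3 / 2 : ℝ) ≤ 2 by norm_num)).trans ?_
    rw [Real.rpow_two, div_pow]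
    refine div_le_div_of_nonneg_right ?_ (by positivity)
    nlinarith [sq_nonneg Real.pi]
  rw [gaussOverlap, abs_mul, abs_of_nonneg (by positivity)]
  have h4 : Real.exp (-δ ^ 2 / (4 * t)) ≤ C * t ^ (N + 2) := by
    convert! hC t ht using 2; field_simp
  calc _ ≤ (2 * Real.pi ^ 2 / t ^ 2) * ((C * t ^ (N + 2)) * W) := by
        refine mul_le_mul h2 (h1.trans ?_) (abs_nonneg _) (by positivity)
        exact mul_le_mul_of_nonneg_right h4 hW
    _ = _ := by rw [pow_add]; field_simp

theorem pow_mul_exp_neg_le {t : ℝ} (ht : 0 < t) (x : ℝ) (hx : 0 ≤ x) (m : ℕ) :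
    x ^ m * Real.exp (-t * x) ≤ m ! * (2 / t) ^ m * Real.exp (-(t / 2) * x) := by
  have h := Real.pow_div_factorial_le_exp (x := t / 2 * x) (by positivity) m
  rw [div_le_iff₀ (by positivity), mul_pow] at h
  have h2 : Real.exp (-t * x) = Real.exp (-(t / 2) * x) * (Real.exp (t / 2 * x))⁻¹ := by
    rw [← Real.exp_neg, ← Real.exp_add]; ring_nf
  rw [h2, mul_comm (Real.exp (-(t / 2) * x)), ← mul_assoc]
  refine mul_le_mul_of_nonneg_right ?_ (Real.exp_pos _).le
  rw [← div_eq_mul_inv, div_le_iff₀ (Real.exp_pos _)]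
  have h3 : x ^ m = (2 / t) ^ m * ((t / 2) ^ m * x ^ m) := by
    rw [← mul_assoc, ← mul_pow]; field_simp; simp
  rw [h3]
  calc _ ≤ (2 / t) ^ m * (Real.exp (t / 2 * x) * m !) :=
        mul_le_mul_of_nonneg_left h (by positivity)
    _ = _ := by ring

theorem integrable_pow_mul_gaussian_mul {B : Space3 → ℂ} (hB : Continuous B) {W : ℝ}
    (hW : ∀ p, ‖B p‖ ≤ W) {t : ℝ} (ht : 0 < t) (m : ℕ) :
    Integrable (fun p : Space3 => (((‖p‖ ^ 2) ^ m * Real.exp (-t * ‖p‖ ^ 2) : ℝ) : ℂ) * B p) ∧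
    ‖∫ p : Space3, (((‖p‖ ^ 2) ^ m * Real.exp (-t * ‖p‖ ^ 2) : ℝ) : ℂ) * B p‖ ≤
      m ! * (2 / t) ^ m * W * (2 * Real.pi / t) ^ (3 / 2 : ℝ) := by
  have hb : ∀ p : Space3, ‖(((‖p‖ ^ 2) ^ m * Real.exp (-t * ‖p‖ ^ 2) : ℝ) : ℂ) * B p‖ ≤
      m ! * (2 / t) ^ m * W * Real.exp (-(t / 2) * ‖p‖ ^ 2) := by
    intro p
    rw [norm_mul, Complex.norm_real, Real.norm_of_nonneg (by positivity)]
    calc _ ≤ (m ! * (2 / t) ^ m * Real.exp (-(t / 2) * ‖p‖ ^ 2)) * W :=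
          mul_le_mul (pow_mul_exp_neg_le ht _ (by positivity) m) (hW p) (norm_nonneg _)
            (by positivity)
      _ = _ := by ring
  have hi := (integrable_exp_neg_mul_norm_sq (half_pos ht)).const_mul (m ! * (2 / t) ^ m * W)
  refine ⟨hi.mono' (by fun_prop) (Eventually.of_forall hb), ?_⟩
  refine (norm_integral_le_of_norm_le hi (Eventually.of_forall hb)).trans_eq ?_
  rw [integral_const_mul, GaussianFourier.integral_rexp_neg_mul_sq_norm (half_pos ht)]
  rw [show Module.finrank ℝ Space3 = 3 by simp]
  congr 2
  · field_simp
  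
/-- An extra factor `|p|²` is `-d/dt` of the Gaussian. Differentiation is replaced by a difference
quotient with step `s = t^M`: the values at `t` and `t + s` are smaller than any power of `t`, so
division by `s` is harmless, and the Taylor error is `s` times a moment with at most a power
singularity in `t`. -/
theorem exists_pow_gaussian_bound {h h' : Space3 → ℝ} (hh : Integrable h)
    (hh' : Integrable h') {d : Space3} {δ : ℝ} (hδ : 0 < δ) (hsep : Separated h h' d δ) (j : ℕ) :
    ∀ N : ℕ, ∃ C : ℝ, 0 ≤ C ∧ ∀ t : ℝ, 0 < t → t ≤ 2 →
      ‖∫ p : Space3, (((‖p‖ ^ 2) ^ j * Real.exp (-t * ‖p‖ ^ 2) : ℝ) : ℂ) * crossSpec h h' d p‖ ≤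
        C * t ^ N := by
  have hcont := continuous_crossSpec hh hh' d
  set W := (∫ x, |h x|) * ∫ x, |h' x|
  have hW0 : 0 ≤ W := mul_nonneg (integral_nonneg fun _ => abs_nonneg _)
    (integral_nonneg fun _ => abs_nonneg _)
  have hW : ∀ p, ‖crossSpec h h' d p‖ ≤ W := fun p => by
    rw [norm_crossSpec]
    exact mul_le_mul (norm_hat_le h p) (norm_hat_le h' p) (norm_nonneg _)
      (integral_nonneg fun _ => abs_nonneg _)
  induction j with
  | zero =>
    intro N
    obtain ⟨C, hC0, hC⟩ := exists_gaussOverlap_bound hh hh' hδ hsep N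
    refine ⟨C, hC0, fun t ht ht2 => ?_⟩
    have := integral_gaussian_crossSpec hh hh' d ht
    simp only [pow_zero, one_mul]
    rw [this, Complex.norm_real]
    exact hC t ht ht2
  | succ j ih =>
    intro N
    -- The Taylor error is of order `s t^{-(j+2)} t^{-2}`: `j + 2` powers come from the moment and 2
    -- from rounding the Gaussian volume `t^{-3/2}` up. With `s = t^M` this is `t^N`.
    set M := N + (j + 4) with hM
    obtain ⟨C, hC0, hC⟩ := ih (N + M)
    set K := (j + 2)! * (2 : ℝ) ^ (j + 2) * W * (2 * (2 * Real.pi) ^ 2) with hK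
    set K' := (j + 1)! * (2 : ℝ) ^ (j + 1) * W * (2 * Real.pi) ^ (3 / 2 : ℝ) with hK'
    refine ⟨C * (1 + 2 ^ (N + M)) + K + K', by positivity, fun t ht ht2 => ?_⟩
    rcases le_or_gt t 1 with ht1 | ht1
    · set s := t ^ M with hs
      have hs0 : 0 < s := by positivity
      have hst : s ≤ t := by
        calc t ^ M ≤ t ^ 1 := pow_le_pow_of_le_one ht.le ht1 (by omega)
          _ = t := pow_one t
      have i1 := (integrable_pow_mul_gaussian_mul hcont hW ht (j + 1)).1
      have i2 := (integrable_pow_mul_gaussian_mul hcont hW ht j).1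
      have i3 := (integrable_pow_mul_gaussian_mul hcont hW (show 0 < t + s by positivity) j).1
      have hI := (integrable_pow_mul_gaussian_mul (B := fun _ => (W : ℂ)) continuous_const
        (W := W) (fun p => by simp [abs_of_nonneg hW0]) ht (j + 2))
      have hdiff : ‖(∫ p : Space3, (((‖p‖ ^ 2) ^ (j + 1) * Real.exp (-t * ‖p‖ ^ 2) : ℝ) : ℂ) *
          crossSpec h h' d p) - ((s⁻¹ : ℝ) : ℂ) * ((∫ p : Space3, (((‖p‖ ^ 2) ^ j *
          Real.exp (-t * ‖p‖ ^ 2) : ℝ) : ℂ) * crossSpec h h' d p) - ∫ p : Space3, (((‖p‖ ^ 2) ^ j *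
          Real.exp (-(t + s) * ‖p‖ ^ 2) : ℝ) : ℂ) * crossSpec h h' d p)‖ ≤
          s * ((j + 2)! * (2 / t) ^ (j + 2) * W * (2 * Real.pi / t) ^ (3 / 2 : ℝ)) := by
        have hn : ∫ p : Space3, (‖p‖ ^ 2) ^ (j + 2) * Real.exp (-t * ‖p‖ ^ 2) * W ≤
            (j + 2)! * (2 / t) ^ (j + 2) * W * (2 * Real.pi / t) ^ (3 / 2 : ℝ) := by
          refine le_trans (le_abs_self _) (le_trans (le_of_eq ?_) hI.2)
          rw [← Real.norm_eq_abs, ← Complex.norm_real, ← integral_complex_ofReal]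
          congr 1
          refine integral_congr_ae (Eventually.of_forall fun p => ?_)
          push_cast; ring
        refine le_trans ?_ (mul_le_mul_of_nonneg_left hn hs0.le)
        have i23 : Integrable (fun p : Space3 => (((‖p‖ ^ 2) ^ j * Real.exp (-t * ‖p‖ ^ 2) : ℝ) : ℂ) *
          crossSpec h h' d p - (((‖p‖ ^ 2) ^ j * Real.exp (-(t + s) * ‖p‖ ^ 2) : ℝ) : ℂ) *
          crossSpec h h' d p) := i2.sub i3
        rw [← integral_sub i2 i3, ← integral_const_mul, ← integral_sub i1
          (Integrable.const_mul i23 _), ← integral_const_mul]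
        refine norm_integral_le_of_norm_le ?_ (Eventually.of_forall fun p => ?_)
        · refine Integrable.const_mul ?_ _
          have := hI.1.re
          refine this.congr (Eventually.of_forall fun p => ?_)
          simp only [RCLike.re_to_complex]
          rw [← Complex.ofReal_mul, Complex.ofReal_re]
        · have e : (((‖p‖ ^ 2) ^ (j + 1) * Real.exp (-t * ‖p‖ ^ 2) : ℝ) : ℂ) * crossSpec h h' d p -
              ((s⁻¹ : ℝ) : ℂ) * ((((‖p‖ ^ 2) ^ j * Real.exp (-t * ‖p‖ ^ 2) : ℝ) : ℂ) *
                crossSpec h h' d p - (((‖p‖ ^ 2) ^ j * Real.exp (-(t + s) * ‖p‖ ^ 2) : ℝ) : ℂ) *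
                crossSpec h h' d p) =
              (((‖p‖ ^ 2) ^ j * Real.exp (-t * ‖p‖ ^ 2) *
                (‖p‖ ^ 2 - s⁻¹ * (1 - Real.exp (-(s * ‖p‖ ^ 2)))) : ℝ) : ℂ) * crossSpec h h' d p := by
            rw [show -(t + s) * ‖p‖ ^ 2 = -t * ‖p‖ ^ 2 + -(s * ‖p‖ ^ 2) by ring, Real.exp_add]
            push_cast; ring
          rw [e, norm_mul, Complex.norm_real, Real.norm_eq_abs, abs_mul,
            abs_of_nonneg (by positivity)]
          have hx : 0 ≤ s * ‖p‖ ^ 2 := by positivity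
          have hle : |‖p‖ ^ 2 - s⁻¹ * (1 - Real.exp (-(s * ‖p‖ ^ 2)))| ≤ s * (‖p‖ ^ 2) ^ 2 := by
            have e2 : ‖p‖ ^ 2 - s⁻¹ * (1 - Real.exp (-(s * ‖p‖ ^ 2))) =
                s⁻¹ * (s * ‖p‖ ^ 2 - 1 + Real.exp (-(s * ‖p‖ ^ 2))) := by
              field_simp; ring
            have e3 : s * (‖p‖ ^ 2) ^ 2 = s⁻¹ * (s * ‖p‖ ^ 2) ^ 2 := by field_simp
            rw [e2, e3, abs_mul, abs_of_pos (inv_pos.2 hs0)]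
            refine mul_le_mul_of_nonneg_left ?_ (inv_pos.2 hs0).le
            have l1 := Real.add_one_le_exp (-(s * ‖p‖ ^ 2))
            -- Since `(1 - x + x²)(1 + x) = 1 + x³ ≥ 1`, this follows from `e^x ≥ 1 + x`.
            have l2 : Real.exp (-(s * ‖p‖ ^ 2)) ≤ 1 - s * ‖p‖ ^ 2 + (s * ‖p‖ ^ 2) ^ 2 := by
              set x := s * ‖p‖ ^ 2
              rw [Real.exp_neg, inv_le_comm₀ (Real.exp_pos _) (by nlinarith [sq_nonneg (x - 1)])]
              refine le_trans ?_ (Real.add_one_le_exp x)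
              rw [inv_le_iff_one_le_mul₀ (by nlinarith [sq_nonneg (x - 1)])]
              nlinarith [pow_nonneg hx 3]
            rw [abs_of_nonneg (by linarith)]
            linarith
          calc _ ≤ (‖p‖ ^ 2) ^ j * Real.exp (-t * ‖p‖ ^ 2) * (s * (‖p‖ ^ 2) ^ 2) * W :=
                mul_le_mul (mul_le_mul_of_nonneg_left hle (by positivity)) (hW p) (norm_nonneg _)
                  (by positivity)
            _ = _ := by ring
      have h1 := hC t ht ht2
      have h2 := hC (t + s) (by positivity) (by linarith)
      have h3 : C * (t + s) ^ (N + M) ≤ C * (2 ^ (N + M) * t ^ (N + M)) := by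
        rw [← mul_pow]
        exact mul_le_mul_of_nonneg_left (pow_le_pow_left₀ (by positivity) (by linarith) _) hC0
      have h4 : ‖((s⁻¹ : ℝ) : ℂ) * ((∫ p : Space3, (((‖p‖ ^ 2) ^ j *
          Real.exp (-t * ‖p‖ ^ 2) : ℝ) : ℂ) * crossSpec h h' d p) - ∫ p : Space3, (((‖p‖ ^ 2) ^ j *
          Real.exp (-(t + s) * ‖p‖ ^ 2) : ℝ) : ℂ) * crossSpec h h' d p)‖ ≤
          C * (1 + 2 ^ (N + M)) * t ^ N := by
        rw [norm_mul, Complex.norm_real, Real.norm_of_nonneg (inv_pos.2 hs0).le,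
          inv_mul_le_iff₀ hs0]
        refine (norm_sub_le _ _).trans ?_
        have : s * (C * (1 + 2 ^ (N + M)) * t ^ N) =
            C * t ^ (N + M) + C * (2 ^ (N + M) * t ^ (N + M)) := by
          rw [hs, pow_add t N M]; ring
        rw [this]; linarith
      have h5 : s * ((j + 2)! * (2 / t) ^ (j + 2) * W * (2 * Real.pi / t) ^ (3 / 2 : ℝ)) ≤
          K * t ^ N := by
        have h6 : (2 * Real.pi / t) ^ (3 / 2 : ℝ) ≤ 2 * (2 * Real.pi) ^ 2 / t ^ 2 := by
          have h3 : 1 ≤ 2 * Real.pi / t := by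
            rw [one_le_div ht]; linarith [Real.pi_gt_three]
          refine (Real.rpow_le_rpow_of_exponent_le h3 (show (3 / 2 : ℝ) ≤ 2 by norm_num)).trans ?_
          rw [Real.rpow_two, div_pow]
          refine div_le_div_of_nonneg_right ?_ (by positivity)
          nlinarith [sq_nonneg (2 * Real.pi)]
        calc _ ≤ s * ((j + 2)! * (2 / t) ^ (j + 2) * W * (2 * (2 * Real.pi) ^ 2 / t ^ 2)) := by
              gcongr
          _ = K * t ^ N := by
              rw [hs, hM, hK, div_pow, show N + (j + 4) = N + (j + 2) + 2 by ring, pow_add,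
                pow_add]
              field_simp
      have h7 : 0 ≤ K' * t ^ N := by positivity
      have h8 := norm_le_norm_add_norm_sub' (∫ p : Space3, (((‖p‖ ^ 2) ^ (j + 1) *
        Real.exp (-t * ‖p‖ ^ 2) : ℝ) : ℂ) * crossSpec h h' d p) (((s⁻¹ : ℝ) : ℂ) * ((∫ p : Space3,
        (((‖p‖ ^ 2) ^ j * Real.exp (-t * ‖p‖ ^ 2) : ℝ) : ℂ) * crossSpec h h' d p) - ∫ p : Space3,
        (((‖p‖ ^ 2) ^ j * Real.exp (-(t + s) * ‖p‖ ^ 2) : ℝ) : ℂ) * crossSpec h h' d p))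
      rw [add_mul, add_mul]
      linarith
    -- For `t > 1` the crude moment bound is enough, because `t^N ≥ 1`.
    · have h1 := (integrable_pow_mul_gaussian_mul hcont hW ht (j + 1)).2
      have h2 : (j + 1)! * (2 / t) ^ (j + 1) * W * (2 * Real.pi / t) ^ (3 / 2 : ℝ) ≤ K' := by
        have h3 : 2 / t ≤ 2 := div_le_self zero_le_two ht1.le
        have h4 : 2 * Real.pi / t ≤ 2 * Real.pi := div_le_self (by positivity) ht1.le
        rw [hK']
        gcongr
      have h5 : K' ≤ K' * t ^ N := le_mul_of_one_le_right (by positivity) (one_le_pow₀ ht1.le)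
      have h6 : 0 ≤ (C * (1 + 2 ^ (N + M)) + K) * t ^ N := by positivity
      rw [add_mul _ K']
      linarith

theorem tendsto_pow_gaussian_crossSpec {h h' : Space3 → ℝ} (hh : Integrable h)
    (hh' : Integrable h') {d : Space3} {δ : ℝ} (hδ : 0 < δ) (hsep : Separated h h' d δ) (j : ℕ) :
    Tendsto (fun t : ℝ => ∫ p : Space3, (((‖p‖ ^ 2) ^ j * Real.exp (-t * ‖p‖ ^ 2) : ℝ) : ℂ) *
      crossSpec h h' d p) (𝓝[>] 0) (𝓝 0) := by
  obtain ⟨C, -, hC⟩ := exists_pow_gaussian_bound hh hh' hδ hsep j 1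
  have h0 : Tendsto (fun t : ℝ => C * t ^ 1) (𝓝[>] 0) (𝓝 0) := by
    have : Tendsto (fun t : ℝ => C * t ^ 1) (𝓝 0) (𝓝 (C * 0 ^ 1)) :=
      Continuous.tendsto (by fun_prop) 0
    simpa using this.mono_left nhdsWithin_le_nhds
  refine squeeze_zero_norm' ?_ h0
  filter_upwards [Ioo_mem_nhdsGT (show (0 : ℝ) < 2 by norm_num)] with t ht
  exact hC t ht.1 ht.2.le

/-- The Fourier symbol of the distribution `a h - b Δg`. -/
def symb (a b : ℂ) (h g : Space3 → ℝ) (p : Space3) : ℂ :=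
  a * hat h p + b * ((‖p‖ ^ 2 : ℝ) : ℂ) * hat g p

/-- Distributions `a h - b Δg` with disjoint supports are linearly independent. -/
theorem symb_ae_eq_zero_of_separated {h g h' g' : Space3 → ℝ} (hh : Integrable h)
    (hg : Integrable g) (hh' : Integrable h') (hg' : Integrable g') {d : Space3} {δ : ℝ}
    (hδ : 0 < δ) (h1 : Separated h h' d δ) (h2 : Separated h g' d δ) (h3 : Separated g h' d δ)
    (h4 : Separated g g' d δ) {a b a' b' : ℂ}
    (heq : ∀ᵐ p, symb a b h g p =
      Complex.exp (Complex.I * ((inner ℝ p d : ℝ) : ℂ)) * symb a' b' h' g' p) :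
    ∀ᵐ p, symb a b h g p = 0 := by
  set u := symb a b h g with hu
  have hgood : ∀ {k k' : Space3 → ℝ} (_ : Integrable k) (_ : Integrable k') (t : ℝ) (_ : 0 < t)
      (j : ℕ), Integrable fun p : Space3 => (((‖p‖ ^ 2) ^ j * Real.exp (-t * ‖p‖ ^ 2) : ℝ) : ℂ) *
      crossSpec k k' d p := by
    intro k k' hk hk' t ht j
    refine (integrable_pow_mul_gaussian_mul (continuous_crossSpec hk hk' d)
      (W := (∫ x, |k x|) * ∫ x, |k' x|) (fun p => ?_) ht j).1
    rw [norm_crossSpec]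
    exact mul_le_mul (norm_hat_le k p) (norm_hat_le k' p) (norm_nonneg _)
      (integral_nonneg fun _ => abs_nonneg _)
  have hexp : ∀ t : ℝ, 0 < t → Integrable (fun p : Space3 => Real.exp (-t * ‖p‖ ^ 2) * ‖u p‖ ^ 2) ∧
      ((∫ p : Space3, Real.exp (-t * ‖p‖ ^ 2) * ‖u p‖ ^ 2 : ℝ) : ℂ) =
      a * conj a' * (∫ p : Space3, (((‖p‖ ^ 2) ^ 0 * Real.exp (-t * ‖p‖ ^ 2) : ℝ) : ℂ) *
        crossSpec h h' d p) +
      a * conj b' * (∫ p : Space3, (((‖p‖ ^ 2) ^ 1 * Real.exp (-t * ‖p‖ ^ 2) : ℝ) : ℂ) *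
        crossSpec h g' d p) +
      b * conj a' * (∫ p : Space3, (((‖p‖ ^ 2) ^ 1 * Real.exp (-t * ‖p‖ ^ 2) : ℝ) : ℂ) *
        crossSpec g h' d p) +
      b * conj b' * (∫ p : Space3, (((‖p‖ ^ 2) ^ 2 * Real.exp (-t * ‖p‖ ^ 2) : ℝ) : ℂ) *
        crossSpec g g' d p) := by
    intro t ht
    have i1 := (hgood hh hh' t ht 0).const_mul (a * conj a')
    have i2 := (hgood hh hg' t ht 1).const_mul (a * conj b')
    have i3 := (hgood hg hh' t ht 1).const_mul (b * conj a')
    have i4 := (hgood hg hg' t ht 2).const_mul (b * conj b')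
    have hae : (fun p : Space3 => ((Real.exp (-t * ‖p‖ ^ 2) * ‖u p‖ ^ 2 : ℝ) : ℂ)) =ᵐ[volume]
        fun p => a * conj a' * ((((‖p‖ ^ 2) ^ 0 * Real.exp (-t * ‖p‖ ^ 2) : ℝ) : ℂ) *
        crossSpec h h' d p) + a * conj b' * ((((‖p‖ ^ 2) ^ 1 * Real.exp (-t * ‖p‖ ^ 2) : ℝ) : ℂ) *
        crossSpec h g' d p) + b * conj a' * ((((‖p‖ ^ 2) ^ 1 * Real.exp (-t * ‖p‖ ^ 2) : ℝ) : ℂ) *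
        crossSpec g h' d p) + b * conj b' * ((((‖p‖ ^ 2) ^ 2 * Real.exp (-t * ‖p‖ ^ 2) : ℝ) : ℂ) *
        crossSpec g g' d p) := by
      filter_upwards [heq] with p hp
      have e1 : ((‖u p‖ ^ 2 : ℝ) : ℂ) = u p * conj (u p) := by
        rw [Complex.mul_conj, Complex.normSq_eq_norm_sq]
      rw [Complex.ofReal_mul, e1]
      -- Only the conjugated factor is replaced by its displaced form, so that `|u|²` becomes a sum
      -- of cross spectra between separated functions.
      nth_rewrite 2 [hp]
      simp only [hu, symb, crossSpec, map_mul, map_add, Complex.conj_ofReal]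
      push_cast; ring
    have itot := ((i1.add i2).add i3).add i4
    refine ⟨?_, ?_⟩
    · have := (itot.congr hae.symm).re
      refine this.congr (Eventually.of_forall fun p => ?_)
      simp only [RCLike.re_to_complex, Complex.ofReal_re]
    · rw [← integral_const_mul, ← integral_const_mul, ← integral_const_mul, ← integral_const_mul,
        ← integral_add i1 i2, ← integral_add (i1.fun_add i2) i3, ← integral_add ((i1.fun_add i2).fun_add i3) i4,
        ← integral_complex_ofReal]
      exact integral_congr_ae hae
  have hlim := (((((tendsto_pow_gaussian_crossSpec hh hh' hδ h1 0).const_mul (a * conj a')).add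
    ((tendsto_pow_gaussian_crossSpec hh hg' hδ h2 1).const_mul (a * conj b'))).add
    ((tendsto_pow_gaussian_crossSpec hg hh' hδ h3 1).const_mul (b * conj a'))).add
    ((tendsto_pow_gaussian_crossSpec hg hg' hδ h4 2).const_mul (b * conj b'))).norm
  simp only [mul_zero, add_zero, norm_zero] at hlim
  -- The regularised norm increases as `t` decreases, yet tends to 0 as `t → 0`; hence its value at
  -- `t = 1` is already 0.
  have hle : ∫ p : Space3, Real.exp (-1 * ‖p‖ ^ 2) * ‖u p‖ ^ 2 ≤ 0 := by
    refine ge_of_tendsto hlim ?_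
    filter_upwards [Ioo_mem_nhdsGT (show (0 : ℝ) < 1 by norm_num)] with t ht
    rw [← (hexp t ht.1).2, Complex.norm_real, Real.norm_eq_abs]
    refine le_trans ?_ (le_abs_self _)
    refine integral_mono (hexp 1 one_pos).1 (hexp t ht.1).1 fun p => ?_
    refine mul_le_mul_of_nonneg_right (Real.exp_le_exp.2 ?_) (by positivity)
    nlinarith [sq_nonneg ‖p‖, ht.2]
  have hzero := (integral_eq_zero_iff_of_nonneg (fun p => by positivity) (hexp 1 one_pos).1).1
    (le_antisymm hle (integral_nonneg fun p => by positivity))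
  filter_upwards [hzero] with p hp
  simpa using hp

/-! ### Riesz potentials at large separation -/

/-- The Mellin transform of the Gaussian overlap. -/
def gaussMoment (σ : ℝ) (h h' : Space3 → ℝ) (d : Space3) : ℝ :=
  ∫ t in Set.Ioi (0 : ℝ), t ^ (σ - 1) * gaussOverlap h h' d t

/-- The constant of the Riesz kernel `|x|^{2σ-3}`. -/
def rieszConst (σ : ℝ) : ℝ :=
  ∫ s in Set.Ioi (0 : ℝ), s ^ (σ - 1) * (Real.pi / s) ^ (3 / 2 : ℝ) * Real.exp (-1 / (4 * s))

/-- The exponential controls every power at the origin. At infinity the integrand is of order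
`s^{σ-5/2}`, which is where `σ < 3/2` is needed; negative `σ` is allowed and is used for positive
powers of the wave number. -/
theorem integrableOn_riesz {σ c : ℝ} (hσ : σ < 3 / 2) (hc : 0 < c) :
    IntegrableOn (fun s : ℝ => s ^ (σ - 1) * (Real.pi / s) ^ (3 / 2 : ℝ) * Real.exp (-c / s))
      (Set.Ioi 0) := by
  have hmeas : Measurable fun s : ℝ =>
      s ^ (σ - 1) * (Real.pi / s) ^ (3 / 2 : ℝ) * Real.exp (-c / s) := by fun_prop
  have e : ∀ s : ℝ, 0 < s → s ^ (σ - 1) * (Real.pi / s) ^ (3 / 2 : ℝ) * Real.exp (-c / s) =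
      Real.pi ^ (3 / 2 : ℝ) * (s ^ (σ - 5 / 2) * Real.exp (-c / s)) := by
    intro s hs
    rw [Real.div_rpow Real.pi_pos.le hs.le, show σ - 5 / 2 = σ - 1 - 3 / 2 by ring,
      Real.rpow_sub hs (σ - 1)]
    ring
  rw [← Set.Ioc_union_Ioi_eq_Ioi zero_le_one, integrableOn_union]
  constructor
  · obtain ⟨N, hN⟩ := exists_nat_ge (5 / 2 - σ)
    obtain ⟨C, hC0, hC⟩ := exists_rpow_mul_exp_le hc N
    refine Measure.integrableOn_of_bounded (M := Real.pi ^ (3 / 2 : ℝ) * C) (by simp)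
      hmeas.aestronglyMeasurable ?_
    refine (ae_restrict_iff' measurableSet_Ioc).2 (Eventually.of_forall fun s hs => ?_)
    have hs0 : 0 < s := hs.1
    rw [e s hs0, Real.norm_of_nonneg (by positivity)]
    refine mul_le_mul_of_nonneg_left ?_ (by positivity)
    calc s ^ (σ - 5 / 2) * Real.exp (-c / s) ≤ s ^ (σ - 5 / 2) * (C * s ^ N) :=
          mul_le_mul_of_nonneg_left (hC s hs0) (by positivity)
      _ = C * s ^ (σ - 5 / 2 + N) := by
          rw [Real.rpow_add hs0, Real.rpow_natCast]; ring
      _ ≤ C * 1 := mul_le_mul_of_nonneg_left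
          (Real.rpow_le_one hs0.le hs.2 (by linarith)) hC0
      _ = C := mul_one C
  · have h1 : IntegrableOn (fun s : ℝ => Real.pi ^ (3 / 2 : ℝ) * s ^ (σ - 5 / 2)) (Set.Ioi 1) :=
      (integrableOn_Ioi_rpow_of_lt (by linarith) one_pos).const_mul _
    refine Integrable.mono' h1 hmeas.aestronglyMeasurable ?_
    refine (ae_restrict_iff' measurableSet_Ioi).2 (Eventually.of_forall fun s hs => ?_)
    have hs0 : 0 < s := lt_trans one_pos hs
    rw [e s hs0, Real.norm_of_nonneg (by positivity)]
    refine mul_le_mul_of_nonneg_left ?_ (by positivity)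
    refine mul_le_of_le_one_right (by positivity) (Real.exp_le_one_iff.2 ?_)
    rw [neg_div]
    exact neg_nonpos.2 (by positivity)

theorem rieszConst_pos {σ : ℝ} (hσ : σ < 3 / 2) : 0 < rieszConst σ := by
  have hi := integrableOn_riesz hσ (show (0 : ℝ) < 1 / 4 by norm_num)
  have e : (fun s : ℝ => s ^ (σ - 1) * (Real.pi / s) ^ (3 / 2 : ℝ) * Real.exp (-(1 / 4) / s)) =
      fun s : ℝ => s ^ (σ - 1) * (Real.pi / s) ^ (3 / 2 : ℝ) * Real.exp (-1 / (4 * s)) := by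
    funext s; congr 2; rw [← div_div]; ring
  rw [e] at hi
  rw [rieszConst, setIntegral_pos_iff_support_of_nonneg_ae]
  · have : Function.support (fun s : ℝ => s ^ (σ - 1) * (Real.pi / s) ^ (3 / 2 : ℝ) *
        Real.exp (-1 / (4 * s))) ∩ Set.Ioi 0 = Set.Ioi 0 := by
      refine Set.inter_eq_right.2 fun s hs => ?_
      have hs0 : 0 < s := hs
      have : 0 < s ^ (σ - 1) * (Real.pi / s) ^ (3 / 2 : ℝ) * Real.exp (-1 / (4 * s)) := by
        positivity
      exact this.ne'
    rw [this]; simp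
  · refine (ae_restrict_iff' measurableSet_Ioi).2 (Eventually.of_forall fun s hs => ?_)
    have hs0 : 0 < s := hs
    simp only [Pi.zero_apply]
    positivity
  · exact hi

/-- The substitution `t = |d|² s` extracts the power `|d|^{2σ-3}` of the Riesz kernel and leaves a
dimensionless separation that tends to 1. -/
theorem gaussMoment_scaling (σ : ℝ) (h h' : Space3 → ℝ) {d : Space3} (hd : d ≠ 0) :
    ‖d‖ ^ (3 - 2 * σ) * gaussMoment σ h h' d =
      ∫ s in Set.Ioi (0 : ℝ), s ^ (σ - 1) * (Real.pi / s) ^ (3 / 2 : ℝ) *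
        ∫ z : Space3 × Space3, Real.exp (-(‖z.1 - z.2 - d‖ / ‖d‖) ^ 2 / (4 * s)) *
          (h z.1 * h' z.2) := by
  have hD : 0 < ‖d‖ := norm_pos_iff.2 hd
  have h1 := integral_comp_mul_left_Ioi' (fun t : ℝ => t ^ (σ - 1) * gaussOverlap h h' d t) 0
    (show 0 < ‖d‖ ^ 2 by positivity)
  simp only [mul_zero] at h1
  rw [gaussMoment, ← h1, smul_eq_mul, ← mul_assoc, ← integral_const_mul]
  refine setIntegral_congr_fun measurableSet_Ioi fun s hs => ?_
  have hs0 : 0 < s := hs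
  have e1 : (Real.pi / (‖d‖ ^ 2 * s)) ^ (3 / 2 : ℝ) = (‖d‖ ^ 3)⁻¹ * (Real.pi / s) ^ (3 / 2 : ℝ) := by
    rw [show Real.pi / (‖d‖ ^ 2 * s) = (‖d‖ ^ 2)⁻¹ * (Real.pi / s) by field_simp,
      Real.mul_rpow (by positivity) (by positivity), Real.inv_rpow (by positivity),
      ← Real.rpow_natCast ‖d‖ 2, ← Real.rpow_mul hD.le, ← Real.rpow_natCast ‖d‖ 3]
    norm_num
  have e2 : ‖d‖ ^ (3 - 2 * σ) * ‖d‖ ^ 2 * (‖d‖ ^ 2 * s) ^ (σ - 1) * (‖d‖ ^ 3)⁻¹ = s ^ (σ - 1) := by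
    rw [Real.mul_rpow (by positivity) hs0.le]
    have : ‖d‖ ^ (3 - 2 * σ) * ‖d‖ ^ 2 * (‖d‖ ^ 2) ^ (σ - 1) * (‖d‖ ^ 3)⁻¹ = 1 := by
      rw [← Real.rpow_natCast ‖d‖ 2, ← Real.rpow_natCast ‖d‖ 3, ← Real.rpow_neg hD.le,
        ← Real.rpow_mul hD.le, ← Real.rpow_add hD, ← Real.rpow_add hD, ← Real.rpow_add hD]
      rw [show 3 - 2 * σ + ((2 : ℕ) : ℝ) + ((2 : ℕ) : ℝ) * (σ - 1) + -((3 : ℕ) : ℝ) = 0 by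
        push_cast; ring, Real.rpow_zero]
    calc _ = (‖d‖ ^ (3 - 2 * σ) * ‖d‖ ^ 2 * (‖d‖ ^ 2) ^ (σ - 1) * (‖d‖ ^ 3)⁻¹) * s ^ (σ - 1) := by
          ring
      _ = _ := by rw [this, one_mul]
  simp only [gaussOverlap]
  rw [e1]
  have e3 : ∀ z : Space3 × Space3, -‖z.1 - z.2 - d‖ ^ 2 / (4 * (‖d‖ ^ 2 * s)) =
      -(‖z.1 - z.2 - d‖ / ‖d‖) ^ 2 / (4 * s) := by
    intro z; field_simp
  simp only [e3]
  rw [← e2]; ring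

theorem tendsto_norm_cobounded : Tendsto (fun d : Space3 => ‖d‖) (Bornology.cobounded Space3) atTop :=
  tendsto_norm_cobounded_atTop

/-- Dominated convergence along a filter requires the filter to be countably generated. -/
instance isCountablyGenerated_cobounded : (Bornology.cobounded Space3).IsCountablyGenerated := by
  rw [← comap_norm_atTop]; infer_instance

theorem tendsto_norm_sub_div_norm (v : Space3) :
    Tendsto (fun d : Space3 => ‖v - d‖ / ‖d‖) (Bornology.cobounded Space3) (𝓝 1) := by
  have h0 : Tendsto (fun d : Space3 => ‖v‖ / ‖d‖) (Bornology.cobounded Space3) (𝓝 0) :=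
    tendsto_const_nhds.div_atTop tendsto_norm_cobounded
  rw [tendsto_iff_norm_sub_tendsto_zero]
  refine squeeze_zero' (Eventually.of_forall fun _ => norm_nonneg _) ?_ h0
  filter_upwards [tendsto_norm_cobounded.eventually_gt_atTop 0] with d hd
  rw [div_sub_one hd.ne', norm_div, norm_norm]
  refine div_le_div_of_nonneg_right ?_ hd.le
  have := abs_norm_sub_norm_le (v - d) (-d)
  rw [norm_neg, sub_neg_eq_add, sub_add_cancel] at this
  exact this

theorem tendsto_gaussMoment {σ : ℝ} (hσ : σ < 3 / 2) {h h' : Space3 → ℝ} (hh : Integrable h)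
    (hh' : Integrable h') {ρ : ℝ} (hρ : ∀ x, h x ≠ 0 → ‖x‖ ≤ ρ) (hρ' : ∀ x, h' x ≠ 0 → ‖x‖ ≤ ρ) :
    Tendsto (fun d => ‖d‖ ^ (3 - 2 * σ) * gaussMoment σ h h' d) (Bornology.cobounded Space3)
      (𝓝 (rieszConst σ * ((∫ x, h x) * ∫ x, h' x))) := by
  have hprod : Integrable (fun z : Space3 × Space3 => h z.1 * h' z.2) := hh.mul_prod hh'
  have hw : ∫ z : Space3 × Space3, h z.1 * h' z.2 = (∫ x, h x) * ∫ x, h' x := by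
    rw [Measure.volume_eq_prod]; exact integral_prod_mul h h'
  have hev : ∀ᶠ d in Bornology.cobounded Space3, 4 * ρ ≤ ‖d‖ ∧ 0 < ‖d‖ :=
    (tendsto_norm_cobounded.eventually_ge_atTop _).and (tendsto_norm_cobounded.eventually_gt_atTop 0)
  rw [rieszConst, ← integral_mul_const]
  have key : Tendsto (fun d : Space3 => ∫ s in Set.Ioi (0 : ℝ), s ^ (σ - 1) *
      (Real.pi / s) ^ (3 / 2 : ℝ) * ∫ z : Space3 × Space3,
        Real.exp (-(‖z.1 - z.2 - d‖ / ‖d‖) ^ 2 / (4 * s)) * (h z.1 * h' z.2))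
      (Bornology.cobounded Space3) (𝓝 (∫ s in Set.Ioi (0 : ℝ), s ^ (σ - 1) *
      (Real.pi / s) ^ (3 / 2 : ℝ) * Real.exp (-1 / (4 * s)) * ((∫ x, h x) * ∫ x, h' x))) := by
    -- Once `|d| ≥ 4ρ`, the relative separation is at least `1/2`, whence the majorant `exp(-1/(16
    -- s))`.
    refine tendsto_integral_filter_of_dominated_convergence
      (fun s => (∫ z : Space3 × Space3, |h z.1 * h' z.2|) *
        (s ^ (σ - 1) * (Real.pi / s) ^ (3 / 2 : ℝ) * Real.exp (-(1 / 16) / s))) ?_ ?_ ?_ ?_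
    · refine Eventually.of_forall fun d => ?_
      refine AEStronglyMeasurable.mul (Measurable.aestronglyMeasurable (by fun_prop)) ?_
      have hm : AEStronglyMeasurable (fun q : ℝ × (Space3 × Space3) =>
          Real.exp (-(‖q.2.1 - q.2.2 - d‖ / ‖d‖) ^ 2 / (4 * q.1)) * (h q.2.1 * h' q.2.2))
          ((volume.restrict (Set.Ioi 0)).prod volume) := by
        refine AEStronglyMeasurable.mul (Measurable.aestronglyMeasurable (by fun_prop)) ?_
        exact hprod.aestronglyMeasurable.comp_snd
      exact hm.integral_prod_right'
    · filter_upwards [hev] with d ⟨hd, hd0⟩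
      refine (ae_restrict_iff' measurableSet_Ioi).2 (Eventually.of_forall fun s hs => ?_)
      have hs0 : 0 < s := hs
      rw [norm_mul, Real.norm_of_nonneg (by positivity)]
      have hb : ‖∫ z : Space3 × Space3, Real.exp (-(‖z.1 - z.2 - d‖ / ‖d‖) ^ 2 / (4 * s)) *
          (h z.1 * h' z.2)‖ ≤ ∫ z : Space3 × Space3, Real.exp (-(1 / 16) / s) * |h z.1 * h' z.2| := by
        refine norm_integral_le_of_norm_le (hprod.abs.const_mul _)
          (Eventually.of_forall fun z => ?_)
        rw [norm_mul, Real.norm_eq_abs, Real.norm_eq_abs, Real.abs_exp]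
        by_cases hz : h z.1 * h' z.2 = 0
        · simp [hz]
        · refine mul_le_mul_of_nonneg_right (Real.exp_le_exp.2 ?_) (abs_nonneg _)
          have h1 := hρ z.1 (left_ne_zero_of_mul hz)
          have h2 := hρ' z.2 (right_ne_zero_of_mul hz)
          have h3 : ‖d‖ / 2 ≤ ‖z.1 - z.2 - d‖ := by
            have h4 := norm_sub_norm_le d (z.1 - z.2)
            rw [norm_sub_rev d] at h4
            have h5 := norm_sub_le z.1 z.2
            linarith
          have h6 : 1 / 2 ≤ ‖z.1 - z.2 - d‖ / ‖d‖ := by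
            rw [le_div_iff₀ hd0]; linarith
          have h7 : 1 / 4 ≤ (‖z.1 - z.2 - d‖ / ‖d‖) ^ 2 := by nlinarith
          rw [show -(1 / 16 : ℝ) / s = -(1 / 4) / (4 * s) by field_simp; norm_num]
          exact div_le_div_of_nonneg_right (by linarith) (by positivity)
      rw [integral_const_mul] at hb
      calc _ ≤ s ^ (σ - 1) * (Real.pi / s) ^ (3 / 2 : ℝ) * (Real.exp (-(1 / 16) / s) *
            ∫ z : Space3 × Space3, |h z.1 * h' z.2|) :=
            mul_le_mul_of_nonneg_left hb (by positivity)
        _ = _ := by ring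
    · exact (integrableOn_riesz hσ (by norm_num)).const_mul _
    · refine (ae_restrict_iff' measurableSet_Ioi).2 (Eventually.of_forall fun s hs => ?_)
      have hs0 : 0 < s := hs
      rw [mul_assoc (s ^ (σ - 1) * (Real.pi / s) ^ (3 / 2 : ℝ))]
      refine Tendsto.const_mul _ ?_
      rw [← hw, ← integral_const_mul]
      refine tendsto_integral_filter_of_dominated_convergence (fun z => |h z.1 * h' z.2|) ?_ ?_
        hprod.abs ?_
      · refine Eventually.of_forall fun d => AEStronglyMeasurable.mul
          (Measurable.aestronglyMeasurable (by fun_prop)) hprod.aestronglyMeasurable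
      · refine Eventually.of_forall fun d => Eventually.of_forall fun z => ?_
        rw [norm_mul, Real.norm_eq_abs, Real.norm_eq_abs, Real.abs_exp]
        refine mul_le_of_le_one_left (abs_nonneg _) (Real.exp_le_one_iff.2 ?_)
        rw [neg_div]
        exact neg_nonpos.2 (by positivity)
      · refine Eventually.of_forall fun z => Tendsto.mul_const _ ?_
        have h1 := tendsto_norm_sub_div_norm (z.1 - z.2)
        have h2 := ((h1.pow 2).neg.div_const (4 * s)).rexp
        simpa using h2
  refine key.congr' ?_
  filter_upwards [hev] with d hd
  rw [gaussMoment_scaling σ h h' (norm_pos_iff.1 hd.2)]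

/-- Negative powers of the wave number, as superpositions of Gaussians. -/
theorem integral_neg_rpow_crossSpec {τ : ℝ} (hτ : 0 < τ) {h h' : Space3 → ℝ}
    (hh : Integrable h) (hh' : Integrable h') (d : Space3)
    (hint : Integrable fun p => ‖p‖ ^ (-2 * τ) * (‖hat h p‖ * ‖hat h' p‖)) :
    ∫ p : Space3, ((‖p‖ ^ (-2 * τ) : ℝ) : ℂ) * crossSpec h h' d p =
      (((Real.Gamma τ)⁻¹ * gaussMoment τ h h' d : ℝ) : ℂ) := by
  have hcont := continuous_crossSpec hh hh' d
  have hne : ∀ᵐ p : Space3, p ≠ 0 := by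
    rw [ae_iff]; simp
  have hG := Real.Gamma_pos_of_pos hτ
  have hI : ∀ p : Space3, p ≠ 0 → ∫ t in Set.Ioi (0 : ℝ), t ^ (τ - 1) * Real.exp (-t * ‖p‖ ^ 2) =
      ‖p‖ ^ (-2 * τ) * Real.Gamma τ := by
    intro p hp
    have hp0 : 0 < ‖p‖ := norm_pos_iff.2 hp
    have := Real.integral_rpow_mul_exp_neg_mul_Ioi hτ (show 0 < ‖p‖ ^ 2 by positivity)
    rw [one_div, ← Real.rpow_natCast, ← Real.rpow_neg hp0.le, ← Real.rpow_mul hp0.le] at this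
    convert! this using 2
    · simp [mul_comm]
  have hint2 : Integrable (Function.uncurry fun (p : Space3) (t : ℝ) =>
      ((t ^ (τ - 1) * Real.exp (-t * ‖p‖ ^ 2) : ℝ) : ℂ) * crossSpec h h' d p)
      (volume.prod (volume.restrict (Set.Ioi 0))) := by
    have hm : AEStronglyMeasurable (Function.uncurry fun (p : Space3) (t : ℝ) =>
      ((t ^ (τ - 1) * Real.exp (-t * ‖p‖ ^ 2) : ℝ) : ℂ) * crossSpec h h' d p)
      (volume.prod (volume.restrict (Set.Ioi 0))) := by
      refine Measurable.aestronglyMeasurable ?_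
      refine Measurable.mul (by fun_prop) (hcont.measurable.comp measurable_fst)
    rw [integrable_prod_iff hm]
    constructor
    · filter_upwards [hne] with p hp
      have hp0 : 0 < ‖p‖ := norm_pos_iff.2 hp
      have hr : Integrable (fun t : ℝ => t ^ (τ - 1) * Real.exp (-t * ‖p‖ ^ 2))
        (volume.restrict (Set.Ioi 0)) := by
        -- A non-integrable function has Bochner integral 0, whereas the value computed here is
        -- positive.
        refine not_imp_comm.1 integral_undef ?_
        rw [hI p hp]
        positivity
      exact (Integrable.ofReal (𝕜 := ℂ) hr).mul_const (crossSpec h h' d p)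
    · refine (hint.mul_const (Real.Gamma τ)).congr ?_
      filter_upwards [hne] with p hp
      simp only [Function.uncurry, norm_mul, norm_crossSpec, Complex.norm_real]
      rw [integral_mul_const]
      have : ∫ t in Set.Ioi (0 : ℝ), ‖t ^ (τ - 1)‖ * ‖Real.exp (-t * ‖p‖ ^ 2)‖ =
          ∫ t in Set.Ioi (0 : ℝ), t ^ (τ - 1) * Real.exp (-t * ‖p‖ ^ 2) := by
        refine setIntegral_congr_fun measurableSet_Ioi fun t ht => ?_
        have ht0 : 0 < t := ht
        rw [Real.norm_of_nonneg (by positivity), Real.norm_of_nonneg (by positivity)]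
      rw [this, hI p hp]; ring
  have hswap := integral_integral_swap hint2
  have e1 : ∫ p : Space3, ∫ t in Set.Ioi (0 : ℝ),
      ((t ^ (τ - 1) * Real.exp (-t * ‖p‖ ^ 2) : ℝ) : ℂ) * crossSpec h h' d p =
      ((Real.Gamma τ : ℝ) : ℂ) * ∫ p : Space3, ((‖p‖ ^ (-2 * τ) : ℝ) : ℂ) * crossSpec h h' d p := by
    rw [← integral_const_mul]
    refine integral_congr_ae ?_
    filter_upwards [hne] with p hp
    rw [integral_mul_const, integral_complex_ofReal, hI p hp]
    push_cast; ring
  have e2 : ∫ t in Set.Ioi (0 : ℝ), ∫ p : Space3,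
      ((t ^ (τ - 1) * Real.exp (-t * ‖p‖ ^ 2) : ℝ) : ℂ) * crossSpec h h' d p =
      ((gaussMoment τ h h' d : ℝ) : ℂ) := by
    rw [gaussMoment, ← integral_complex_ofReal]
    refine setIntegral_congr_fun measurableSet_Ioi fun t ht => ?_
    have := integral_gaussian_crossSpec hh hh' d ht
    simp only [gaussOverlap]
    rw [Complex.ofReal_mul, ← this, ← integral_const_mul]
    refine integral_congr_ae (Eventually.of_forall fun p => ?_)
    push_cast; ring
  rw [e1, e2] at hswap
  rw [Complex.ofReal_mul, ← hswap, Complex.ofReal_inv, inv_mul_cancel_left₀]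
  exact_mod_cast hG.ne'

/-- The constant in `p^{2θ} ∝ ∫ t^{-θ-1} (1 - e^{-tp²}) dt`. -/
def bernsteinConst (θ : ℝ) : ℝ := ∫ t in Set.Ioi (0 : ℝ), t ^ (-θ - 1) * (1 - Real.exp (-t))

theorem integrableOn_bernstein {θ : ℝ} (h0 : 0 < θ) (h1 : θ < 1) :
    IntegrableOn (fun t : ℝ => t ^ (-θ - 1) * (1 - Real.exp (-t))) (Set.Ioi 0) := by
  have hmeas : Measurable fun t : ℝ => t ^ (-θ - 1) * (1 - Real.exp (-t)) := by fun_prop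
  rw [← Set.Ioc_union_Ioi_eq_Ioi zero_le_one, integrableOn_union]
  constructor
  · have hi : IntegrableOn (fun t : ℝ => t ^ (-θ)) (Set.Ioc 0 1) := by
      rw [← intervalIntegrable_iff_integrableOn_Ioc_of_le zero_le_one]
      exact intervalIntegral.intervalIntegrable_rpow' (by linarith)
    refine Integrable.mono' hi hmeas.aestronglyMeasurable ?_
    refine (ae_restrict_iff' measurableSet_Ioc).2 (Eventually.of_forall fun t ht => ?_)
    have ht0 : 0 < t := ht.1
    have h2 := Real.add_one_le_exp (-t)
    have h3 : Real.exp (-t) ≤ 1 := Real.exp_le_one_iff.2 (by linarith)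
    rw [Real.norm_of_nonneg (mul_nonneg (by positivity) (by linarith))]
    calc _ ≤ t ^ (-θ - 1) * t := mul_le_mul_of_nonneg_left (by linarith) (by positivity)
      _ = t ^ (-θ) := by rw [Real.rpow_sub_one ht0.ne']; field_simp
  · have hi : IntegrableOn (fun t : ℝ => t ^ (-θ - 1)) (Set.Ioi 1) :=
      integrableOn_Ioi_rpow_of_lt (by linarith) one_pos
    refine Integrable.mono' hi hmeas.aestronglyMeasurable ?_
    refine (ae_restrict_iff' measurableSet_Ioi).2 (Eventually.of_forall fun t ht => ?_)
    have ht0 : 0 < t := lt_trans one_pos ht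
    have h3 : Real.exp (-t) ≤ 1 := Real.exp_le_one_iff.2 (by linarith)
    rw [Real.norm_of_nonneg (mul_nonneg (by positivity) (by linarith))]
    exact mul_le_of_le_one_right (by positivity) (by linarith [Real.exp_pos (-t)])

theorem bernsteinConst_pos {θ : ℝ} (h0 : 0 < θ) (h1 : θ < 1) : 0 < bernsteinConst θ := by
  have hpos : ∀ s : ℝ, 0 < s → 0 < s ^ (-θ - 1) * (1 - Real.exp (-s)) := by
    intro s hs
    have : Real.exp (-s) < 1 := Real.exp_lt_one_iff.2 (by linarith)
    exact mul_pos (by positivity) (by linarith)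
  rw [bernsteinConst, setIntegral_pos_iff_support_of_nonneg_ae]
  · have : Function.support (fun s : ℝ => s ^ (-θ - 1) * (1 - Real.exp (-s))) ∩ Set.Ioi 0 =
        Set.Ioi 0 := Set.inter_eq_right.2 fun s hs => (hpos s hs).ne'
    rw [this]; simp
  · exact (ae_restrict_iff' measurableSet_Ioi).2 (Eventually.of_forall fun s hs => (hpos s hs).le)
  · exact integrableOn_bernstein h0 h1

theorem integral_bernstein (θ : ℝ) {x : ℝ} (hx : 0 < x) :
    ∫ t in Set.Ioi (0 : ℝ), t ^ (-θ - 1) * (1 - Real.exp (-t * x)) =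
      x ^ θ * bernsteinConst θ := by
  have h1 := integral_comp_mul_left_Ioi' (fun t : ℝ => t ^ (-θ - 1) * (1 - Real.exp (-t))) 0 hx
  rw [mul_zero] at h1
  rw [bernsteinConst, ← h1, smul_eq_mul, ← mul_assoc, ← integral_const_mul]
  refine setIntegral_congr_fun measurableSet_Ioi fun t ht => ?_
  have ht0 : 0 < t := ht
  rw [Real.mul_rpow hx.le ht0.le, show -(x * t) = -t * x by ring, ← mul_assoc]
  congr 1
  have : x ^ θ * x * x ^ (-θ - 1) = 1 := by
    rw [← Real.rpow_add_one hx.ne', ← Real.rpow_add hx]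
    simp
  rw [← mul_assoc, this, one_mul]

/-- Formally this is the position-space overlap of two functions with disjoint supports. The
Gaussian regularisation vanishes as `t → 0`, and integrability of the cross spectrum allows the
limit under the integral. -/
theorem integral_crossSpec_eq_zero {h h' : Space3 → ℝ} (hh : Integrable h)
    (hh' : Integrable h') {d : Space3} {δ : ℝ} (hδ : 0 < δ) (hsep : Separated h h' d δ)
    (hint : Integrable fun p => ‖hat h p‖ * ‖hat h' p‖) : ∫ p, crossSpec h h' d p = 0 := by
  have hcont := continuous_crossSpec hh hh' d
  have h1 := tendsto_pow_gaussian_crossSpec hh hh' hδ hsep 0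
  simp only [pow_zero, one_mul] at h1
  refine tendsto_nhds_unique (tendsto_integral_filter_of_dominated_convergence
    (fun p => ‖hat h p‖ * ‖hat h' p‖) ?_ ?_ hint ?_) h1
  · exact Eventually.of_forall fun t => Continuous.aestronglyMeasurable (by fun_prop)
  · filter_upwards [self_mem_nhdsWithin] with t ht
    refine Eventually.of_forall fun p => ?_
    have ht0 : 0 < t := ht
    rw [norm_mul, norm_crossSpec, Complex.norm_real, Real.norm_of_nonneg (by positivity)]
    refine mul_le_of_le_one_left (by positivity) (Real.exp_le_one_iff.2 ?_)
    rw [neg_mul]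
    exact neg_nonpos.2 (by positivity)
  · refine Eventually.of_forall fun p => ?_
    have : Continuous fun t : ℝ => ((Real.exp (-t * ‖p‖ ^ 2) : ℝ) : ℂ) * crossSpec h h' d p := by
      fun_prop
    simpa using (this.tendsto 0).mono_left nhdsWithin_le_nhds

/-- Positive powers of the wave number, for separated supports. -/
theorem integral_pos_rpow_crossSpec {θ : ℝ} (hθ0 : 0 < θ) (hθ1 : θ < 1) {h h' : Space3 → ℝ}
    (hh : Integrable h) (hh' : Integrable h') {d : Space3} {δ : ℝ} (hδ : 0 < δ)
    (hsep : Separated h h' d δ) (hint0 : Integrable fun p => ‖hat h p‖ * ‖hat h' p‖)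
    (hint : Integrable fun p => ‖p‖ ^ (2 * θ) * (‖hat h p‖ * ‖hat h' p‖)) :
    ∫ p : Space3, ((‖p‖ ^ (2 * θ) : ℝ) : ℂ) * crossSpec h h' d p =
      ((-(bernsteinConst θ)⁻¹ * gaussMoment (-θ) h h' d : ℝ) : ℂ) := by
  have hcont := continuous_crossSpec hh hh' d
  have hne : ∀ᵐ p : Space3, p ≠ 0 := by
    rw [ae_iff]; simp
  have hG := bernsteinConst_pos hθ0 hθ1
  have hI : ∀ p : Space3, p ≠ 0 →
      ∫ t in Set.Ioi (0 : ℝ), t ^ (-θ - 1) * (1 - Real.exp (-t * ‖p‖ ^ 2)) =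
      ‖p‖ ^ (2 * θ) * bernsteinConst θ := by
    intro p hp
    have hp0 : 0 < ‖p‖ := norm_pos_iff.2 hp
    rw [integral_bernstein θ (by positivity), ← Real.rpow_natCast, ← Real.rpow_mul hp0.le]
    norm_num
  have hint2 : Integrable (Function.uncurry fun (p : Space3) (t : ℝ) =>
      ((t ^ (-θ - 1) * (1 - Real.exp (-t * ‖p‖ ^ 2)) : ℝ) : ℂ) * crossSpec h h' d p)
      (volume.prod (volume.restrict (Set.Ioi 0))) := by
    have hm : AEStronglyMeasurable (Function.uncurry fun (p : Space3) (t : ℝ) =>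
      ((t ^ (-θ - 1) * (1 - Real.exp (-t * ‖p‖ ^ 2)) : ℝ) : ℂ) * crossSpec h h' d p)
      (volume.prod (volume.restrict (Set.Ioi 0))) := by
      refine Measurable.aestronglyMeasurable ?_
      refine Measurable.mul (by fun_prop) (hcont.measurable.comp measurable_fst)
    rw [integrable_prod_iff hm]
    constructor
    · filter_upwards [hne] with p hp
      have hp0 : 0 < ‖p‖ := norm_pos_iff.2 hp
      have hr : Integrable (fun t : ℝ => t ^ (-θ - 1) * (1 - Real.exp (-t * ‖p‖ ^ 2)))
        (volume.restrict (Set.Ioi 0)) := by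
        refine not_imp_comm.1 integral_undef ?_
        rw [hI p hp]
        positivity
      exact (Integrable.ofReal (𝕜 := ℂ) hr).mul_const (crossSpec h h' d p)
    · refine (hint.mul_const (bernsteinConst θ)).congr ?_
      filter_upwards [hne] with p hp
      simp only [Function.uncurry, norm_mul, norm_crossSpec, Complex.norm_real]
      rw [integral_mul_const]
      have : ∫ t in Set.Ioi (0 : ℝ), ‖t ^ (-θ - 1)‖ * ‖1 - Real.exp (-t * ‖p‖ ^ 2)‖ =
          ∫ t in Set.Ioi (0 : ℝ), t ^ (-θ - 1) * (1 - Real.exp (-t * ‖p‖ ^ 2)) := by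
        refine setIntegral_congr_fun measurableSet_Ioi fun t ht => ?_
        have ht0 : 0 < t := ht
        have h3 : Real.exp (-t * ‖p‖ ^ 2) ≤ 1 := Real.exp_le_one_iff.2 (by
          rw [neg_mul]; exact neg_nonpos.2 (by positivity))
        rw [Real.norm_of_nonneg (by positivity), Real.norm_of_nonneg (by linarith)]
      rw [this, hI p hp]; ring
  have hswap := integral_integral_swap hint2
  have e1 : ∫ p : Space3, ∫ t in Set.Ioi (0 : ℝ),
      ((t ^ (-θ - 1) * (1 - Real.exp (-t * ‖p‖ ^ 2)) : ℝ) : ℂ) * crossSpec h h' d p =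
      ((bernsteinConst θ : ℝ) : ℂ) *
        ∫ p : Space3, ((‖p‖ ^ (2 * θ) : ℝ) : ℂ) * crossSpec h h' d p := by
    rw [← integral_const_mul]
    refine integral_congr_ae ?_
    filter_upwards [hne] with p hp
    rw [integral_mul_const, integral_complex_ofReal, hI p hp]
    push_cast; ring
  have hcs : Integrable (crossSpec h h' d) := by
    refine hint0.mono' hcont.aestronglyMeasurable (Eventually.of_forall fun p => ?_)
    rw [norm_crossSpec]
  have e2 : ∫ t in Set.Ioi (0 : ℝ), ∫ p : Space3,
      ((t ^ (-θ - 1) * (1 - Real.exp (-t * ‖p‖ ^ 2)) : ℝ) : ℂ) * crossSpec h h' d p =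
      ((-gaussMoment (-θ) h h' d : ℝ) : ℂ) := by
    rw [gaussMoment, ← integral_neg, ← integral_complex_ofReal]
    refine setIntegral_congr_fun measurableSet_Ioi fun t ht => ?_
    have h1 := integral_gaussian_crossSpec hh hh' d ht
    have h2 := integral_crossSpec_eq_zero hh hh' hδ hsep hint0
    have hgi : Integrable fun p : Space3 =>
        ((Real.exp (-t * ‖p‖ ^ 2) : ℝ) : ℂ) * crossSpec h h' d p := by
      refine hcs.bdd_mul (c := 1) (Continuous.aestronglyMeasurable (by fun_prop))
        (Eventually.of_forall fun p => ?_)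
      have ht0 : 0 < t := ht
      rw [Complex.norm_real, Real.norm_of_nonneg (by positivity)]
      refine Real.exp_le_one_iff.2 ?_
      rw [neg_mul]; exact neg_nonpos.2 (by positivity)
    simp only [gaussOverlap]
    -- The unregularised integral vanishes by separation, so of `1 - exp(-t|p|²)` only the Gaussian
    -- survives, with a minus sign.
    have h3 : (((Real.pi / t) ^ (3 / 2 : ℝ) * ∫ z : Space3 × Space3,
        Real.exp (-‖z.1 - z.2 - d‖ ^ 2 / (4 * t)) * (h z.1 * h' z.2) : ℝ) : ℂ) =
        -∫ p : Space3, (1 - ((Real.exp (-t * ‖p‖ ^ 2) : ℝ) : ℂ)) * crossSpec h h' d p := by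
      simp only [sub_mul, one_mul]
      rw [integral_sub hcs hgi, h1, h2]; ring
    rw [Complex.ofReal_neg, Complex.ofReal_mul, h3, mul_neg, neg_neg, ← integral_const_mul]
    refine integral_congr_ae (Eventually.of_forall fun p => ?_)
    push_cast; ring
  rw [e1, e2] at hswap
  rw [neg_mul, ← mul_neg, Complex.ofReal_mul, ← hswap, Complex.ofReal_inv, inv_mul_cancel_left₀]
  exact_mod_cast hG.ne'

/-! ### Off-diagonal bounds for Fourier multipliers of slow variation -/

/-- The homogeneous weight controls large wave vectors; on the unit ball the transform is bounded by
the `L¹` norm. -/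
theorem integrable_sq_hat_of_half {h : Space3 → ℝ} (hh : Integrable h)
    (hs : Integrable fun p => ‖p‖ * ‖hat h p‖ ^ 2) :
    Integrable fun p => (1 + ‖p‖) * ‖hat h p‖ ^ 2 := by
  have hc := continuous_hat hh
  set W := ∫ x, |h x|
  have hb : Integrable fun p : Space3 =>
      (Metric.closedBall (0 : Space3) 1).indicator (fun _ => W ^ 2) p + 2 * (‖p‖ * ‖hat h p‖ ^ 2) := by
    refine Integrable.add ?_ (hs.const_mul 2)
    rw [integrable_indicator_iff measurableSet_closedBall]
    exact integrableOn_const (by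
      exact measure_closedBall_lt_top.ne)
  refine hb.mono' (Continuous.aestronglyMeasurable (by fun_prop)) (Eventually.of_forall fun p => ?_)
  rw [Real.norm_of_nonneg (by positivity)]
  have h1 : ‖hat h p‖ ^ 2 ≤ W ^ 2 := pow_le_pow_left₀ (norm_nonneg _) (norm_hat_le h p) 2
  rcases le_or_gt ‖p‖ 1 with hp | hp
  · rw [Set.indicator_of_mem (by simpa using hp)]
    nlinarith [mul_nonneg (norm_nonneg p) (sq_nonneg ‖hat h p‖)]
  · have : 0 ≤ (Metric.closedBall (0 : Space3) 1).indicator (fun _ => W ^ 2) p :=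
      Set.indicator_nonneg (fun _ _ => sq_nonneg W) p
    nlinarith [sq_nonneg ‖hat h p‖]

/-- A Peetre-type inequality: the weight of order one is shared between `p` and `p + v`, half an
order each, at the cost of a polynomial in `|v|`. -/
theorem weight_le (p v : Space3) : 1 + ‖p‖ ≤ √(1 + ‖p‖) * √(1 + ‖p + v‖) * (1 + ‖v‖) := by
  have h1 : 1 + ‖p‖ ≤ (1 + ‖p + v‖) * (1 + ‖v‖) := by
    have : ‖p‖ ≤ ‖p + v‖ + ‖v‖ := by
      have := norm_sub_le (p + v) v
      rwa [add_sub_cancel_right] at this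
    nlinarith [mul_nonneg (norm_nonneg (p + v)) (norm_nonneg v)]
  have h2 : √(1 + ‖p‖) ≤ √(1 + ‖p + v‖) * (1 + ‖v‖) := by
    refine (Real.sqrt_le_sqrt h1).trans ?_
    rw [Real.sqrt_mul (by positivity)]
    refine mul_le_mul_of_nonneg_left ?_ (Real.sqrt_nonneg _)
    rw [Real.sqrt_le_left (by positivity)]
    nlinarith [norm_nonneg v]
  calc 1 + ‖p‖ = √(1 + ‖p‖) * √(1 + ‖p‖) := (Real.mul_self_sqrt (by positivity)).symm
    _ ≤ √(1 + ‖p‖) * (√(1 + ‖p + v‖) * (1 + ‖v‖)) :=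
        mul_le_mul_of_nonneg_left h2 (Real.sqrt_nonneg _)
    _ = _ := by ring

theorem weighted_mul_le (p v : Space3) {x y : ℝ} (hx : 0 ≤ x) (hy : 0 ≤ y) :
    (1 + ‖p‖) * (x * y) ≤
      (1 + ‖v‖) * (((1 + ‖p‖) * x ^ 2 + (1 + ‖p + v‖) * y ^ 2) / 2) := by
  have h1 := mul_le_mul_of_nonneg_right (weight_le p v) (mul_nonneg hx hy)
  refine h1.trans ?_
  have h2 : √(1 + ‖p‖) ^ 2 = 1 + ‖p‖ := Real.sq_sqrt (by positivity)
  have h3 : √(1 + ‖p + v‖) ^ 2 = 1 + ‖p + v‖ := Real.sq_sqrt (by positivity)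
  calc _ = (1 + ‖v‖) * ((√(1 + ‖p‖) * x) * (√(1 + ‖p + v‖) * y)) := by ring
    _ ≤ (1 + ‖v‖) * (((1 + ‖p‖) * x ^ 2 + (1 + ‖p + v‖) * y ^ 2) / 2) := by
      refine mul_le_mul_of_nonneg_left ?_ (by positivity)
      have := two_mul_le_add_sq (√(1 + ‖p‖) * x) (√(1 + ‖p + v‖) * y)
      rw [mul_pow, mul_pow, h2, h3] at this
      linarith

section Shear

variable {a b : Space3 → ℂ}

theorem integrable_weight_shift (hb : Integrable fun p => (1 + ‖p‖) * ‖b p‖ ^ 2) (v : Space3) :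
    Integrable (fun p => (1 + ‖p + v‖) * ‖b (p + v)‖ ^ 2) ∧
      ∫ p, (1 + ‖p + v‖) * ‖b (p + v)‖ ^ 2 = ∫ p, (1 + ‖p‖) * ‖b p‖ ^ 2 :=
  ⟨hb.comp_add_right v, integral_add_right_eq_self (fun p => (1 + ‖p‖) * ‖b p‖ ^ 2) v⟩

theorem integrable_mul_shift (ha : Continuous a) (hb : Continuous b)
    (ha2 : Integrable fun p => (1 + ‖p‖) * ‖a p‖ ^ 2)
    (hb2 : Integrable fun p => (1 + ‖p‖) * ‖b p‖ ^ 2) {m : Space3 → ℂ} (hm : Measurable m) {C : ℝ}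
    (v : Space3) (hC : ∀ p, ‖m p‖ ≤ C * (1 + ‖p‖)) :
    Integrable (fun p => m p * (a p * b (p + v))) ∧ ∫ p, ‖m p * (a p * b (p + v))‖ ≤
      C * ((1 + ‖v‖) * ((∫ p, (1 + ‖p‖) * ‖a p‖ ^ 2) + ∫ p, (1 + ‖p‖) * ‖b p‖ ^ 2) / 2) := by
  have hC0 : 0 ≤ C := by
    have := (norm_nonneg _).trans (hC 0)
    simpa using this
  obtain ⟨i1, i2⟩ := integrable_weight_shift hb2 v
  have hi := (((ha2.add i1).div_const 2).const_mul (1 + ‖v‖)).const_mul C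
  have hle : ∀ p, ‖m p * (a p * b (p + v))‖ ≤ C * ((1 + ‖v‖) *
      (((1 + ‖p‖) * ‖a p‖ ^ 2 + (1 + ‖p + v‖) * ‖b (p + v)‖ ^ 2) / 2)) := by
    intro p
    rw [norm_mul, norm_mul]
    calc _ ≤ C * (1 + ‖p‖) * (‖a p‖ * ‖b (p + v)‖) :=
          mul_le_mul_of_nonneg_right (hC p) (by positivity)
      _ = C * ((1 + ‖p‖) * (‖a p‖ * ‖b (p + v)‖)) := by ring
      _ ≤ _ := mul_le_mul_of_nonneg_left (weighted_mul_le p v (norm_nonneg _) (norm_nonneg _)) hC0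
  have hint : Integrable (fun p => m p * (a p * b (p + v))) :=
    hi.mono' (hm.aestronglyMeasurable.mul (Continuous.aestronglyMeasurable (by fun_prop)))
      (Eventually.of_forall hle)
  refine ⟨hint, (integral_mono hint.norm hi hle).trans_eq ?_⟩
  simp only [Pi.add_apply]
  rw [integral_const_mul, integral_const_mul, integral_div, integral_add ha2 i1, i2]
  ring

theorem integrable_shear (ha : Continuous a) (hb : Continuous b)
    (ha2 : Integrable fun p => (1 + ‖p‖) * ‖a p‖ ^ 2)
    (hb2 : Integrable fun p => (1 + ‖p‖) * ‖b p‖ ^ 2) {m : Space3 → ℂ} (hm : Measurable m) {C : ℝ}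
    (hC : ∀ p, ‖m p‖ ≤ C * (1 + ‖p‖)) (X : SchwartzMap Space3 ℂ) (c : ℝ) :
    Integrable (Function.uncurry fun (w p : Space3) => X w * (m p * (a p * b (p + c • w))))
      (volume.prod volume) := by
  have hmeas : AEStronglyMeasurable (Function.uncurry fun (w p : Space3) =>
      X w * (m p * (a p * b (p + c • w)))) (volume.prod volume) := by
    refine AEStronglyMeasurable.mul (X.continuous.comp continuous_fst).aestronglyMeasurable ?_
    refine AEStronglyMeasurable.mul (hm.comp measurable_snd).aestronglyMeasurable ?_
    exact Continuous.aestronglyMeasurable (by fun_prop)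
  rw [integrable_prod_iff hmeas]
  constructor
  · refine Eventually.of_forall fun w => ?_
    exact (integrable_mul_shift ha hb ha2 hb2 hm (c • w) hC).1.const_mul (X w)
  · set E := (∫ p, (1 + ‖p‖) * ‖a p‖ ^ 2) + ∫ p, (1 + ‖p‖) * ‖b p‖ ^ 2 with hE
    have hE0 : 0 ≤ E := add_nonneg (integral_nonneg fun _ => by positivity)
      (integral_nonneg fun _ => by positivity)
    have hX : Integrable fun w : Space3 => C * (E / 2) * (‖X w‖ + |c| * (‖w‖ ^ 1 * ‖X w‖)) :=
      (X.integrable.norm.add ((X.integrable_pow_mul volume 1).const_mul |c|)).const_mul _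
    refine hX.mono' hmeas.norm.integral_prod_right' (Eventually.of_forall fun w => ?_)
    rw [Real.norm_of_nonneg (integral_nonneg fun _ => norm_nonneg _)]
    simp only [Function.uncurry, norm_mul (X w)]
    rw [integral_const_mul]
    refine (mul_le_mul_of_nonneg_left (integrable_mul_shift ha hb ha2 hb2 hm (c • w) hC).2
      (norm_nonneg _)).trans_eq ?_
    rw [norm_smul, Real.norm_eq_abs, pow_one, ← hE]
    ring

end Shear

/-- A smooth compactly supported cut-off separating two compact sets. -/
theorem exists_schwartz_cutoff {K K' : Set Space3} (hK : IsCompact K) (hK' : IsCompact K')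
    (hd : Disjoint K K') : ∃ χ : SchwartzMap Space3 ℂ, (∀ x ∈ K, χ x = 1) ∧ (∀ x ∈ K', χ x = 0) ∧
      ∀ x, conj (χ x) = χ x := by
  obtain ⟨ρ, hρ⟩ := hK.isBounded.subset_ball (0 : Space3)
  have hs : IsClosed (K' ∪ (Metric.ball (0 : Space3) ρ)ᶜ) :=
    hK'.isClosed.union Metric.isOpen_ball.isClosed_compl
  have hdis : Disjoint (K' ∪ (Metric.ball (0 : Space3) ρ)ᶜ) K := by
    rw [Set.disjoint_union_left]
    exact ⟨hd.symm, Set.disjoint_compl_left_iff_subset.2 hρ⟩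
  obtain ⟨f, hf0, hf1, -⟩ := exists_contMDiffMap_zero_one_of_isClosed (n := (⊤ : ℕ∞))
    (modelWithCornersSelf ℝ Space3) hs hK.isClosed hdis
  have hfc : ContDiff ℝ (⊤ : ℕ∞) f := f.contMDiff.contDiff
  have hsupp : HasCompactSupport fun x => ((f x : ℝ) : ℂ) := by
    refine HasCompactSupport.intro (isCompact_closedBall (0 : Space3) ρ) fun x hx => ?_
    have : f x = 0 := hf0 (Or.inr fun h => hx (Metric.ball_subset_closedBall h))
    simp [this]
  refine ⟨hsupp.toSchwartzMap (Complex.ofRealCLM.contDiff.comp hfc), fun x hx => ?_, fun x hx => ?_,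
    fun x => ?_⟩
  · change ((f x : ℝ) : ℂ) = 1
    rw [hf1 hx]; simp
  · change ((f x : ℝ) : ℂ) = 0
    rw [hf0 (Or.inl hx)]; simp
  · change conj ((f x : ℝ) : ℂ) = ((f x : ℝ) : ℂ)
    simp

theorem schwartz_inversion (χ : SchwartzMap Space3 ℂ) (x : Space3) :
    χ x = ∫ w : Space3, Complex.exp (Complex.I * ((inner ℝ ((2 * Real.pi) • w) x : ℝ) : ℂ)) *
      (FourierTransform.fourier χ : SchwartzMap Space3 ℂ) w := by
  have h1 : FourierTransformInv.fourierInv (FourierTransform.fourier χ) = χ :=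
    FourierTransform.fourierInv_fourier_eq χ
  have h2 : (FourierTransformInv.fourierInv (FourierTransform.fourier χ) : SchwartzMap Space3 ℂ) x =
      χ x := by rw [h1]
  rw [← h2, SchwartzMap.fourierInv_coe, Real.fourierInv_eq']
  refine integral_congr_ae (Eventually.of_forall fun w => ?_)
  simp only [smul_eq_mul, real_inner_smul_left]
  congr 2; push_cast; ring

/-- Multiplication by a cut-off in position is an average over shifts of the wave vector, weighted
by a rapidly decreasing function. -/
theorem hat_mul_schwartz {h : Space3 → ℝ} (hh : Integrable h) (χ : SchwartzMap Space3 ℂ)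
    (p : Space3) :
    ∫ x : Space3, Complex.exp (Complex.I * ((inner ℝ p x : ℝ) : ℂ)) * ((h x : ℝ) : ℂ) * χ x =
      ∫ w : Space3, (FourierTransform.fourier χ : SchwartzMap Space3 ℂ) w *
        hat h (p + (2 * Real.pi) • w) := by
  set X := (FourierTransform.fourier χ : SchwartzMap Space3 ℂ) with hX
  have hint : Integrable (Function.uncurry fun (x w : Space3) =>
      Complex.exp (Complex.I * ((inner ℝ p x : ℝ) : ℂ)) * ((h x : ℝ) : ℂ) *
      (Complex.exp (Complex.I * ((inner ℝ ((2 * Real.pi) • w) x : ℝ) : ℂ)) * X w))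
      (volume.prod volume) := by
    have h1 : Integrable (fun q : Space3 × Space3 => ((h q.1 : ℝ) : ℂ) * X q.2)
      (volume.prod volume) := (Integrable.ofReal (𝕜 := ℂ) hh).mul_prod X.integrable
    have h2 := h1.bdd_mul (c := 1) (f := fun q : Space3 × Space3 =>
      Complex.exp (Complex.I * ((inner ℝ (p + (2 * Real.pi) • q.2) q.1 : ℝ) : ℂ)))
      (Continuous.aestronglyMeasurable (by fun_prop))
      (Eventually.of_forall fun x => (norm_cexp_I_mul _).le)
    refine h2.congr (Eventually.of_forall fun q => ?_)
    simp only [Function.uncurry, inner_add_left, Complex.ofReal_add, mul_add, Complex.exp_add]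
    ring
  have e1 : ∀ x : Space3, Complex.exp (Complex.I * ((inner ℝ p x : ℝ) : ℂ)) * ((h x : ℝ) : ℂ) * χ x =
      ∫ w : Space3, Complex.exp (Complex.I * ((inner ℝ p x : ℝ) : ℂ)) * ((h x : ℝ) : ℂ) *
      (Complex.exp (Complex.I * ((inner ℝ ((2 * Real.pi) • w) x : ℝ) : ℂ)) * X w) := by
    intro x
    rw [integral_const_mul, ← schwartz_inversion]
  simp only [e1]
  rw [integral_integral_swap hint]
  refine integral_congr_ae (Eventually.of_forall fun w => ?_)
  simp only [hat_eq]
  rw [← integral_const_mul]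
  refine integral_congr_ae (Eventually.of_forall fun x => ?_)
  simp only [inner_add_left, Complex.ofReal_add, mul_add, Complex.exp_add]
  ring

/-- Fourier multipliers of slow variation have bounded matrix elements between separated functions
in `H^{1/2}`. -/
theorem exists_offDiagonal_bound {h h' : Space3 → ℝ} (hh : Integrable h) (hh' : Integrable h')
    {d : Space3} {K K' : Set Space3} (hK : IsCompact K) (hK' : IsCompact K') (hdis : Disjoint K K')
    (hsupp : ∀ x, h x ≠ 0 → x ∈ K) (hsupp' : ∀ x, h' (x - d) ≠ 0 → x ∈ K')
    (hs : Integrable fun p => ‖p‖ * ‖hat h p‖ ^ 2) (hs' : Integrable fun p => ‖p‖ * ‖hat h' p‖ ^ 2) :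
    ∃ Q : ℝ, 0 ≤ Q ∧ ∀ (m : Space3 → ℝ) (C C' : ℝ), Measurable m →
      (∀ p v, |m p - m (p + v)| ≤ C * ‖v‖ * (1 + ‖p‖ + ‖p + v‖)) →
      (∀ p, |m p| ≤ C' * (1 + ‖p‖)) →
      ‖∫ p, ((m p : ℝ) : ℂ) * crossSpec h h' d p‖ ≤ C * Q := by
  obtain ⟨χ, hχ1, hχ0, hχr⟩ := exists_schwartz_cutoff hK hK' hdis
  set X := (FourierTransform.fourier χ : SchwartzMap Space3 ℂ) with hX
  set b : Space3 → ℂ := fun p => conj (hat (fun x => h' (x - d)) p) with hb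
  have hht : Integrable fun x => h' (x - d) := hh'.comp_sub_right d
  have hac : Continuous (hat h) := continuous_hat hh
  have hbc : Continuous b := Complex.continuous_conj.comp (continuous_hat hht)
  have hbn : ∀ p, ‖b p‖ = ‖hat h' p‖ := fun p => by
    rw [hb]; simp only [RCLike.norm_conj, hat_translate, norm_mul, norm_cexp_I_mul, one_mul]
  have ha2 := integrable_sq_hat_of_half hh hs
  have hb2 : Integrable fun p => (1 + ‖p‖) * ‖b p‖ ^ 2 := by
    simp only [hbn]; exact integrable_sq_hat_of_half hh' hs'
  have hcs : ∀ p, crossSpec h h' d p = hat h p * b p := fun p => by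
    rw [crossSpec, hb]; simp only [hat_translate]
  -- The cut-off is 1 on the support of `h`, so multiplying by it changes nothing.
  have hA : ∀ p, hat h p = ∫ w, X w * hat h (p + (2 * Real.pi) • w) := by
    intro p
    rw [← hat_mul_schwartz hh χ p, hat_eq]
    refine integral_congr_ae (Eventually.of_forall fun x => ?_)
    by_cases hx : h x = 0
    · simp [hx]
    · simp only [hχ1 x (hsupp x hx), mul_one]
  -- The cut-off is 0 on the support of the displaced `h'`; conjugation reverses the sign of the
  -- shift.
  have hB : ∀ p, ∫ w, X w * b (p + (-(2 * Real.pi)) • w) = 0 := by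
    intro p
    have h1 := hat_mul_schwartz hht χ (-p)
    have h2 : ∫ x : Space3, Complex.exp (Complex.I * ((inner ℝ (-p) x : ℝ) : ℂ)) *
        ((h' (x - d) : ℝ) : ℂ) * χ x = 0 := by
      rw [← integral_zero Space3 ℂ (μ := volume)]
      refine integral_congr_ae (Eventually.of_forall fun x => ?_)
      by_cases hx : h' (x - d) = 0
      · simp [hx]
      · simp only [hχ0 x (hsupp' x hx), mul_zero]
    rw [h2] at h1
    rw [h1]
    refine integral_congr_ae (Eventually.of_forall fun w => ?_)
    simp only [hb, hat_eq, ← integral_conj]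
    congr 1
    refine integral_congr_ae (Eventually.of_forall fun x => ?_)
    simp only [map_mul, Complex.conj_ofReal, ← Complex.exp_conj, Complex.conj_I]
    congr 2
    rw [inner_add_left, inner_add_left, inner_neg_left, inner_smul_left, inner_smul_left]
    simp only [conj_trivial]
    push_cast; ring
  set E := (∫ p, (1 + ‖p‖) * ‖hat h p‖ ^ 2) + ∫ p, (1 + ‖p‖) * ‖b p‖ ^ 2 with hE
  have hE0 : 0 ≤ E := add_nonneg (integral_nonneg fun _ => by positivity)
    (integral_nonneg fun _ => by positivity)
  have hXi : Integrable fun w : Space3 => (2 * Real.pi) * E * (‖w‖ ^ 1 * ‖X w‖ +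
      4 * Real.pi * (‖w‖ ^ 2 * ‖X w‖) + 4 * Real.pi ^ 2 * (‖w‖ ^ 3 * ‖X w‖)) :=
    (((X.integrable_pow_mul volume 1).add ((X.integrable_pow_mul volume 2).const_mul _)).add
      ((X.integrable_pow_mul volume 3).const_mul _)).const_mul _
  refine ⟨∫ w : Space3, (2 * Real.pi) * E * (‖w‖ ^ 1 * ‖X w‖ +
      4 * Real.pi * (‖w‖ ^ 2 * ‖X w‖) + 4 * Real.pi ^ 2 * (‖w‖ ^ 3 * ‖X w‖)), integral_nonneg fun w => by positivity, ?_⟩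
  intro m C C' hm hC hC'
  have hmc : Measurable fun p => ((m p : ℝ) : ℂ) := Complex.measurable_ofReal.comp hm
  have hmb : ∀ p, ‖((m p : ℝ) : ℂ)‖ ≤ C' * (1 + ‖p‖) := fun p => by
    rw [Complex.norm_real]; exact hC' p
  have F1 := integrable_shear hbc hac hb2 ha2 hmc hmb X (2 * Real.pi)
  have F2 := integrable_shear hac hbc ha2 hb2 hmc hmb X (-(2 * Real.pi))
  have e1 : ∫ p, ((m p : ℝ) : ℂ) * crossSpec h h' d p = ∫ w, X w * ∫ p, ((m p : ℝ) : ℂ) *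
      (b p * hat h (p + (2 * Real.pi) • w)) := by
    have h1 := integral_integral_swap F1
    simp only [integral_const_mul] at h1
    rw [h1]
    refine integral_congr_ae (Eventually.of_forall fun p => ?_)
    simp only
    rw [hcs, hA p, ← integral_mul_const, ← integral_const_mul]
    refine integral_congr_ae (Eventually.of_forall fun w => ?_)
    simp only; ring
  -- With the multiplier evaluated at the shifted point, a translation of `p` moves the shift onto
  -- `b`, where the cut-off gives zero.
  have e2 : ∫ w, X w * ∫ p, ((m (p + (2 * Real.pi) • w) : ℝ) : ℂ) *
      (b p * hat h (p + (2 * Real.pi) • w)) = 0 := by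
    have h1 := integral_integral_swap F2
    simp only [integral_const_mul] at h1
    have h2 : ∫ p : Space3, ∫ w : Space3, X w * (((m p : ℝ) : ℂ) *
        (hat h p * b (p + (-(2 * Real.pi)) • w))) = 0 := by
      rw [← integral_zero Space3 ℂ (μ := volume)]
      refine integral_congr_ae (Eventually.of_forall fun p => ?_)
      have h3 : ∫ w : Space3, X w * (((m p : ℝ) : ℂ) * (hat h p * b (p + (-(2 * Real.pi)) • w))) =
          ((m p : ℝ) : ℂ) * hat h p * ∫ w, X w * b (p + (-(2 * Real.pi)) • w) := by
        rw [← integral_const_mul]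
        refine integral_congr_ae (Eventually.of_forall fun w => ?_)
        simp only; ring
      simp only
      rw [h3, hB, mul_zero]
    rw [h2] at h1
    rw [← h1]
    refine integral_congr_ae (Eventually.of_forall fun w => ?_)
    simp only
    congr 1
    rw [← integral_add_right_eq_self (fun p => ((m p : ℝ) : ℂ) *
      (hat h p * b (p + (-(2 * Real.pi)) • w))) ((2 * Real.pi) • w)]
    refine integral_congr_ae (Eventually.of_forall fun p => ?_)
    simp only [neg_smul, add_neg_cancel_right]
    ring
  have hi1 : Integrable fun w => X w * ∫ p, ((m p : ℝ) : ℂ) *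
      (b p * hat h (p + (2 * Real.pi) • w)) := by
    have := F1.integral_prod_left
    simpa only [Function.uncurry, integral_const_mul] using this
  have hi2 : Integrable fun w => X w * ∫ p, ((m (p + (2 * Real.pi) • w) : ℝ) : ℂ) *
      (b p * hat h (p + (2 * Real.pi) • w)) := by
    have := F2.integral_prod_left
    simp only [Function.uncurry, integral_const_mul] at this
    refine this.congr (Eventually.of_forall fun w => ?_)
    simp only
    congr 1
    rw [← integral_add_right_eq_self (fun p => ((m p : ℝ) : ℂ) *
      (hat h p * b (p + (-(2 * Real.pi)) • w))) ((2 * Real.pi) • w)]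
    refine integral_congr_ae (Eventually.of_forall fun p => ?_)
    simp only [neg_smul, add_neg_cancel_right]
    ring
  -- The difference of the two expressions is the commutator of the multiplier with the cut-off, so
  -- only `m(p) - m(p + v)` enters the estimate. The growth constant `C'` serves integrability alone
  -- and is absent from the bound.
  rw [e1, ← sub_zero (∫ w, _), ← e2, ← integral_sub hi1 hi2, ← integral_const_mul]
  refine norm_integral_le_of_norm_le (hXi.const_mul C) (Eventually.of_forall fun w => ?_)
  set v := (2 * Real.pi) • w with hv
  have hvn : ‖v‖ = 2 * Real.pi * ‖w‖ := by
    rw [hv, norm_smul, Real.norm_of_nonneg (by positivity)]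
  have hC0 : 0 ≤ C * ‖v‖ := by
    have h1 := (abs_nonneg _).trans (hC 0 v)
    have h2 : 0 < 1 + ‖(0 : Space3)‖ + ‖(0 : Space3) + v‖ := by positivity
    exact nonneg_of_mul_nonneg_left h1 h2
  have j1 := (integrable_mul_shift hbc hac hb2 ha2 hmc v hmb).1
  have hms : Measurable fun p => ((m (p + v) : ℝ) : ℂ) := hmc.comp (measurable_add_const v)
  have hmsb : ∀ p, ‖((m (p + v) : ℝ) : ℂ)‖ ≤ (C' * (1 + ‖v‖)) * (1 + ‖p‖) := fun p => by
    refine (hmb _).trans ?_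
    have hC'0 : 0 ≤ C' := by
      have := (norm_nonneg _).trans (hmb 0)
      simpa using this
    rw [mul_assoc]
    refine mul_le_mul_of_nonneg_left ?_ hC'0
    have := norm_add_le p v
    nlinarith [mul_nonneg (norm_nonneg p) (norm_nonneg v)]
  have j2 := (integrable_mul_shift hbc hac hb2 ha2 hms v hmsb).1
  have hmd : ∀ p, ‖((m p : ℝ) : ℂ) - ((m (p + v) : ℝ) : ℂ)‖ ≤
      (C * ‖v‖ * (2 * (1 + ‖v‖))) * (1 + ‖p‖) := fun p => by
    rw [← Complex.ofReal_sub, Complex.norm_real]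
    refine (hC p v).trans ?_
    rw [mul_assoc (C * ‖v‖)]
    refine mul_le_mul_of_nonneg_left ?_ hC0
    have := norm_add_le p v
    nlinarith [mul_nonneg (norm_nonneg p) (norm_nonneg v), norm_nonneg p, norm_nonneg v]
  have j3 := (integrable_mul_shift hbc hac hb2 ha2 (hmc.sub hms) v hmd).2
  rw [← mul_sub, ← integral_sub j1 j2, norm_mul]
  have h3 : ‖∫ p, (((m p : ℝ) : ℂ) * (b p * hat h (p + v)) -
      ((m (p + v) : ℝ) : ℂ) * (b p * hat h (p + v)))‖ ≤
      C * ‖v‖ * (2 * (1 + ‖v‖)) * ((1 + ‖v‖) * E / 2) := by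
    refine (norm_integral_le_integral_norm _).trans ?_
    rw [hE, add_comm (∫ p, (1 + ‖p‖) * ‖hat h p‖ ^ 2)]
    refine le_trans (le_of_eq ?_) j3
    simp only [Pi.sub_apply, sub_mul]
  refine (mul_le_mul_of_nonneg_left h3 (norm_nonneg _)).trans_eq ?_
  rw [hvn]; ring

/-! ### Reduced amplitudes -/

namespace BunchDavies

/-- `L^{-ν} H_ν(p/L)`. -/
def aFun (ν L : ℝ) (p : Space3) : ℂ := ((L ^ (-ν) : ℝ) : ℂ) * hankel1 ν (‖p‖ / L)

/-- `L^{2-ν} (p/L) H_{ν-1}(p/L)`. -/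
def bFun (ν L : ℝ) (p : Space3) : ℂ :=
  ((L ^ (2 - ν) : ℝ) : ℂ) * (((‖p‖ / L : ℝ) : ℂ) * hankel1 (ν - 1) (‖p‖ / L))

/-- The amplitude of a dilated observable in rescaled wave vectors, up to normalisation; it depends
on the scale `R` and on `H` only through `L = RH`. -/
def redAmp (ν L : ℝ) (γ : PhaseVec) (p : Space3) : ℂ :=
  aFun ν L p * (((3 / 2 - ν : ℝ) : ℂ) * hat γ.g p + ((L⁻¹ : ℝ) : ℂ) * hat γ.f p) +
    (((L ^ 2)⁻¹ : ℝ) : ℂ) * (bFun ν L p * hat γ.g p)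

theorem order_mul (q : ℝ) {H : ℝ} (hH : 0 < H) : order (q * H) H = √(9 / 4 - q ^ 2) := by
  rw [order, mul_pow, mul_div_assoc, div_self (by positivity), mul_one]

theorem scaleFactor_eta0 {H : ℝ} (hH : 0 < H) : scaleFactor H (eta0 H) = 1 := by
  rw [scaleFactor, eta0]; field_simp

theorem fieldMode_eq (m : ℝ) {H : ℝ} (hH : 0 < H) (k : ℝ) :
    fieldMode m H k = ((√(Real.pi / (4 * H)) : ℝ) : ℂ) * hankel1 (order m H) (k / H) := by
  rw [fieldMode, modeFun, scaleFactor_eta0 hH, eta0]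
  have e1 : -Real.pi * (-1 / H) / (4 * 1 ^ 2) = Real.pi / (4 * H) := by field_simp
  have e2 : -k * (-1 / H) = k / H := by field_simp
  rw [e1, e2]

/-- The prefactor `(-η)^{3/2}` contributes `3/2` and the derivative of the Hankel function
contributes `-ν`. The most singular term thus has the coefficient `3/2 - ν = μ²`, nonzero for a
massive field, and the remainder involves only the less singular `H_{ν-1}`. -/
theorem momentumMode_eq (m : ℝ) {H : ℝ} (hH : 0 < H) {k : ℝ} (hk : 0 < k) :
    momentumMode m H k = -(((√(Real.pi / (4 * H)) * H : ℝ) : ℂ) *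
      (((3 / 2 - order m H : ℝ) : ℂ) * hankel1 (order m H) (k / H) +
        ((k / H : ℝ) : ℂ) * hankel1 (order m H - 1) (k / H))) := by
  set ν := order m H
  set s := √(Real.pi / (4 * H)) with hs
  have hs0 : 0 < s := Real.sqrt_pos.2 (by positivity)
  have hs2 : s ^ 2 = Real.pi / (4 * H) := Real.sq_sqrt (by positivity)
  have hη : eta0 H < 0 := by rw [eta0]; exact div_neg_of_neg_of_pos (by norm_num) hH
  have hinner : HasDerivAt (fun η : ℝ => -(Real.pi * H ^ 2 / 4) * η ^ 3)
      (-(Real.pi * H ^ 2 / 4) * (3 * (eta0 H) ^ 2)) (eta0 H) := by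
    simpa using (hasDerivAt_pow 3 (eta0 H)).const_mul (-(Real.pi * H ^ 2 / 4))
  have hval : -(Real.pi * H ^ 2 / 4) * (eta0 H) ^ 3 = Real.pi / (4 * H) := by
    rw [eta0]; field_simp
  have hsq := hinner.sqrt (by rw [hval]; positivity)
  rw [hval, ← hs] at hsq
  have hsq' : HasDerivAt (fun η : ℝ => √(-Real.pi * η / (4 * scaleFactor H η ^ 2)))
      (-(3 / 2) * H * s) (eta0 H) := by
    have h1 : HasDerivAt (fun η : ℝ => √(-Real.pi * η / (4 * scaleFactor H η ^ 2))) _ (eta0 H) :=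
      hsq.congr_of_eventuallyEq (by
        filter_upwards [gt_mem_nhds hη] with η hη'
        rw [scaleFactor]
        congr 1
        field_simp)
    convert! h1 using 1
    rw [eta0]; field_simp
    rw [hs2]; field_simp
  have harg : HasDerivAt (fun η : ℝ => -k * η) (-k) (eta0 H) := by
    simpa using (hasDerivAt_id (eta0 H)).const_mul (-k)
  have hx : -k * eta0 H = k / H := by rw [eta0]; field_simp
  have hh : HasDerivAt (fun η : ℝ => hankel1 ν (-k * η))
      ((-k : ℝ) • (hankel1 (ν - 1) (k / H) - (ν / (k / H) : ℝ) * hankel1 ν (k / H))) (eta0 H) := by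
    have h1 := hasDerivAt_hankel1 ν (show 0 < k / H by positivity)
    rw [← hx] at h1
    have := h1.scomp (eta0 H) harg
    rw [hx] at this
    exact this
  have hd := (hsq'.ofReal_comp).mul hh
  have hval2 : √(-Real.pi * eta0 H / (4 * scaleFactor H (eta0 H) ^ 2)) = s := by
    rw [scaleFactor_eta0 hH, eta0, hs]; congr 1; field_simp
  have hderiv : deriv (modeFun m H k) (eta0 H) = _ := hd.deriv
  rw [momentumMode, hderiv, hval2, hx, scaleFactor_eta0 hH, Complex.real_smul]
  have hk' : (k : ℂ) ≠ 0 := by exact_mod_cast hk.ne'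
  have hH' : (H : ℂ) ≠ 0 := by exact_mod_cast hH.ne'
  push_cast
  field_simp
  ring

theorem hat_dilate_f (γ : PhaseVec) {R : ℝ} (hR : 0 < R) (k : Space3) :
    hat (γ.dilate R).f k = (R : ℂ) * hat γ.f (R • k) := by
  have := hat_dilate γ.f hR ((R ^ 2)⁻¹) k
  rw [PhaseVec.dilate]
  rw [this]
  congr 2
  field_simp

theorem hat_dilate_g (γ : PhaseVec) {R : ℝ} (hR : 0 < R) (k : Space3) :
    hat (γ.dilate R).g k = ((R ^ 2 : ℝ) : ℂ) * hat γ.g (R • k) := by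
  have := hat_dilate γ.g hR (R⁻¹) k
  rw [PhaseVec.dilate]
  rw [this]
  congr 2
  field_simp

theorem amplitude_dilate (q : ℝ) {R H : ℝ} (hR : 0 < R) (hH : 0 < H) (γ : PhaseVec) {k : Space3}
    (hk : k ≠ 0) :
    amplitude (q * H) H (γ.dilate R) k =
      ((√(Real.pi / (4 * H)) * H * R ^ 2 * (R * H) ^ √(9 / 4 - q ^ 2) : ℝ) : ℂ) *
        redAmp (√(9 / 4 - q ^ 2)) (R * H) γ (R • k) := by
  have hk0 : 0 < ‖k‖ := norm_pos_iff.2 hk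
  have e1 : ‖R • k‖ / (R * H) = ‖k‖ / H := by
    rw [norm_smul, Real.norm_of_nonneg hR.le]; field_simp
  have hf := hat_dilate_f γ hR k
  have hg := hat_dilate_g γ hR k
  rw [hat] at hf hg
  have hL : 0 < R * H := by positivity
  rw [amplitude, fieldMode_eq _ hH, momentumMode_eq _ hH hk0, order_mul q hH, hf, hg, redAmp, aFun,
    bFun, e1]
  set ν := √(9 / 4 - q ^ 2)
  set s := √(Real.pi / (4 * H))
  have e2 : (((R * H) ^ ν : ℝ) : ℂ) * (((R * H) ^ (-ν) : ℝ) : ℂ) = 1 := by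
    rw [← Complex.ofReal_mul, ← Real.rpow_add hL]; simp
  have e3 : (((R * H) ^ ν : ℝ) : ℂ) * (((R * H) ^ (2 - ν) : ℝ) : ℂ) = ((R * H : ℝ) : ℂ) ^ 2 := by
    rw [← Complex.ofReal_mul, ← Real.rpow_add hL]; simp
  have hR' : (R : ℂ) ≠ 0 := by exact_mod_cast hR.ne'
  have hH' : (H : ℂ) ≠ 0 := by exact_mod_cast hH.ne'
  set P := hankel1 ν (‖k‖ / H)
  set Q := hankel1 (ν - 1) (‖k‖ / H)
  have e4 : ((s * H * R ^ 2 * (R * H) ^ ν : ℝ) : ℂ) * ((((R * H) ^ (-ν) : ℝ) : ℂ) * P *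
      (((3 / 2 - ν : ℝ) : ℂ) * hat γ.g (R • k) + (((R * H)⁻¹ : ℝ) : ℂ) * hat γ.f (R • k)) +
      ((((R * H) ^ 2)⁻¹ : ℝ) : ℂ) * ((((R * H) ^ (2 - ν) : ℝ) : ℂ) * (((‖k‖ / H : ℝ) : ℂ) * Q) *
        hat γ.g (R • k))) =
      (s * H * R ^ 2 : ℂ) * (((((R * H) ^ ν : ℝ) : ℂ) * (((R * H) ^ (-ν) : ℝ) : ℂ)) * (P *
      (((3 / 2 - ν : ℝ) : ℂ) * hat γ.g (R • k) + (((R * H)⁻¹ : ℝ) : ℂ) * hat γ.f (R • k))) +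
      ((((R * H) ^ ν : ℝ) : ℂ) * (((R * H) ^ (2 - ν) : ℝ) : ℂ)) * (((((R * H) ^ 2)⁻¹ : ℝ) : ℂ) *
        ((((‖k‖ / H : ℝ) : ℂ) * Q) * hat γ.g (R • k)))) := by
    push_cast; ring
  rw [e4, e2, e3]
  push_cast
  field_simp
  ring

/-- The overlap integral of two reduced amplitudes. -/
def redGram (ν L : ℝ) (γ γ' : PhaseVec) : ℝ := (∫ p, redAmp ν L γ p * conj (redAmp ν L γ' p)).re

/-- The change of variables `p = Rk` contributes `R⁻³`, which combines with the squared
normalisation into a power of `RH` alone. The anticommutator doubles `π/4` to `π/2`. -/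
theorem sigma_dilate (q : ℝ) {R H : ℝ} (hR : 0 < R) (hH : 0 < H) (γ γ' : PhaseVec) :
    sigma (q * H) H (γ.dilate R) (γ'.dilate R) =
      ((2 * Real.pi) ^ 3)⁻¹ * (Real.pi / 2) * (R * H) ^ (2 * √(9 / 4 - q ^ 2) + 1) *
        redGram (√(9 / 4 - q ^ 2)) (R * H) γ γ' := by
  set ν := √(9 / 4 - q ^ 2) with hν
  have hL : 0 < R * H := by positivity
  have hne : ∀ᵐ k : Space3, k ≠ 0 := by
    rw [ae_iff]; simp
  set n : ℝ := √(Real.pi / (4 * H)) * H * R ^ 2 * (R * H) ^ ν with hn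
  have hn2 : n ^ 2 * (R ^ 3)⁻¹ = Real.pi / 4 * (R * H) ^ (2 * ν + 1) := by
    rw [hn, mul_pow, mul_pow, mul_pow, Real.sq_sqrt (by positivity), Real.rpow_add hL,
      Real.rpow_one, mul_comm 2 ν, Real.rpow_mul hL.le, Real.rpow_two]
    field_simp
  have key : ∀ α β : PhaseVec, twoPoint (q * H) H (α.dilate R) (β.dilate R) =
      ((((2 * Real.pi) ^ 3)⁻¹ * (Real.pi / 4 * (R * H) ^ (2 * ν + 1)) : ℝ) : ℂ) *
        ∫ p, redAmp ν (R * H) α p * conj (redAmp ν (R * H) β p) := by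
    intro α β
    have e1 : ∫ k : Space3, amplitude (q * H) H (α.dilate R) k *
        conj (amplitude (q * H) H (β.dilate R) k) = ((n ^ 2 : ℝ) : ℂ) * ∫ k : Space3,
        redAmp ν (R * H) α (R • k) * conj (redAmp ν (R * H) β (R • k)) := by
      rw [← integral_const_mul]
      refine integral_congr_ae ?_
      filter_upwards [hne] with k hk
      rw [amplitude_dilate q hR hH α hk, amplitude_dilate q hR hH β hk, map_mul, Complex.conj_ofReal,
        ← hν, ← hn]
      push_cast; ring
    rw [twoPoint, e1, Measure.integral_comp_smul volume
      (fun p => redAmp ν (R * H) α p * conj (redAmp ν (R * H) β p)) R]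
    rw [show Module.finrank ℝ Space3 = 3 by simp, abs_of_pos (by positivity), Complex.real_smul,
      ← hn2]
    push_cast; ring
  have hsym : ∫ p, redAmp ν (R * H) γ' p * conj (redAmp ν (R * H) γ p) =
      conj (∫ p, redAmp ν (R * H) γ p * conj (redAmp ν (R * H) γ' p)) := by
    rw [← integral_conj]
    refine integral_congr_ae (Eventually.of_forall fun p => ?_)
    simp [mul_comm]
  rw [sigma, key, key, hsym, redGram, ← mul_add, Complex.re_ofReal_mul, Complex.add_re,
    Complex.conj_re]
  ring

theorem redAmp_translate (ν L : ℝ) (d : Space3) (γ : PhaseVec) (p : Space3) :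
    redAmp ν L (γ.translate d) p =
      Complex.exp (Complex.I * ((inner ℝ p d : ℝ) : ℂ)) * redAmp ν L γ p := by
  have hg : hat (γ.translate d).g p = _ := hat_translate γ.g d p
  have hf : hat (γ.translate d).f p = _ := hat_translate γ.f d p
  rw [redAmp, redAmp, hg, hf]
  ring

/-! ### Uniform bounds on the rescaled mode functions -/

theorem continuousOn_aFun {ν L : ℝ} (hL : 0 < L) : ContinuousOn (aFun ν L) {0}ᶜ := by
  refine continuousOn_const.mul ?_
  refine (continuousOn_hankel1 ν).comp (continuous_norm.div_const L).continuousOn fun p hp => ?_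
  exact div_pos (norm_pos_iff.2 hp) hL

theorem continuousOn_bFun {ν L : ℝ} (hL : 0 < L) : ContinuousOn (bFun ν L) {0}ᶜ := by
  refine continuousOn_const.mul (ContinuousOn.mul
    (Complex.continuous_ofReal.comp (continuous_norm.div_const L)).continuousOn ?_)
  refine (continuousOn_hankel1 (ν - 1)).comp (continuous_norm.div_const L).continuousOn
    fun p hp => ?_
  exact div_pos (norm_pos_iff.2 hp) hL

theorem measurable_aFun {ν L : ℝ} (hL : 0 < L) : Measurable (aFun ν L) :=
  measurable_of_continuousOn_compl_singleton 0 (continuousOn_aFun hL)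

theorem measurable_bFun {ν L : ℝ} (hL : 0 < L) : Measurable (bFun ν L) :=
  measurable_of_continuousOn_compl_singleton 0 (continuousOn_bFun hL)

section Bounds

variable {ν K L : ℝ}

theorem norm_aFun_le (h1 : 1 < ν) (hK : HankelBounds ν K) (hL : 1 ≤ L) {p : Space3} (hp : p ≠ 0) :
    ‖aFun ν L p‖ ≤ K * (‖p‖ ^ (-ν) + ‖p‖ ^ (-(1 / 2) : ℝ)) := by
  have hp0 : 0 < ‖p‖ := norm_pos_iff.2 hp
  have hL0 : 0 < L := by linarith
  rw [aFun, norm_mul, Complex.norm_real, Real.norm_of_nonneg (by positivity)]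
  refine (mul_le_mul_of_nonneg_left (hK.bound _ (div_pos hp0 hL0)) (by positivity)).trans ?_
  rw [Real.div_rpow hp0.le hL0.le, Real.div_rpow hp0.le hL0.le, mul_left_comm]
  refine mul_le_mul_of_nonneg_left ?_ hK.nonneg
  have e1 : L ^ (-ν) * (‖p‖ ^ (-ν) / L ^ (-ν)) = ‖p‖ ^ (-ν) := by
    have : L ^ (-ν) ≠ 0 := by positivity
    field_simp
  have e2 : L ^ (-ν) * (‖p‖ ^ (-(1 / 2) : ℝ) / L ^ (-(1 / 2) : ℝ)) ≤ ‖p‖ ^ (-(1 / 2) : ℝ) := by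
    have : L ^ (-ν) ≤ L ^ (-(1 / 2) : ℝ) := Real.rpow_le_rpow_of_exponent_le hL (by linarith)
    rw [mul_div_assoc', div_le_iff₀ (by positivity), mul_comm]
    exact mul_le_mul_of_nonneg_left this (by positivity)
  rw [mul_add, e1]
  linarith

theorem norm_bFun_le (hK : HankelBounds ν K) (hL : 0 < L) {p : Space3} (hp : p ≠ 0) :
    ‖bFun ν L p‖ ≤ K * ‖p‖ ^ (2 - ν) := by
  have hp0 : 0 < ‖p‖ := norm_pos_iff.2 hp
  have hx : 0 < ‖p‖ / L := by positivity
  rw [bFun, norm_mul, norm_mul, Complex.norm_real, Complex.norm_real,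
    Real.norm_of_nonneg (by positivity), Real.norm_of_nonneg hx.le]
  refine (mul_le_mul_of_nonneg_left (hK.bound_rpow _ hx) (by positivity)).trans_eq ?_
  rw [Real.div_rpow hp0.le hL.le]
  have : L ^ (2 - ν) ≠ 0 := by positivity
  field_simp

/-- The bound by `|p|^{2-ν}` is uniform in `L`, but `2 - ν > 1/2` may exceed the regularity of `g`.
The power `1/2` matches the Sobolev condition on `g`, at the price `L^{3/2-ν}`. -/
theorem norm_bFun_le_half (hK : HankelBounds ν K) (hL : 0 < L) {p : Space3} (hp : p ≠ 0) :
    ‖bFun ν L p‖ ≤ K * L ^ (3 / 2 - ν) * ‖p‖ ^ (1 / 2 : ℝ) := by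
  have hp0 : 0 < ‖p‖ := norm_pos_iff.2 hp
  have hx : 0 < ‖p‖ / L := by positivity
  rw [bFun, norm_mul, norm_mul, Complex.norm_real, Complex.norm_real,
    Real.norm_of_nonneg (by positivity), Real.norm_of_nonneg hx.le]
  refine (mul_le_mul_of_nonneg_left (hK.bound_half _ hx) (by positivity)).trans_eq ?_
  rw [Real.div_rpow hp0.le hL.le, show 3 / 2 - ν = 2 - ν - 1 / 2 by ring, Real.rpow_sub hL (2 - ν)]
  ring

theorem tendsto_div_atTop_nhdsGT {x : ℝ} (hx : 0 < x) :
    Tendsto (fun L : ℝ => x / L) atTop (𝓝[>] 0) := by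
  refine tendsto_nhdsWithin_iff.2 ⟨tendsto_const_nhds.div_atTop tendsto_id, ?_⟩
  filter_upwards [eventually_gt_atTop 0] with L hL
  exact div_pos hx hL

theorem tendsto_aFun {c : ℂ}
    (hc : Tendsto (fun x : ℝ => ((x ^ ν : ℝ) : ℂ) * hankel1 ν x) (𝓝[>] 0) (𝓝 c))
    {p : Space3} (hp : p ≠ 0) :
    Tendsto (fun L => aFun ν L p) atTop (𝓝 (((‖p‖ ^ (-ν) : ℝ) : ℂ) * c)) := by
  have hp0 : 0 < ‖p‖ := norm_pos_iff.2 hp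
  refine ((hc.comp (tendsto_div_atTop_nhdsGT hp0)).const_mul _).congr' ?_
  filter_upwards [eventually_gt_atTop 0] with L hL
  rw [aFun, Function.comp_apply, ← mul_assoc, ← Complex.ofReal_mul]
  congr 2
  rw [Real.div_rpow hp0.le hL.le, Real.rpow_neg hp0.le, Real.rpow_neg hL.le]
  have : ‖p‖ ^ ν ≠ 0 := by positivity
  field_simp

theorem tendsto_bFun {c : ℂ}
    (hc : Tendsto (fun x : ℝ => ((x ^ (ν - 1) : ℝ) : ℂ) * hankel1 (ν - 1) x) (𝓝[>] 0) (𝓝 c))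
    {p : Space3} (hp : p ≠ 0) :
    Tendsto (fun L => bFun ν L p) atTop (𝓝 (((‖p‖ ^ (2 - ν) : ℝ) : ℂ) * c)) := by
  have hp0 : 0 < ‖p‖ := norm_pos_iff.2 hp
  refine ((hc.comp (tendsto_div_atTop_nhdsGT hp0)).const_mul _).congr' ?_
  filter_upwards [eventually_gt_atTop 0] with L hL
  rw [bFun, Function.comp_apply, ← mul_assoc, ← mul_assoc, ← Complex.ofReal_mul,
    ← Complex.ofReal_mul]
  congr 2
  have e : ∀ x : ℝ, 0 < x → x ^ (2 - ν) = x / x ^ (ν - 1) := by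
    intro x hx
    rw [show 2 - ν = 1 - (ν - 1) by ring, Real.rpow_sub hx, Real.rpow_one]
  rw [Real.div_rpow hp0.le hL.le, e _ hp0, e _ hL]
  have : ‖p‖ ^ (ν - 1) ≠ 0 := by positivity
  have : L ^ (ν - 1) ≠ 0 := by positivity
  field_simp

theorem rpow_le_one_add {x s : ℝ} (hx : 0 ≤ x) (h0 : 0 ≤ s) (h1 : s ≤ 1) : x ^ s ≤ 1 + x := by
  rcases le_total x 1 with h | h
  · have := Real.rpow_le_one hx h h0
    linarith
  · have := Real.rpow_le_rpow_of_exponent_le h h1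
    rw [Real.rpow_one] at this
    linarith

/-- The multiplier `|b_L|²` varies slowly, uniformly in `L`. -/
theorem bFun_sq_variation (h1 : 1 < ν) (h2 : ν < 3 / 2) (hK : HankelBounds ν K) (hL : 1 ≤ L)
    (p v : Space3) :
    |‖bFun ν L p‖ ^ 2 - ‖bFun ν L (p + v)‖ ^ 2| ≤
      (2 * K + K ^ 2) * ‖v‖ * (1 + ‖p‖ + ‖p + v‖) := by
  have hL0 : 0 < L := by linarith
  have hK0 := hK.nonneg
  set N : ℝ → ℝ := fun r => L ^ (4 - 2 * ν) * ((r / L) ^ 2 * ‖hankel1 (ν - 1) (r / L)‖ ^ 2) with hN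
  have hbN : ∀ p, ‖bFun ν L p‖ ^ 2 = N ‖p‖ := by
    intro p
    rw [bFun, norm_mul, norm_mul, Complex.norm_real, Complex.norm_real, mul_pow, mul_pow,
      Real.norm_of_nonneg (by positivity), Real.norm_of_nonneg (by positivity), hN]
    simp only
    congr 1
    rw [← Real.rpow_natCast, ← Real.rpow_mul hL0.le]
    congr 1; push_cast; ring
  have hd : ∀ r, 0 < r → ∃ N', HasDerivAt N N' r ∧ |N'| ≤ 2 * K * (1 + r) := by
    intro r hr
    obtain ⟨M', hM, hM'⟩ := hK.deriv_bound (r / L) (by positivity)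
    have hdiv : HasDerivAt (fun r : ℝ => r / L) (1 / L) r := (hasDerivAt_id r).div_const L
    refine ⟨L ^ (4 - 2 * ν) * (M' * (1 / L)), (hM.comp r hdiv).const_mul _, ?_⟩
    rw [abs_mul, abs_of_pos (by positivity), abs_mul, abs_of_pos (by positivity : 0 < 1 / L)]
    have e1 : L ^ (4 - 2 * ν) * (1 / L) = L ^ (3 - 2 * ν) := by
      rw [show 3 - 2 * ν = 4 - 2 * ν - 1 by ring, Real.rpow_sub_one hL0.ne']; ring
    have e2 : L ^ (3 - 2 * ν) * (r / L) ^ (3 - 2 * ν) = r ^ (3 - 2 * ν) := by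
      rw [← Real.mul_rpow hL0.le (by positivity)]; congr 1; field_simp
    have e3 : L ^ (3 - 2 * ν) * (r / L) ≤ r := by
      have : L ^ (3 - 2 * ν) ≤ L := by
        have := Real.rpow_le_rpow_of_exponent_le hL (show 3 - 2 * ν ≤ 1 by linarith)
        rwa [Real.rpow_one] at this
      rw [mul_div_assoc', div_le_iff₀ hL0]
      nlinarith
    have e4 := rpow_le_one_add hr.le (show 0 ≤ 3 - 2 * ν by linarith) (by linarith)
    calc L ^ (4 - 2 * ν) * (|M'| * (1 / L)) = L ^ (4 - 2 * ν) * (1 / L) * |M'| := by ring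
      _ ≤ L ^ (3 - 2 * ν) * (K * ((r / L) ^ (3 - 2 * ν) + r / L)) := by
          rw [e1]; exact mul_le_mul_of_nonneg_left hM' (by positivity)
      _ = K * (L ^ (3 - 2 * ν) * (r / L) ^ (3 - 2 * ν) + L ^ (3 - 2 * ν) * (r / L)) := by ring
      _ ≤ K * (2 * (1 + r)) := mul_le_mul_of_nonneg_left (by rw [e2]; linarith) hK0
      _ = _ := by ring
  have hpos : ∀ r r', 0 < r → 0 < r' → |N r - N r'| ≤ 2 * K * (1 + r + r') * |r - r'| := by
    intro r r' hr hr'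
    choose! N' hN' hNb using hd
    have hconv : Convex ℝ (Set.uIcc r r') := by
      rw [Set.uIcc]; exact convex_Icc _ _
    have := hconv.norm_image_sub_le_of_norm_hasDerivWithin_le (f := N) (f' := N')
      (C := 2 * K * (1 + r + r')) (x := r') (y := r) (fun x hx => ?_) (fun x hx => ?_)
      Set.right_mem_uIcc Set.left_mem_uIcc
    · simpa [Real.norm_eq_abs] using this
    · have hx0 : 0 < x := lt_of_lt_of_le (lt_min hr hr') hx.1
      exact (hN' x hx0).hasDerivWithinAt
    · have hx0 : 0 < x := lt_of_lt_of_le (lt_min hr hr') hx.1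
      refine (hNb x hx0).trans (mul_le_mul_of_nonneg_left ?_ (by positivity))
      have : x ≤ max r r' := hx.2
      have : max r r' ≤ r + r' := max_le (by linarith) (by linarith)
      linarith
  have hN0 : N 0 = 0 := by simp [hN]
  -- The derivative bound holds only away from the origin. A comparison with `r = 0` uses the size
  -- of `N r`, which is at most `K² r^{4-2ν}`.
  have hzero : ∀ r, 0 < r → |N r| ≤ K ^ 2 * (1 + r) * r := by
    intro r hr
    have h3 := hK.bound_rpow (r / L) (by positivity)
    have h4 : N r ≤ L ^ (4 - 2 * ν) * (K * (r / L) ^ (2 - ν)) ^ 2 := by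
      simp only [hN]
      rw [← mul_pow]
      exact mul_le_mul_of_nonneg_left (pow_le_pow_left₀ (by positivity) h3 2) (by positivity)
    have hNn : 0 ≤ N r := by simp only [hN]; positivity
    rw [abs_of_nonneg hNn]
    refine h4.trans ?_
    have e1 : ((r / L) ^ (2 - ν)) ^ 2 = r ^ (4 - 2 * ν) / L ^ (4 - 2 * ν) := by
      rw [← Real.rpow_natCast, ← Real.rpow_mul (by positivity), ← Real.div_rpow hr.le hL0.le]
      congr 1; push_cast; ring
    have e2 : L ^ (4 - 2 * ν) * (K * (r / L) ^ (2 - ν)) ^ 2 = K ^ 2 * (r ^ (3 - 2 * ν) * r) := by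
      rw [mul_pow, e1, show r ^ (3 - 2 * ν) * r = r ^ (4 - 2 * ν) by
        rw [← Real.rpow_add_one hr.ne']; congr 1; ring]
      have : L ^ (4 - 2 * ν) ≠ 0 := by positivity
      field_simp
    rw [e2, mul_assoc]
    have e4 := rpow_le_one_add hr.le (show 0 ≤ 3 - 2 * ν by linarith) (by linarith)
    exact mul_le_mul_of_nonneg_left (mul_le_mul_of_nonneg_right e4 hr.le) (sq_nonneg K)
  rw [hbN, hbN]
  have hvn : |‖p‖ - ‖p + v‖| ≤ ‖v‖ := by
    have := abs_norm_sub_norm_le p (p + v)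
    rwa [sub_add_cancel_left, norm_neg] at this
  have hS : 0 ≤ 1 + ‖p‖ + ‖p + v‖ := by positivity
  have main : |N ‖p‖ - N ‖p + v‖| ≤ (2 * K + K ^ 2) * (1 + ‖p‖ + ‖p + v‖) * |‖p‖ - ‖p + v‖| := by
    rcases (norm_nonneg p).eq_or_lt with hp | hp <;>
    rcases (norm_nonneg (p + v)).eq_or_lt with hp' | hp'
    · rw [← hp, ← hp']; simp
    · rw [← hp, hN0, zero_sub, abs_neg, zero_sub, abs_neg, abs_of_pos hp']
      refine (hzero _ hp').trans ?_
      have : 0 ≤ (1 + ‖p + v‖) * ‖p + v‖ := by positivity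
      nlinarith [mul_nonneg hK0 this]
    · rw [← hp', hN0, sub_zero, sub_zero, abs_of_pos hp]
      refine (hzero _ hp).trans ?_
      have : 0 ≤ (1 + ‖p‖) * ‖p‖ := by positivity
      nlinarith [mul_nonneg hK0 this]
    · refine (hpos _ _ hp hp').trans ?_
      refine mul_le_mul_of_nonneg_right ?_ (abs_nonneg _)
      exact mul_le_mul_of_nonneg_right (by nlinarith) hS
  refine main.trans ?_
  have h3 : 0 ≤ (2 * K + K ^ 2) * (1 + ‖p‖ + ‖p + v‖) := by positivity
  refine (mul_le_mul_of_nonneg_left hvn h3).trans_eq ?_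
  ring

theorem bFun_sq_growth (hK : HankelBounds ν K) (hL : 1 ≤ L) (p : Space3) :
    |‖bFun ν L p‖ ^ 2| ≤ (K * L ^ (3 / 2 - ν)) ^ 2 * (1 + ‖p‖) := by
  rw [abs_of_nonneg (by positivity)]
  rcases eq_or_ne p 0 with rfl | hp
  · have : bFun ν L (0 : Space3) = 0 := by simp [bFun]
    rw [this]; simp; positivity
  · have h3 := norm_bFun_le_half hK (by linarith : 0 < L) hp
    have hp0 : 0 < ‖p‖ := norm_pos_iff.2 hp
    calc ‖bFun ν L p‖ ^ 2 ≤ (K * L ^ (3 / 2 - ν) * ‖p‖ ^ (1 / 2 : ℝ)) ^ 2 :=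
          pow_le_pow_left₀ (norm_nonneg _) h3 2
      _ = (K * L ^ (3 / 2 - ν)) ^ 2 * ‖p‖ := by
          rw [mul_pow _ (‖p‖ ^ (1 / 2 : ℝ)), ← Real.sqrt_eq_rpow, Real.sq_sqrt hp0.le]
      _ ≤ _ := mul_le_mul_of_nonneg_left (by linarith) (sq_nonneg _)

end Bounds

end BunchDavies

/-! ### Convergence of the rescaled amplitudes -/

namespace BunchDavies

/-- A family of amplitudes that converges almost everywhere and is dominated in `L²`. -/
structure Dominated (Y : ℝ → Space3 → ℂ) (y : Space3 → ℂ) : Prop where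
  bound : ∃ D : Space3 → ℝ, MemLp D 2 volume ∧ ∀ᶠ L in atTop,
    AEStronglyMeasurable (Y L) volume ∧ ∀ᵐ p, ‖Y L p‖ ≤ D p
  lim : ∀ᵐ p, Tendsto (fun L => Y L p) atTop (𝓝 (y p))

/-- A normalised family of amplitudes that tends to zero almost everywhere. -/
structure Escaping (W : ℝ → Space3 → ℂ) : Prop where
  norm : ∀ᶠ L in atTop, MemLp (W L) 2 volume ∧ ∫ p, ‖W L p‖ ^ 2 = 1
  lim : ∀ᵐ p, Tendsto (fun L => W L p) atTop (𝓝 0)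

section General

variable {Y Z W : ℝ → Space3 → ℂ} {y z : Space3 → ℂ}

theorem Dominated.memLp (hY : Dominated Y y) : MemLp y 2 volume := by
  obtain ⟨D, hD, hev⟩ := hY.bound
  obtain ⟨L₀, hL₀⟩ := eventually_atTop.1 hev
  have hseq : Tendsto (fun n : ℕ => L₀ + (n : ℝ)) atTop atTop :=
    tendsto_atTop_add_const_left _ _ tendsto_natCast_atTop_atTop
  have hn : ∀ n : ℕ, L₀ ≤ L₀ + (n : ℝ) := fun n => by
    have := Nat.cast_nonneg (α := ℝ) n
    linarith
  have hm : AEStronglyMeasurable y volume :=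
    aestronglyMeasurable_of_tendsto_ae atTop (fun n : ℕ => (hL₀ _ (hn n)).1) (by
      filter_upwards [hY.lim] with p hp using hp.comp hseq)
  refine hD.mono hm ?_
  have hall := ae_all_iff.2 fun n : ℕ => (hL₀ _ (hn n)).2
  filter_upwards [hY.lim, hall] with p hp hb
  have : ‖y p‖ ≤ D p := le_of_tendsto' (hp.comp hseq).norm fun n => hb n
  exact this.trans (le_abs_self _)

theorem Dominated.add (hY : Dominated Y y) (hZ : Dominated Z z) :
    Dominated (fun L p => Y L p + Z L p) (fun p => y p + z p) := by
  obtain ⟨D, hD, hev⟩ := hY.bound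
  obtain ⟨E, hE, hev'⟩ := hZ.bound
  refine ⟨⟨fun p => D p + E p, hD.add hE, ?_⟩, ?_⟩
  · filter_upwards [hev, hev'] with L h1 h2
    refine ⟨h1.1.add h2.1, ?_⟩
    filter_upwards [h1.2, h2.2] with p h3 h4
    exact (norm_add_le _ _).trans (add_le_add h3 h4)
  · filter_upwards [hY.lim, hZ.lim] with p h1 h2 using h1.add h2

theorem Dominated.smul (hY : Dominated Y y) {α : ℝ → ℝ} {α₀ : ℝ} (hα : Tendsto α atTop (𝓝 α₀)) :
    Dominated (fun L p => (α L : ℂ) * Y L p) (fun p => (α₀ : ℂ) * y p) := by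
  obtain ⟨D, hD, hev⟩ := hY.bound
  refine ⟨⟨fun p => (|α₀| + 1) * D p, hD.const_mul _, ?_⟩, ?_⟩
  · have h3 : ∀ᶠ L in atTop, |α L| < |α₀| + 1 := hα.abs.eventually_lt_const (by linarith)
    filter_upwards [hev, h3] with L h1 h2
    refine ⟨h1.1.const_mul _, ?_⟩
    filter_upwards [h1.2] with p h4
    rw [norm_mul, Complex.norm_real, Real.norm_eq_abs]
    exact mul_le_mul h2.le h4 (norm_nonneg _) (by positivity)
  · filter_upwards [hY.lim] with p h1
    exact ((Complex.continuous_ofReal.tendsto _).comp hα).mul h1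

theorem Dominated.phase (hY : Dominated Y y) (d : Space3) :
    Dominated (fun L p => Complex.exp (Complex.I * ((inner ℝ p d : ℝ) : ℂ)) * Y L p)
      (fun p => Complex.exp (Complex.I * ((inner ℝ p d : ℝ) : ℂ)) * y p) := by
  obtain ⟨D, hD, hev⟩ := hY.bound
  refine ⟨⟨D, hD, ?_⟩, ?_⟩
  · filter_upwards [hev] with L h1
    refine ⟨AEStronglyMeasurable.mul (by fun_prop) h1.1, ?_⟩
    filter_upwards [h1.2] with p h2
    rwa [norm_mul, norm_cexp_I_mul, one_mul]
  · filter_upwards [hY.lim] with p h1 using h1.const_mul _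

theorem Escaping.phase (hW : Escaping W) (d : Space3) :
    Escaping (fun L p => Complex.exp (Complex.I * ((inner ℝ p d : ℝ) : ℂ)) * W L p) := by
  refine ⟨?_, ?_⟩
  · filter_upwards [hW.norm] with L h1
    refine ⟨h1.1.mono (AEStronglyMeasurable.mul (by fun_prop) h1.1.1) ?_, ?_⟩
    · filter_upwards with p
      rw [norm_mul, norm_cexp_I_mul, one_mul]
    · simpa only [norm_mul, norm_cexp_I_mul, one_mul] using h1.2
  · filter_upwards [hW.lim] with p h1 using by simpa using h1.const_mul _

theorem integrable_mul_conj {u v : Space3 → ℂ} (hu : MemLp u 2 volume) (hv : MemLp v 2 volume) :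
    Integrable (fun p => u p * conj (v p)) := by
  have hv' : MemLp (fun p => conj (v p)) 2 volume := hv.star
  exact hu.integrable_mul hv'

theorem Dominated.tendsto_integral (hY : Dominated Y y) (hZ : Dominated Z z) :
    Tendsto (fun L => ∫ p, Y L p * conj (Z L p)) atTop (𝓝 (∫ p, y p * conj (z p))) := by
  obtain ⟨D, hD, hev⟩ := hY.bound
  obtain ⟨E, hE, hev'⟩ := hZ.bound
  refine tendsto_integral_filter_of_dominated_convergence (fun p => D p * E p) ?_ ?_
    (hD.integrable_mul hE) ?_
  · filter_upwards [hev, hev'] with L h1 h2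
    exact h1.1.mul (Complex.continuous_conj.comp_aestronglyMeasurable h2.1)
  · filter_upwards [hev, hev'] with L h1 h2
    filter_upwards [h1.2, h2.2] with p h3 h4
    rw [norm_mul, RCLike.norm_conj]
    exact mul_le_mul h3 h4 (norm_nonneg _) ((norm_nonneg _).trans h3)
  · filter_upwards [hY.lim, hZ.lim] with p h1 h2
    exact h1.mul ((Complex.continuous_conj.tendsto _).comp h2)

/-- Pointwise `|D||W|` is at most `ε/2 |W|²` plus the minimum of `|D||W|` and `D²/(2ε)`. The first
term integrates to `ε/2` by normalisation; the minimum is dominated by an integrable function and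
tends to 0 almost everywhere. -/
theorem Dominated.tendsto_integral_escaping (hY : Dominated Y y) (hW : Escaping W) :
    Tendsto (fun L => ∫ p, Y L p * conj (W L p)) atTop (𝓝 0) := by
  obtain ⟨D, hD, hev⟩ := hY.bound
  have hD2 : Integrable (fun p => D p ^ 2) := hD.integrable_sq
  rw [Metric.tendsto_nhds]
  intro ε hε
  have hmin : Tendsto (fun L => ∫ p, min (|D p| * ‖W L p‖) ((2 * ε)⁻¹ * D p ^ 2)) atTop
      (𝓝 (∫ _ : Space3, (0 : ℝ))) := by
    refine tendsto_integral_filter_of_dominated_convergence (fun p => (2 * ε)⁻¹ * D p ^ 2) ?_ ?_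
      (hD2.const_mul _) ?_
    · filter_upwards [hW.norm] with L h1
      exact (hD.1.norm.mul h1.1.1.norm).inf (hD2.1.const_mul _)
    · filter_upwards with L
      filter_upwards with p
      rw [Real.norm_of_nonneg (le_min (by positivity) (by positivity))]
      exact min_le_right _ _
    · filter_upwards [hW.lim] with p h1
      have h2 : Tendsto (fun L => |D p| * ‖W L p‖) atTop (𝓝 0) := by
        simpa using h1.norm.const_mul |D p|
      refine squeeze_zero (fun L => le_min (by positivity) (by positivity))
        (fun L => min_le_left _ _) h2
  rw [integral_zero] at hmin
  filter_upwards [hev, hW.norm, hmin.eventually_lt_const (half_pos hε)] with L h1 h2 h3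
  rw [dist_zero_right]
  have hW2 : Integrable (fun p => ‖W L p‖ ^ 2) := h2.1.integrable_norm_pow (by norm_num)
  have hmI : Integrable (fun p => min (|D p| * ‖W L p‖) ((2 * ε)⁻¹ * D p ^ 2)) := by
    refine (hD2.const_mul (2 * ε)⁻¹).mono' ((hD.1.norm.mul h2.1.1.norm).inf (hD2.1.const_mul _)) ?_
    filter_upwards with p
    rw [Real.norm_of_nonneg (le_min (by positivity) (by positivity))]
    exact min_le_right _ _
  calc ‖∫ p, Y L p * conj (W L p)‖ ≤ ∫ p, (ε / 2 * ‖W L p‖ ^ 2 +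
        min (|D p| * ‖W L p‖) ((2 * ε)⁻¹ * D p ^ 2)) := by
        refine norm_integral_le_of_norm_le ((hW2.const_mul _).add hmI) ?_
        filter_upwards [h1.2] with p h4
        rw [norm_mul, RCLike.norm_conj]
        have h5 : ‖Y L p‖ * ‖W L p‖ ≤ |D p| * ‖W L p‖ :=
          mul_le_mul_of_nonneg_right (h4.trans (le_abs_self _)) (norm_nonneg _)
        refine h5.trans ?_
        rw [← min_add_add_left]
        refine le_min (by linarith [show 0 ≤ ε / 2 * ‖W L p‖ ^ 2 by positivity]) ?_
        rw [← sq_abs (D p), ← sub_nonneg]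
        have : ε / 2 * ‖W L p‖ ^ 2 + (2 * ε)⁻¹ * |D p| ^ 2 - |D p| * ‖W L p‖ =
          (2 * ε)⁻¹ * (ε * ‖W L p‖ - |D p|) ^ 2 := by field_simp; ring
        rw [this]; positivity
    _ < ε := by
        rw [integral_add (hW2.const_mul _) hmI, integral_const_mul, h2.2]
        linarith

theorem Escaping.tendsto_integral_self (hW : Escaping W) :
    Tendsto (fun L => (∫ p, W L p * conj (W L p)).re) atTop (𝓝 1) := by
  refine tendsto_const_nhds.congr' ?_
  filter_upwards [hW.norm] with L h1
  have : ∫ p, W L p * conj (W L p) = ((∫ p, ‖W L p‖ ^ 2 : ℝ) : ℂ) := by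
    rw [← integral_complex_ofReal]
    refine integral_congr_ae (Eventually.of_forall fun p => ?_)
    simp [Complex.mul_conj, Complex.normSq_eq_norm_sq]
  rw [this, h1.2]; simp

theorem Escaping.tendsto_integral_dominated (hW : Escaping W) (hY : Dominated Y y) :
    Tendsto (fun L => ∫ p, W L p * conj (Y L p)) atTop (𝓝 0) := by
  have := (Complex.continuous_conj.tendsto 0).comp (hY.tendsto_integral_escaping hW)
  rw [map_zero] at this
  refine this.congr fun L => ?_
  rw [Function.comp_apply, ← integral_conj]
  refine integral_congr_ae (Eventually.of_forall fun p => ?_)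
  simp [mul_comm]

end General

/-! ### Weighted square integrability of Fourier transforms -/

/-- Integrable functions in the Sobolev space of order `-1/2`. -/
structure Tame (u : Space3 → ℝ) : Prop where
  integrable : Integrable u
  sobolev : Integrable (fun p => ‖p‖⁻¹ * ‖hat u p‖ ^ 2)

/-- Integrable functions in the Sobolev space of order `1/2`. -/
structure Strong (u : Space3 → ℝ) : Prop where
  integrable : Integrable u
  sobolev : Integrable (fun p => ‖p‖ * ‖hat u p‖ ^ 2)

theorem norm_hat_lincomb_sq_le {u v : Space3 → ℝ} (hu : Integrable u) (hv : Integrable v)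
    (a b : ℝ) (p : Space3) : ‖hat (fun x => a * u x + b * v x) p‖ ^ 2 ≤
      2 * a ^ 2 * ‖hat u p‖ ^ 2 + 2 * b ^ 2 * ‖hat v p‖ ^ 2 := by
  rw [hat_lincomb hu hv]
  have h1 := norm_add_le ((a : ℂ) * hat u p) ((b : ℂ) * hat v p)
  rw [norm_mul, norm_mul, Complex.norm_real, Complex.norm_real, Real.norm_eq_abs,
    Real.norm_eq_abs] at h1
  have h2 := pow_le_pow_left₀ (norm_nonneg _) h1 2
  have h3 := add_sq_le (a := |a| * ‖hat u p‖) (b := |b| * ‖hat v p‖)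
  rw [mul_pow, mul_pow, sq_abs, sq_abs] at h3
  linarith

theorem Tame.lincomb {u v : Space3 → ℝ} (hu : Tame u) (hv : Tame v) (a b : ℝ) :
    Tame (fun x => a * u x + b * v x) := by
  refine ⟨(hu.1.const_mul a).add (hv.1.const_mul b), ?_⟩
  refine ((hu.2.const_mul (2 * a ^ 2)).add (hv.2.const_mul (2 * b ^ 2))).mono' ?_ ?_
  · exact (measurable_norm.inv.mul ((continuous_hat ((hu.1.const_mul a).add
      (hv.1.const_mul b))).measurable.norm.pow_const 2)).aestronglyMeasurable
  · filter_upwards with p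
    rw [Real.norm_of_nonneg (by positivity), Pi.add_apply]
    have := mul_le_mul_of_nonneg_left (norm_hat_lincomb_sq_le hu.1 hv.1 a b p)
      (inv_nonneg.2 (norm_nonneg p))
    linarith

theorem Strong.lincomb {u v : Space3 → ℝ} (hu : Strong u) (hv : Strong v) (a b : ℝ) :
    Strong (fun x => a * u x + b * v x) := by
  refine ⟨(hu.1.const_mul a).add (hv.1.const_mul b), ?_⟩
  refine ((hu.2.const_mul (2 * a ^ 2)).add (hv.2.const_mul (2 * b ^ 2))).mono' ?_ ?_
  · exact (measurable_norm.mul ((continuous_hat ((hu.1.const_mul a).add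
      (hv.1.const_mul b))).measurable.norm.pow_const 2)).aestronglyMeasurable
  · filter_upwards with p
    rw [Real.norm_of_nonneg (by positivity), Pi.add_apply]
    have := mul_le_mul_of_nonneg_left (norm_hat_lincomb_sq_le hu.1 hv.1 a b p) (norm_nonneg p)
    linarith

theorem tame_zero : Tame 0 := by
  refine ⟨integrable_zero _ _ _, ?_⟩
  simp [hat_zero_left]

/-- `|p|^s` is integrable near the origin for `s > -3`. -/
theorem integrableOn_norm_rpow_ball {s : ℝ} (hs : -3 < s) :
    IntegrableOn (fun p : Space3 => ‖p‖ ^ s) (Metric.closedBall 0 1) := by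
  refine (locallyIntegrable_of_norm_le_rpow (C := 1) (α := -s) (by simp) (by simp; linarith) ?_
    (measurable_norm.pow_const s).aestronglyMeasurable).integrableOn_isCompact
    (isCompact_closedBall 0 1)
  filter_upwards with p
  rw [neg_neg, one_mul, Real.norm_of_nonneg (by positivity)]

/-- In the unit ball the transform is bounded and `|p|^s` is integrable for `s > -3`; outside it the
larger exponent dominates. -/
theorem integrable_rpow_mul_sq_hat {u : Space3 → ℝ} (hu : Integrable u) {s t : ℝ} (hs : -3 < s)
    (hst : s ≤ t) (ht : Integrable (fun p => ‖p‖ ^ t * ‖hat u p‖ ^ 2)) :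
    Integrable (fun p => ‖p‖ ^ s * ‖hat u p‖ ^ 2) := by
  have hm : AEStronglyMeasurable (fun p : Space3 => ‖p‖ ^ s * ‖hat u p‖ ^ 2) volume :=
    ((measurable_norm.pow_const s).mul ((continuous_hat hu).measurable.norm.pow_const
      2)).aestronglyMeasurable
  rw [← integrableOn_univ, ← Set.union_compl_self (Metric.closedBall (0 : Space3) 1)]
  refine IntegrableOn.union ?_ ?_
  · refine ((integrableOn_norm_rpow_ball hs).mul_const ((∫ x, |u x|) ^ 2)).mono' hm.restrict ?_
    filter_upwards with p
    rw [Real.norm_of_nonneg (by positivity)]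
    exact mul_le_mul_of_nonneg_left (pow_le_pow_left₀ (norm_nonneg _) (norm_hat_le u p) 2)
      (by positivity)
  · refine (ht.integrableOn (s := (Metric.closedBall (0 : Space3) 1)ᶜ)).mono' hm.restrict ?_
    filter_upwards [ae_restrict_mem Metric.isClosed_closedBall.measurableSet.compl] with p hp
    rw [Real.norm_of_nonneg (by positivity)]
    refine mul_le_mul_of_nonneg_right ?_ (by positivity)
    have : 1 ≤ ‖p‖ := by
      simp at hp; exact hp.le
    exact Real.rpow_le_rpow_of_exponent_le this hst

theorem Strong.tame {u : Space3 → ℝ} (hu : Strong u) : Tame u := by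
  refine ⟨hu.1, ?_⟩
  have := integrable_rpow_mul_sq_hat hu.1 (s := -1) (t := 1) (by norm_num) (by norm_num)
    (by simpa using hu.2)
  simpa [Real.rpow_neg_one] using this

theorem ae_ne_zero : ∀ᵐ p : Space3, p ≠ 0 := by
  rw [ae_iff]; simp

/-- `L²` membership of `|p|^s û` in terms of a weighted integral. -/
theorem memLp_rpow_mul_hat_iff {u : Space3 → ℝ} (hu : Integrable u) (s : ℝ) :
    MemLp (fun p => ((‖p‖ ^ s : ℝ) : ℂ) * hat u p) 2 volume ↔
      Integrable (fun p => ‖p‖ ^ (2 * s) * ‖hat u p‖ ^ 2) := by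
  have hm : AEStronglyMeasurable (fun p : Space3 => ((‖p‖ ^ s : ℝ) : ℂ) * hat u p) volume :=
    ((Complex.measurable_ofReal.comp (measurable_norm.pow_const s)).mul
      (continuous_hat hu).measurable).aestronglyMeasurable
  rw [memLp_two_iff_integrable_sq_norm hm]
  refine integrable_congr ?_
  filter_upwards [ae_ne_zero] with p hp
  have hp0 : 0 < ‖p‖ := norm_pos_iff.2 hp
  rw [norm_mul, Complex.norm_real, Real.norm_of_nonneg (by positivity), mul_pow,
    ← Real.rpow_natCast, ← Real.rpow_mul hp0.le]
  congr 2; push_cast; ring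

/-- The lower limit is infrared convergence in three dimensions. It admits `s = -ν` because `ν <
3/2`, that is, because the mass is positive. -/
theorem Tame.memLp_rpow {u : Space3 → ℝ} (hu : Tame u) {s : ℝ} (h1 : -(3 / 2) < s)
    (h2 : s ≤ -(1 / 2)) : MemLp (fun p => ((‖p‖ ^ s : ℝ) : ℂ) * hat u p) 2 volume := by
  rw [memLp_rpow_mul_hat_iff hu.1]
  refine integrable_rpow_mul_sq_hat hu.1 (by linarith) (t := -1) (by linarith) ?_
  simpa [Real.rpow_neg_one] using hu.2

end BunchDavies

/-! ### Dominated and escaping families built from the Hankel functions. -/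

namespace BunchDavies

/-- Bounds and leading behaviour at the origin of the Hankel functions of orders `ν`, `ν - 1`. -/
structure HankelData (ν K : ℝ) (c₀ c₁ : ℂ) : Prop where
  one_lt : 1 < ν
  lt : ν < 3 / 2
  bounds : HankelBounds ν K
  ne₀ : c₀ ≠ 0
  ne₁ : c₁ ≠ 0
  lim₀ : Tendsto (fun x : ℝ => ((x ^ ν : ℝ) : ℂ) * hankel1 ν x) (𝓝[>] 0) (𝓝 c₀)
  lim₁ : Tendsto (fun x : ℝ => ((x ^ (ν - 1) : ℝ) : ℂ) * hankel1 (ν - 1) x) (𝓝[>] 0) (𝓝 c₁)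

theorem exists_hankelData {ν : ℝ} (h1 : 1 < ν) (h2 : ν < 3 / 2) :
    ∃ K c₀ c₁, HankelData ν K c₀ c₁ := by
  obtain ⟨K, hK⟩ := exists_hankelBounds h1 h2
  obtain ⟨c₀, h3, h4⟩ := exists_tendsto_hankel1_zero (ν := ν) (by linarith) (by
    rintro n rfl
    have : 1 < n := by exact_mod_cast h1
    have : (2 : ℝ) ≤ n := by exact_mod_cast this
    linarith)
  obtain ⟨c₁, h5, h6⟩ := exists_tendsto_hankel1_zero (ν := ν - 1) (by linarith) (by
    intro n hn
    rcases Nat.eq_zero_or_pos n with rfl | h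
    · simp at hn; linarith
    · have : (1 : ℝ) ≤ n := by exact_mod_cast h
      linarith)
  exact ⟨K, c₀, c₁, h1, h2, hK, h3, h5, h4, h6⟩

/-- The squared norm of `b_L ŵ`. -/
def bNormSq (ν L : ℝ) (w : Space3 → ℝ) : ℝ := ∫ p, ‖bFun ν L p * hat w p‖ ^ 2

/-- The normalised amplitude `b_L ŵ / ‖b_L ŵ‖`. -/
def roughAmp (ν : ℝ) (w : Space3 → ℝ) (L : ℝ) (p : Space3) : ℂ :=
  (((√(bNormSq ν L w))⁻¹ : ℝ) : ℂ) * (bFun ν L p * hat w p)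

section Families

variable {ν K : ℝ} {c₀ c₁ : ℂ} {u w : Space3 → ℝ}

theorem aestronglyMeasurable_aFun_mul {L : ℝ} (hL : 0 < L) (hu : Integrable u) :
    AEStronglyMeasurable (fun p => aFun ν L p * hat u p) volume :=
  ((measurable_aFun hL).mul (continuous_hat hu).measurable).aestronglyMeasurable

theorem aestronglyMeasurable_bFun_mul {L : ℝ} (hL : 0 < L) (hu : Integrable u) :
    AEStronglyMeasurable (fun p => bFun ν L p * hat u p) volume :=
  ((measurable_bFun hL).mul (continuous_hat hu).measurable).aestronglyMeasurable

theorem HankelData.dominated_aFun (H : HankelData ν K c₀ c₁) (hu : Tame u) :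
    Dominated (fun L p => aFun ν L p * hat u p)
      (fun p => ((‖p‖ ^ (-ν) : ℝ) : ℂ) * (c₀ * hat u p)) := by
  have hν := H.one_lt
  have hν' := H.lt
  refine ⟨⟨fun p => K * (‖((‖p‖ ^ (-ν) : ℝ) : ℂ) * hat u p‖ +
    ‖((‖p‖ ^ (-(1 / 2) : ℝ) : ℝ) : ℂ) * hat u p‖), ?_, ?_⟩, ?_⟩
  · exact ((hu.memLp_rpow (by linarith) (by linarith)).norm.add
      (hu.memLp_rpow (by norm_num) le_rfl).norm).const_mul K
  · filter_upwards [eventually_ge_atTop 1] with L hL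
    refine ⟨aestronglyMeasurable_aFun_mul (by linarith) hu.1, ?_⟩
    filter_upwards [ae_ne_zero] with p hp
    rw [norm_mul, norm_mul, norm_mul, Complex.norm_real, Complex.norm_real,
      Real.norm_of_nonneg (by positivity), Real.norm_of_nonneg (by positivity), ← add_mul,
      ← mul_assoc]
    exact mul_le_mul_of_nonneg_right (norm_aFun_le H.one_lt H.bounds hL hp) (norm_nonneg _)
  · filter_upwards [ae_ne_zero] with p hp
    rw [← mul_assoc]
    exact (tendsto_aFun H.lim₀ hp).mul_const _

/-- A single factor `L⁻¹` compensates the growth `L^{3/2-ν}` of the bound adapted to `Ḣ^{1/2}`.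
Hence the `b_L` term drops out of every limit in which it carries a negative power of `L`. -/
theorem HankelData.dominated_inv_bFun (H : HankelData ν K c₀ c₁) (hw : Strong w) :
    Dominated (fun L p => ((L⁻¹ : ℝ) : ℂ) * (bFun ν L p * hat w p)) (fun _ => 0) := by
  have hν := H.one_lt
  have hK := H.bounds.nonneg
  refine ⟨⟨fun p => K * ‖((‖p‖ ^ (1 / 2 : ℝ) : ℝ) : ℂ) * hat w p‖, ?_, ?_⟩, ?_⟩
  · refine MemLp.const_mul (MemLp.norm ?_) K
    rw [memLp_rpow_mul_hat_iff hw.1]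
    simpa using hw.2
  · filter_upwards [eventually_ge_atTop 1] with L hL
    have hL0 : 0 < L := by linarith
    refine ⟨(aestronglyMeasurable_bFun_mul hL0 hw.1).const_mul _, ?_⟩
    filter_upwards [ae_ne_zero] with p hp
    rw [norm_mul, norm_mul, norm_mul, Complex.norm_real, Complex.norm_real,
      Real.norm_of_nonneg (by positivity), Real.norm_of_nonneg (by positivity)]
    have h1 := norm_bFun_le_half H.bounds hL0 hp
    have h2 : L⁻¹ * L ^ (3 / 2 - ν) ≤ 1 := by
      have : L ^ (3 / 2 - ν) ≤ L ^ (1 : ℝ) := Real.rpow_le_rpow_of_exponent_le hL (by linarith)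
      rw [Real.rpow_one] at this
      rwa [inv_mul_le_iff₀ hL0, mul_one]
    calc L⁻¹ * (‖bFun ν L p‖ * ‖hat w p‖)
        ≤ L⁻¹ * (K * L ^ (3 / 2 - ν) * ‖p‖ ^ (1 / 2 : ℝ) * ‖hat w p‖) := by gcongr
      _ = (L⁻¹ * L ^ (3 / 2 - ν)) * (K * (‖p‖ ^ (1 / 2 : ℝ) * ‖hat w p‖)) := by ring
      _ ≤ 1 * (K * (‖p‖ ^ (1 / 2 : ℝ) * ‖hat w p‖)) := by gcongr
      _ = _ := one_mul _
  · filter_upwards [ae_ne_zero] with p hp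
    have h1 := ((tendsto_bFun H.lim₁ hp).mul_const (hat w p))
    have h2 : Tendsto (fun L : ℝ => ((L⁻¹ : ℝ) : ℂ)) atTop (𝓝 ((0 : ℝ) : ℂ)) :=
      (Complex.continuous_ofReal.tendsto _).comp tendsto_inv_atTop_zero
    simpa using h2.mul h1

theorem HankelData.dominated_bFun (H : HankelData ν K c₀ c₁) (hw : Integrable w)
    (hL2 : MemLp (fun p => ((‖p‖ ^ (2 - ν) : ℝ) : ℂ) * hat w p) 2 volume) :
    Dominated (fun L p => bFun ν L p * hat w p)
      (fun p => ((‖p‖ ^ (2 - ν) : ℝ) : ℂ) * (c₁ * hat w p)) := by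
  refine ⟨⟨fun p => K * ‖((‖p‖ ^ (2 - ν) : ℝ) : ℂ) * hat w p‖, hL2.norm.const_mul K, ?_⟩, ?_⟩
  · filter_upwards [eventually_gt_atTop 0] with L hL
    refine ⟨aestronglyMeasurable_bFun_mul hL hw, ?_⟩
    filter_upwards [ae_ne_zero] with p hp
    rw [norm_mul, norm_mul, Complex.norm_real, Real.norm_of_nonneg (by positivity), ← mul_assoc]
    exact mul_le_mul_of_nonneg_right (norm_bFun_le H.bounds hL hp) (norm_nonneg _)
  · filter_upwards [ae_ne_zero] with p hp
    rw [← mul_assoc]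
    exact (tendsto_bFun H.lim₁ hp).mul_const _

theorem HankelData.memLp_bFun (H : HankelData ν K c₀ c₁) (hw : Strong w) {L : ℝ} (hL : 0 < L) :
    MemLp (fun p => bFun ν L p * hat w p) 2 volume := by
  have h1 : MemLp (fun p => ((‖p‖ ^ (1 / 2 : ℝ) : ℝ) : ℂ) * hat w p) 2 volume := by
    rw [memLp_rpow_mul_hat_iff hw.1]
    simpa using hw.2
  refine MemLp.mono (h1.norm.const_mul (K * L ^ (3 / 2 - ν)))
    (aestronglyMeasurable_bFun_mul hL hw.1) ?_
  filter_upwards [ae_ne_zero] with p hp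
  have hK := H.bounds.nonneg
  rw [Real.norm_of_nonneg (by positivity), norm_mul, norm_mul, Complex.norm_real,
    Real.norm_of_nonneg (by positivity), ← mul_assoc]
  exact mul_le_mul_of_nonneg_right (norm_bFun_le_half H.bounds hL hp) (norm_nonneg _)

/-- If the norms stayed bounded along a sequence `L → ∞`, Fatou's lemma would put the pointwise
limit in `L²`. -/
theorem HankelData.tendsto_bNormSq (H : HankelData ν K c₀ c₁) (hw : Strong w)
    (hL2 : ¬ MemLp (fun p => ((‖p‖ ^ (2 - ν) : ℝ) : ℂ) * hat w p) 2 volume) :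
    Tendsto (fun L => bNormSq ν L w) atTop atTop := by
  by_contra hnot
  rw [tendsto_atTop] at hnot
  push Not at hnot
  obtain ⟨M, hM⟩ := hnot
  have hM' : ∃ᶠ L in atTop, bNormSq ν L w < M ∧ 0 < L := by
    refine (hM.mono fun L h => ?_).and_eventually (eventually_gt_atTop 0)
    simpa using h
  obtain ⟨Ls, hLs, hb⟩ := exists_seq_forall_of_frequently hM'
  apply hL2
  have hlim : ∀ᵐ p : Space3, Tendsto (fun n => bFun ν (Ls n) p * hat w p) atTop
      (𝓝 (((‖p‖ ^ (2 - ν) : ℝ) : ℂ) * c₁ * hat w p)) := by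
    filter_upwards [ae_ne_zero] with p hp
    exact ((tendsto_bFun H.lim₁ hp).comp hLs).mul_const _
  have hle := Lp.eLpNorm_le_of_ae_tendsto (p := 2) (C := ENNReal.ofReal (√M)) ?_
    (fun n => aestronglyMeasurable_bFun_mul (hb n).2 hw.1) hlim
  · have h1 : MemLp (fun p => ((‖p‖ ^ (2 - ν) : ℝ) : ℂ) * c₁ * hat w p) 2 volume := by
      refine ⟨?_, lt_of_le_of_lt hle ENNReal.ofReal_lt_top⟩
      exact (((Complex.measurable_ofReal.comp (measurable_norm.pow_const _)).mul_const _).mul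
        (continuous_hat hw.1).measurable).aestronglyMeasurable
    refine (h1.const_mul c₁⁻¹).congr_norm ?_ ?_
    · exact ((Complex.measurable_ofReal.comp (measurable_norm.pow_const _)).mul
        (continuous_hat hw.1).measurable).aestronglyMeasurable
    · filter_upwards with p
      congr 1
      field_simp [H.ne₁]
  · filter_upwards with n
    have h2 := H.memLp_bFun hw (hb n).2
    rw [h2.eLpNorm_eq_integral_rpow_norm (by norm_num) (by norm_num)]
    refine ENNReal.ofReal_le_ofReal ?_
    have := (hb n).1.le
    rw [bNormSq] at this
    simp only [ENNReal.toReal_ofNat, Real.rpow_ofNat]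
    rw [← one_div, ← Real.sqrt_eq_rpow]
    exact Real.sqrt_le_sqrt this

theorem HankelData.escaping_roughAmp (H : HankelData ν K c₀ c₁) (hw : Strong w)
    (hL2 : ¬ MemLp (fun p => ((‖p‖ ^ (2 - ν) : ℝ) : ℂ) * hat w p) 2 volume) :
    Escaping (roughAmp ν w) := by
  have hN := H.tendsto_bNormSq hw hL2
  refine ⟨?_, ?_⟩
  · filter_upwards [hN.eventually_gt_atTop 0, eventually_gt_atTop 0] with L h1 hL
    refine ⟨(H.memLp_bFun hw hL).const_mul _, ?_⟩
    have : ∀ p, ‖roughAmp ν w L p‖ ^ 2 = (bNormSq ν L w)⁻¹ * ‖bFun ν L p * hat w p‖ ^ 2 := by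
      intro p
      rw [roughAmp, norm_mul, Complex.norm_real, mul_pow, Real.norm_eq_abs, sq_abs, inv_pow,
        Real.sq_sqrt h1.le]
    simp_rw [this]
    rw [integral_const_mul, ← bNormSq, inv_mul_cancel₀ h1.ne']
  · filter_upwards [ae_ne_zero] with p hp
    have h1 := ((tendsto_bFun H.lim₁ hp).mul_const (hat w p))
    have h2 : Tendsto (fun L : ℝ => (((√(bNormSq ν L w))⁻¹ : ℝ) : ℂ)) atTop (𝓝 ((0 : ℝ) : ℂ)) :=
      (Complex.continuous_ofReal.tendsto _).comp
        (tendsto_inv_atTop_zero.comp (Real.tendsto_sqrt_atTop.comp hN))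
    have h3 := h2.mul h1
    rw [Complex.ofReal_zero, zero_mul] at h3
    exact h3

/-- The normalised amplitudes of two separated rough modes become uncorrelated. -/
theorem HankelData.tendsto_integral_roughAmp (H : HankelData ν K c₀ c₁) {w' : Space3 → ℝ}
    (hw : Strong w) (hw' : Strong w')
    (hL2 : ¬ MemLp (fun p => ((‖p‖ ^ (2 - ν) : ℝ) : ℂ) * hat w p) 2 volume)
    (hL2' : ¬ MemLp (fun p => ((‖p‖ ^ (2 - ν) : ℝ) : ℂ) * hat w' p) 2 volume)
    {d : Space3} {S S' : Set Space3} (hS : IsCompact S) (hS' : IsCompact S') (hdis : Disjoint S S')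
    (hsupp : ∀ x, w x ≠ 0 → x ∈ S) (hsupp' : ∀ x, w' (x - d) ≠ 0 → x ∈ S') :
    Tendsto (fun L => ∫ p, roughAmp ν w L p *
      conj (Complex.exp (Complex.I * ((inner ℝ p d : ℝ) : ℂ)) * roughAmp ν w' L p)) atTop (𝓝 0) := by
  obtain ⟨Q, hQ0, hQ⟩ := exists_offDiagonal_bound hw.1 hw'.1 hS hS' hdis hsupp hsupp' hw.2 hw'.2
  have hN := H.tendsto_bNormSq hw hL2
  have hN' := H.tendsto_bNormSq hw' hL2'
  have hi : Tendsto (fun L : ℝ => (√(bNormSq ν L w))⁻¹ * (√(bNormSq ν L w'))⁻¹ *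
      ((2 * K + K ^ 2) * Q)) atTop (𝓝 0) := by
    have h1 := tendsto_inv_atTop_zero.comp (Real.tendsto_sqrt_atTop.comp hN)
    have h2 := tendsto_inv_atTop_zero.comp (Real.tendsto_sqrt_atTop.comp hN')
    simpa using (h1.mul h2).mul_const ((2 * K + K ^ 2) * Q)
  refine squeeze_zero_norm' ?_ hi
  filter_upwards [eventually_ge_atTop 1] with L hL
  have hL0 : 0 < L := by linarith
  -- The variation constant `2K + K²` does not depend on `L`; the growth constant does, but it does
  -- not enter the resulting bound.
  have hb := hQ (fun p => ‖bFun ν L p‖ ^ 2) (2 * K + K ^ 2) ((K * L ^ (3 / 2 - ν)) ^ 2)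
    ((measurable_bFun hL0).norm.pow_const 2)
    (bFun_sq_variation H.one_lt H.lt H.bounds hL) (bFun_sq_growth H.bounds hL)
  have e : ∫ p, roughAmp ν w L p *
      conj (Complex.exp (Complex.I * ((inner ℝ p d : ℝ) : ℂ)) * roughAmp ν w' L p) =
      (((√(bNormSq ν L w))⁻¹ * (√(bNormSq ν L w'))⁻¹ : ℝ) : ℂ) *
        ∫ p, ((‖bFun ν L p‖ ^ 2 : ℝ) : ℂ) * crossSpec w w' d p := by
    rw [← integral_const_mul]
    refine integral_congr_ae (Eventually.of_forall fun p => ?_)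
    have hb2 : ((‖bFun ν L p‖ ^ 2 : ℝ) : ℂ) = bFun ν L p * conj (bFun ν L p) := by
      rw [Complex.mul_conj, Complex.normSq_eq_norm_sq]
    simp only [roughAmp, crossSpec, map_mul, Complex.conj_ofReal, hb2]
    push_cast; ring
  rw [e, norm_mul, Complex.norm_real, Real.norm_of_nonneg (by positivity)]
  exact mul_le_mul_of_nonneg_left hb (by positivity)

end Families

end BunchDavies

open Matrix in
/-- A real symmetric Gram matrix plus a diagonal matrix. -/
theorem posDef_add_diagonal {ι : Type*} [Fintype ι] [DecidableEq ι] {G : Matrix ι ι ℝ} {ε : ι → ℝ}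
    (hG : G.IsHermitian) (hq : ∀ x : ι → ℝ, x ≠ 0 → 0 < x ⬝ᵥ (G *ᵥ x) + ∑ i, ε i * x i ^ 2) :
    (G + diagonal ε).PosDef := by
  refine PosDef.of_dotProduct_mulVec_pos (hG.add (isHermitian_diagonal ε)) fun x hx => ?_
  have := hq x hx
  rw [star_trivial, add_mulVec, dotProduct_add]
  convert! this using 2
  rw [dotProduct]
  refine Finset.sum_congr rfl fun i _ => ?_
  rw [mulVec_diagonal]; ring

/-! ### Overlap matrices -/

section Overlap

open Matrix

variable {ι κ : Type*}

/-- Real parts of the overlap integrals of two families of amplitudes. -/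
def overlap (V : ι → Space3 → ℂ) (W : κ → Space3 → ℂ) : Matrix ι κ ℝ :=
  Matrix.of fun i j => (∫ p, V i p * conj (W j p)).re

theorem overlap_transpose (V : ι → Space3 → ℂ) (W : κ → Space3 → ℂ) :
    (overlap V W)ᵀ = overlap W V := by
  ext i j
  rw [transpose_apply, overlap, overlap, of_apply, of_apply, ← Complex.conj_re, ← integral_conj]
  congr 2
  ext p
  simp [mul_comm]

theorem overlap_phase (V : ι → Space3 → ℂ) (W : κ → Space3 → ℂ) (d : Space3) :
    overlap (fun i p => Complex.exp (Complex.I * ((inner ℝ p d : ℝ) : ℂ)) * V i p)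
      (fun i p => Complex.exp (Complex.I * ((inner ℝ p d : ℝ) : ℂ)) * W i p) = overlap V W := by
  ext i j
  simp only [overlap, of_apply]
  congr 2
  ext p
  have h1 := Complex.mul_conj (Complex.exp (Complex.I * ((inner ℝ p d : ℝ) : ℂ)))
  rw [Complex.normSq_eq_norm_sq, norm_cexp_I_mul] at h1
  rw [map_mul, mul_mul_mul_comm, h1]
  simp

theorem fromBlocks_overlap (V : ι → Space3 → ℂ) (W : κ → Space3 → ℂ) :
    fromBlocks (overlap V V) (overlap V W) (overlap V W).transpose (overlap W W) =
      overlap (Sum.elim V W) (Sum.elim V W) := by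
  rw [overlap_transpose]
  ext i j
  rcases i with i | i <;> rcases j with j | j <;> rfl

theorem isHermitian_overlap (V : ι → Space3 → ℂ) : (overlap V V).IsHermitian := by
  rw [IsHermitian, conjTranspose_eq_transpose_of_trivial, overlap_transpose]

theorem overlap_lincomb [Fintype ι] [Fintype κ] {V : ι → Space3 → ℂ} {W : κ → Space3 → ℂ}
    (hV : ∀ i, MemLp (V i) 2 volume) (hW : ∀ i, MemLp (W i) 2 volume) {ι' κ' : Type*}
    (S : Matrix ι' ι ℝ) (T : Matrix κ' κ ℝ) :
    overlap (fun i p => ∑ j, (S i j : ℂ) * V j p) (fun i p => ∑ j, (T i j : ℂ) * W j p) =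
      S * overlap V W * Tᵀ := by
  ext i j
  have e : ∫ p, (∑ k, (S i k : ℂ) * V k p) * conj (∑ l, (T j l : ℂ) * W l p) =
      ∑ k, ∑ l, ((S i k * T j l : ℝ) : ℂ) * ∫ p, V k p * conj (W l p) := by
    have hint : ∀ k l, Integrable fun p => ((S i k * T j l : ℝ) : ℂ) * (V k p * conj (W l p)) :=
      fun k l => (BunchDavies.integrable_mul_conj (hV k) (hW l)).const_mul _
    simp_rw [← integral_const_mul]
    have h1 : ∀ k, ∑ l, ∫ p, ((S i k * T j l : ℝ) : ℂ) * (V k p * conj (W l p)) =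
        ∫ p, ∑ l, ((S i k * T j l : ℝ) : ℂ) * (V k p * conj (W l p)) := fun k =>
      (integral_finsetSum _ fun l _ => hint k l).symm
    simp_rw [h1]
    rw [← integral_finsetSum _ fun k _ => integrable_finsetSum _ fun l _ => hint k l]
    refine integral_congr_ae (Eventually.of_forall fun p => ?_)
    simp only [map_sum, map_mul, Complex.conj_ofReal, Finset.sum_mul_sum, Complex.ofReal_mul]
    refine Finset.sum_congr rfl fun k _ => Finset.sum_congr rfl fun l _ => ?_
    ring
  rw [overlap, of_apply, e, mul_apply]
  simp only [mul_apply, transpose_apply, overlap, of_apply, Complex.re_sum, Complex.re_ofReal_mul,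
    Finset.sum_mul]
  rw [Finset.sum_comm]
  refine Finset.sum_congr rfl fun k _ => Finset.sum_congr rfl fun l _ => ?_
  ring

theorem dotProduct_overlap_mulVec [Fintype ι] {V : ι → Space3 → ℂ}
    (hV : ∀ i, MemLp (V i) 2 volume) (x : ι → ℝ) :
    x ⬝ᵥ (overlap V V *ᵥ x) = ∫ p, ‖∑ i, (x i : ℂ) * V i p‖ ^ 2 := by
  have h := congrFun (congrFun (overlap_lincomb hV hV (replicateRow Unit x)
    (replicateRow Unit x)) ()) ()
  have h2 : (replicateRow Unit x * overlap V V * (replicateRow Unit x)ᵀ) () () =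
      x ⬝ᵥ (overlap V V *ᵥ x) := by
    rw [dotProduct_mulVec]; rfl
  rw [← h2, ← h, overlap, of_apply, ← RCLike.re_eq_complex_re, ← integral_re]
  · refine integral_congr_ae (Eventually.of_forall fun p => ?_)
    simp only [replicateRow_apply, RCLike.re_eq_complex_re]
    rw [Complex.mul_conj, Complex.normSq_eq_norm_sq, Complex.ofReal_re]
  · have hm : MemLp (fun p => ∑ i, (x i : ℂ) * V i p) 2 volume :=
      memLp_finsetSum _ fun i _ => (hV i).const_mul _
    exact BunchDavies.integrable_mul_conj hm hm

theorem posSemidef_overlap [Fintype ι] {V : ι → Space3 → ℂ} (hV : ∀ i, MemLp (V i) 2 volume) :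
    (overlap V V).PosSemidef := by
  refine PosSemidef.of_dotProduct_mulVec_nonneg (isHermitian_overlap V) fun x => ?_
  rw [star_trivial, dotProduct_overlap_mulVec hV]
  positivity

/-- Directions with positive `ε` draw positivity from the diagonal, so independence of the
amplitudes is required only on the remaining ones. -/
theorem posDef_overlap_add_diagonal [Fintype ι] [DecidableEq ι] {V : ι → Space3 → ℂ}
    (hV : ∀ i, MemLp (V i) 2 volume) {ε : ι → ℝ} (hε : ∀ i, 0 ≤ ε i)
    (hind : ∀ x : ι → ℝ, (∀ᵐ p, ∑ i, (x i : ℂ) * V i p = 0) → (∑ i, ε i * x i ^ 2 = 0) → x = 0) :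
    (overlap V V + diagonal ε).PosDef := by
  refine posDef_add_diagonal (isHermitian_overlap V) fun x hx => ?_
  rw [dotProduct_overlap_mulVec hV]
  have h1 : 0 ≤ ∫ p, ‖∑ i, (x i : ℂ) * V i p‖ ^ 2 := by positivity
  have h2 : 0 ≤ ∑ i, ε i * x i ^ 2 := Finset.sum_nonneg fun i _ => mul_nonneg (hε i) (sq_nonneg _)
  refine lt_of_le_of_ne (add_nonneg h1 h2) fun h => hx ?_
  have h3 : ∫ p, ‖∑ i, (x i : ℂ) * V i p‖ ^ 2 = 0 := by linarith
  refine hind x ?_ (by linarith)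
  have hm : MemLp (fun p => ∑ i, (x i : ℂ) * V i p) 2 volume :=
    memLp_finsetSum _ fun i _ => (hV i).const_mul _
  rw [integral_eq_zero_iff_of_nonneg (fun p => by positivity)
    (hm.integrable_norm_pow (by norm_num))] at h3
  filter_upwards [h3] with p hp
  simpa using hp

end Overlap

namespace BunchDavies

/-! ### Adapted frames of a mode -/

section

variable {ν K : ℝ} {c₀ c₁ : ℂ}

theorem HankelData.memLp_aFun (H : HankelData ν K c₀ c₁) {u : Space3 → ℝ} (hu : Tame u) {L : ℝ}
    (hL : 1 ≤ L) : MemLp (fun p => aFun ν L p * hat u p) 2 volume := by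
  have hν := H.one_lt
  have hν' := H.lt
  have hD := ((hu.memLp_rpow (s := -ν) (by linarith) (by linarith)).norm.add
    (hu.memLp_rpow (s := -(1 / 2)) (by norm_num) le_rfl).norm).const_mul K
  refine hD.mono (aestronglyMeasurable_aFun_mul (by linarith) hu.1) ?_
  filter_upwards [ae_ne_zero] with p hp
  refine le_trans ?_ (le_abs_self _)
  rw [Pi.add_apply, norm_mul, norm_mul, norm_mul, Complex.norm_real, Complex.norm_real,
    Real.norm_of_nonneg (by positivity), Real.norm_of_nonneg (by positivity), ← add_mul,
    ← mul_assoc]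
  exact mul_le_mul_of_nonneg_right (norm_aFun_le H.one_lt H.bounds hL hp) (norm_nonneg _)

end

theorem PhaseVec.Admissible.strong_g {γ : PhaseVec} (h : γ.Admissible) : Strong γ.g := by
  refine ⟨h.integrable_g, ?_⟩
  simpa using sobolev_integrable h.sobolev_g

theorem PhaseVec.Admissible.tame_f {γ : PhaseVec} (h : γ.Admissible) : Tame γ.f := by
  refine ⟨h.integrable_f, ?_⟩
  have := sobolev_integrable h.sobolev_f
  simpa [show (2 : ℝ) * (-1 / 2) = -1 by norm_num, Real.rpow_neg_one] using this

theorem HankelData.memLp_redAmp {ν K : ℝ} {c₀ c₁ : ℂ} (H : HankelData ν K c₀ c₁) {γ : PhaseVec}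
    (h : γ.Admissible) {L : ℝ} (hL : 1 ≤ L) : MemLp (redAmp ν L γ) 2 volume := by
  have hg := PhaseVec.Admissible.strong_g h
  have h1 := (H.memLp_aFun hg.tame hL).const_mul ((3 / 2 - ν : ℝ) : ℂ)
  have h2 := (H.memLp_aFun (PhaseVec.Admissible.tame_f h) hL).const_mul ((L⁻¹ : ℝ) : ℂ)
  have h3 := (H.memLp_bFun hg (by linarith : 0 < L)).const_mul (((L ^ 2)⁻¹ : ℝ) : ℂ)
  convert! (h1.add h2).add h3 using 1
  ext p
  simp only [redAmp, Pi.add_apply]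
  ring

/-- Scale-dependent linear combinations of the observables of a mode whose rescaled amplitudes have
non-degenerate limits; `ε` marks combinations which lose all their norm in the limit. -/
structure Frame (ν : ℝ) (c₀ c₁ : ℂ) (A : ModePair) where
  h : Fin 2 → Space3 → ℝ
  θ : Fin 2 → ℝ
  ε : Fin 2 → ℝ
  T : ℝ → Matrix (Fin 2) (Fin 2) ℝ
  strong : Strong (h 0)
  tame : ∀ i, Tame (h i)
  supp : ∀ i x, h i x ≠ 0 → ∃ j, (A j).g x ≠ 0 ∨ (A j).f x ≠ 0
  θ_zero : θ 0 = 0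
  memLp_θ : θ 1 ≠ 0 → MemLp (fun p => ((‖p‖ ^ (2 - ν) : ℝ) : ℂ) * hat (h 0) p) 2 volume
  det_ne : ∀ᶠ L in atTop, (T L).det ≠ 0
  -- The exponent 3 is attained in the fully proportional case. It is affordable because the squared
  -- covariance scale `L^{4ν+2}` outgrows `L⁶` for `ν > 1`.
  det_le : ∃ C : ℝ, ∀ᶠ L in atTop, |(T L).det| ≤ C * L ^ 3
  ε_zero : ε 0 = 0
  limit : ∀ i,
    (ε i = 0 ∧ Dominated (fun L p => ∑ j, (T L i j : ℂ) * redAmp ν L (A j) p)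
      (fun p => ((‖p‖ ^ (-ν) : ℝ) : ℂ) * symb c₀ (θ i * c₁) (h i) (h 0) p)) ∨
    (ε i = 1 ∧ θ i = 0 ∧ h i = 0 ∧
      (∀ᶠ L in atTop, (fun p => ∑ j, (T L i j : ℂ) * redAmp ν L (A j) p) = roughAmp ν (h 0) L) ∧
      ¬ MemLp (fun p => ((‖p‖ ^ (2 - ν) : ℝ) : ℂ) * hat (h 0) p) 2 volume)
  indep : ∀ x : Fin 2 → ℝ,
    (∀ᵐ p, ∑ i, (x i : ℂ) * (((‖p‖ ^ (-ν) : ℝ) : ℂ) * symb c₀ (θ i * c₁) (h i) (h 0) p) = 0) →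
      (∑ i, ε i * x i ^ 2 = 0) → x = 0

end BunchDavies

namespace BunchDavies

/-! ### Separation of supports -/

/-- The region in which a mode is supported. -/
def modeRegion (A : ModePair) : Set Space3 := (A 0).region ∪ (A 1).region

theorem subset_modeRegion (A : ModePair) {x : Space3} {j : Fin 2}
    (h : (A j).g x ≠ 0 ∨ (A j).f x ≠ 0) : x ∈ modeRegion A := by
  have h1 : x ∈ (A j).region := by
    rcases h with h | h
    · exact Or.inl (subset_tsupport _ h)
    · exact Or.inr (subset_tsupport _ h)
  fin_cases j
  · exact Or.inl h1
  · exact Or.inr h1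

theorem isCompact_modeRegion {A : ModePair} (hA : A.IsSingleMode) : IsCompact (modeRegion A) := by
  have h : ∀ i, IsCompact (A i).region := fun i =>
    (hA.admissible i).compact_g.isCompact.union (hA.admissible i).compact_f.isCompact
  exact (h 0).union (h 1)

theorem admissible_translate {γ : PhaseVec} (h : γ.Admissible) (d : Space3) :
    HasCompactSupport (γ.translate d).g ∧ HasCompactSupport (γ.translate d).f :=
  ⟨h.compact_g.comp_homeomorph (Homeomorph.subRight d),
    h.compact_f.comp_homeomorph (Homeomorph.subRight d)⟩

theorem isCompact_modeRegion_translate {B : ModePair} (hB : B.IsSingleMode) (d : Space3) :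
    IsCompact (modeRegion (B.translate d)) := by
  have h : ∀ i, IsCompact ((B.translate d) i).region := fun i =>
    ((admissible_translate (hB.admissible i) d).1.isCompact).union
      ((admissible_translate (hB.admissible i) d).2.isCompact)
  exact (h 0).union (h 1)

theorem disjoint_modeRegion {A B : ModePair} (h : A.NonOverlapping B) :
    Disjoint (modeRegion A) (modeRegion B) := by
  simp only [modeRegion, Set.disjoint_union_left, Set.disjoint_union_right]
  exact ⟨⟨h 0 0, h 1 0⟩, h 0 1, h 1 1⟩

theorem exists_separated {K K' : Set Space3} (hK : IsCompact K) (hK' : IsCompact K')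
    (hdis : Disjoint K K') (d : Space3) : ∃ δ : ℝ, 0 < δ ∧ ∀ h h' : Space3 → ℝ,
      (∀ x, h x ≠ 0 → x ∈ K) → (∀ y, h' y ≠ 0 → y + d ∈ K') → Separated h h' d δ := by
  obtain ⟨r, hr, h⟩ := Metric.exists_pos_forall_lt_edist hK hK'.isClosed hdis
  refine ⟨r, by exact_mod_cast hr, fun h1 h2 hs hs' x y hx hy => ?_⟩
  have h3 := h x (hs x hx) (y + d) (hs' y hy)
  rw [edist_nndist, ENNReal.coe_lt_coe] at h3
  have h4 : (r : ℝ) < dist x (y + d) := by exact_mod_cast h3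
  rw [dist_eq_norm, ← sub_sub] at h4
  exact h4.le

namespace Frame

variable {ν K : ℝ} {c₀ c₁ : ℂ} {A B : ModePair}

/-- The rescaled amplitudes of a frame. -/
def amp (F : Frame ν c₀ c₁ A) (L : ℝ) (i : Fin 2) (p : Space3) : ℂ :=
  ∑ j, (F.T L i j : ℂ) * redAmp ν L (A j) p

/-- The limiting amplitudes of a frame. -/
def lim (F : Frame ν c₀ c₁ A) (i : Fin 2) (p : Space3) : ℂ :=
  ((‖p‖ ^ (-ν) : ℝ) : ℂ) * symb c₀ (F.θ i * c₁) (F.h i) (F.h 0) p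

theorem ε_nonneg (F : Frame ν c₀ c₁ A) (i : Fin 2) : 0 ≤ F.ε i := by
  rcases F.limit i with h | h <;> rw [h.1]
  exact zero_le_one

theorem lim_eq_zero (F : Frame ν c₀ c₁ A) {i : Fin 2} (h1 : F.θ i = 0) (h2 : F.h i = 0) :
    F.lim i = 0 := by
  ext p
  simp [lim, symb, h1, h2, hat_zero_left]

theorem memLp_lim (F : Frame ν c₀ c₁ A) (i : Fin 2) : MemLp (F.lim i) 2 volume := by
  rcases F.limit i with h | h
  · exact h.2.memLp
  · rw [F.lim_eq_zero h.2.1 h.2.2.1]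
    exact MemLp.zero

theorem dominated_or_escaping (H : HankelData ν K c₀ c₁) (F : Frame ν c₀ c₁ A) (i : Fin 2) :
    (F.ε i = 0 ∧ Dominated (fun L => F.amp L i) (F.lim i)) ∨
    (F.ε i = 1 ∧ F.lim i = 0 ∧ (∀ᶠ L in atTop, F.amp L i = roughAmp ν (F.h 0) L) ∧
      ¬ MemLp (fun p => ((‖p‖ ^ (2 - ν) : ℝ) : ℂ) * hat (F.h 0) p) 2 volume ∧
      Escaping (roughAmp ν (F.h 0))) := by
  rcases F.limit i with h | h
  · exact Or.inl ⟨h.1, h.2⟩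
  · exact Or.inr ⟨h.1, F.lim_eq_zero h.2.1 h.2.2.1, h.2.2.2.1, h.2.2.2.2,
      H.escaping_roughAmp F.strong h.2.2.2.2⟩

theorem tendsto_re {f : ℝ → ℂ} {c : ℂ} {r : ℝ} (h : Tendsto f atTop (𝓝 c)) (hr : c.re = r) :
    Tendsto (fun L => (f L).re) atTop (𝓝 r) :=
  hr ▸ (Complex.continuous_re.tendsto c).comp h

/-- Two dominated amplitudes converge under the integral, and a dominated one decouples from an
escaping one. Two escaping ones can only be the same amplitude, since `ε 0 = 0`, and their overlap
is the norm 1 recorded by the diagonal term. -/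
theorem tendsto_overlap_self (H : HankelData ν K c₀ c₁) (F : Frame ν c₀ c₁ A) :
    Tendsto (fun L => overlap (F.amp L) (F.amp L)) atTop
      (𝓝 (overlap F.lim F.lim + Matrix.diagonal F.ε)) := by
  refine tendsto_pi_nhds.2 fun i => tendsto_pi_nhds.2 fun j => ?_
  have hz := F.ε_zero
  simp only [overlap, Matrix.of_apply, Matrix.add_apply]
  rcases F.dominated_or_escaping H i with hi | ⟨hi1, hi2, hi3, hi4, hi5⟩ <;>
  rcases F.dominated_or_escaping H j with hj | ⟨hj1, hj2, hj3, hj4, hj5⟩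
  · refine tendsto_re (hi.2.tendsto_integral hj.2) ?_
    have : Matrix.diagonal F.ε i j = 0 := by
      rcases eq_or_ne i j with rfl | h
      · rw [Matrix.diagonal_apply_eq, hi.1]
      · exact Matrix.diagonal_apply_ne _ h
    rw [this, add_zero]
  · have hij : i ≠ j := by rintro rfl; linarith [hi.1]
    refine (tendsto_re (hi.2.tendsto_integral_escaping hj5) ?_).congr' ?_
    · rw [Matrix.diagonal_apply_ne _ hij, hj2]; simp
    · filter_upwards [hj3] with L h; rw [h]
  · have hij : i ≠ j := by rintro rfl; linarith [hj.1]
    refine (tendsto_re (hi5.tendsto_integral_dominated hj.2) ?_).congr' ?_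
    · rw [Matrix.diagonal_apply_ne _ hij, hi2]; simp
    · filter_upwards [hi3] with L h; rw [h]
  · have hij : i = j := by
      have h0 : ∀ k : Fin 2, F.ε k = 1 → k = 1 := by
        intro k hk
        fin_cases k
        · rw [Fin.zero_eta, hz] at hk; norm_num at hk
        · rfl
      rw [h0 i hi1, h0 j hj1]
    subst hij
    have := hi5.tendsto_integral_self
    rw [Matrix.diagonal_apply_eq, hi1, hi2]
    simp only [Pi.zero_apply, zero_mul, integral_zero, Complex.zero_re, zero_add]
    refine this.congr' ?_
    filter_upwards [hi3] with L h; rw [h]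

/-- Multiplication of a family of amplitudes by the phase of a displacement. -/
def shift (d : Space3) {ι : Type*} (V : ι → Space3 → ℂ) (i : ι) (p : Space3) : ℂ :=
  Complex.exp (Complex.I * ((inner ℝ p d : ℝ) : ℂ)) * V i p

theorem mem_region (F : Frame ν c₀ c₁ A) (i : Fin 2) (x : Space3) (hx : F.h i x ≠ 0) :
    x ∈ modeRegion A := by
  obtain ⟨j, hj⟩ := F.supp i x hx
  exact subset_modeRegion A hj

theorem mem_region_translate (F : Frame ν c₀ c₁ A) (d : Space3) (i : Fin 2) (x : Space3)
    (hx : F.h i (x - d) ≠ 0) : x ∈ modeRegion (A.translate d) := by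
  obtain ⟨j, hj⟩ := F.supp i _ hx
  exact subset_modeRegion (A.translate d) (j := j) hj

/-- Disjointness of the supports is needed only for a pair of escaping amplitudes; in the other
cases domination suffices. -/
theorem tendsto_overlap_shift (H : HankelData ν K c₀ c₁) (hA : A.IsSingleMode)
    (hB : B.IsSingleMode) (F : Frame ν c₀ c₁ A) (G : Frame ν c₀ c₁ B) {d : Space3}
    (hd : A.NonOverlapping (B.translate d)) :
    Tendsto (fun L => overlap (F.amp L) (shift d (G.amp L))) atTop
      (𝓝 (overlap F.lim (shift d G.lim))) := by
  refine tendsto_pi_nhds.2 fun i => tendsto_pi_nhds.2 fun j => ?_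
  simp only [overlap, Matrix.of_apply, shift]
  rcases F.dominated_or_escaping H i with hi | ⟨hi1, hi2, hi3, hi4, hi5⟩ <;>
  rcases G.dominated_or_escaping H j with hj | ⟨hj1, hj2, hj3, hj4, hj5⟩
  · exact tendsto_re (hi.2.tendsto_integral (hj.2.phase d)) rfl
  · refine (tendsto_re (hi.2.tendsto_integral_escaping (hj5.phase d)) ?_).congr' ?_
    · rw [hj2]; simp
    · filter_upwards [hj3] with L h; rw [h]
  · refine (tendsto_re (hi5.tendsto_integral_dominated (hj.2.phase d)) ?_).congr' ?_
    · rw [hi2]; simp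
    · filter_upwards [hi3] with L h; rw [h]
  · refine (tendsto_re (H.tendsto_integral_roughAmp F.strong G.strong hi4 hj4
      (isCompact_modeRegion hA) (isCompact_modeRegion_translate hB d) (disjoint_modeRegion hd)
      (F.mem_region 0) (G.mem_region_translate d 0)) ?_).congr' ?_
    · rw [hi2]; simp
    · filter_upwards [hi3, hj3] with L h h'; rw [h, h']

/-! ### Non-degeneracy of the limit -/

theorem sum_lim (F : Frame ν c₀ c₁ A) (x : Fin 2 → ℝ) (p : Space3) :
    ∑ i, (x i : ℂ) * F.lim i p = ((‖p‖ ^ (-ν) : ℝ) : ℂ) *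
      symb c₀ ((x 1 * F.θ 1 : ℝ) * c₁) (fun z => x 0 * F.h 0 z + x 1 * F.h 1 z) (F.h 0) p := by
  simp only [lim, symb, Fin.sum_univ_two, F.θ_zero]
  rw [hat_lincomb (F.tame 0).1 (F.tame 1).1]
  push_cast; ring

theorem posDef_self (F : Frame ν c₀ c₁ A) :
    (overlap F.lim F.lim + Matrix.diagonal F.ε).PosDef :=
  posDef_overlap_add_diagonal F.memLp_lim F.ε_nonneg F.indep

theorem memLp_shift {ι : Type*} {V : ι → Space3 → ℂ} (hV : ∀ i, MemLp (V i) 2 volume) (d : Space3)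
    (i : ι) : MemLp (shift d V i) 2 volume := by
  refine (hV i).mono (AEStronglyMeasurable.mul (by fun_prop) (hV i).1) ?_
  filter_upwards with p
  rw [shift, norm_mul, norm_cexp_I_mul, one_mul]

theorem mem_of_lincomb_ne_zero {S : Set Space3} {u v : Space3 → ℝ} {τ : Space3 → Space3}
    (hu : ∀ x, u x ≠ 0 → τ x ∈ S) (hv : ∀ x, v x ≠ 0 → τ x ∈ S) (a b : ℝ) (x : Space3)
    (h : a * u x + b * v x ≠ 0) : τ x ∈ S := by
  by_cases h1 : u x = 0
  · refine hv x fun h2 => h ?_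
    rw [h1, h2]; ring
  · exact hu x h1

/-- The limiting covariance matrix of two modes. -/
def limitBlock (F : Frame ν c₀ c₁ A) (G : Frame ν c₀ c₁ B) (d : Space3) :
    Matrix (Fin 2 ⊕ Fin 2) (Fin 2 ⊕ Fin 2) ℝ :=
  Matrix.fromBlocks (overlap F.lim F.lim + Matrix.diagonal F.ε) (overlap F.lim (shift d G.lim))
    (overlap F.lim (shift d G.lim)).transpose (overlap G.lim G.lim + Matrix.diagonal G.ε)

theorem limitBlock_eq (F : Frame ν c₀ c₁ A) (G : Frame ν c₀ c₁ B) (d : Space3) :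
    limitBlock F G d = overlap (Sum.elim F.lim (shift d G.lim)) (Sum.elim F.lim (shift d G.lim)) +
      Matrix.diagonal (Sum.elim F.ε G.ε) := by
  have h : overlap G.lim G.lim = overlap (shift d G.lim) (shift d G.lim) :=
    (overlap_phase G.lim G.lim d).symm
  rw [limitBlock, h, ← fromBlocks_overlap]
  rw [show Matrix.diagonal (Sum.elim F.ε G.ε) = Matrix.fromBlocks (Matrix.diagonal F.ε) 0 0
    (Matrix.diagonal G.ε) from (Matrix.fromBlocks_diagonal _ _).symm, Matrix.fromBlocks_add]
  simp

/-- After division by `|p|^{-ν}`, a null vector equates the symbol of a distribution `a h - b Δg`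
supported in `A` with that of one supported in the displaced `B`. Both vanish by separation, and
independence within each frame finishes the argument. -/
theorem posDef_limitBlock (hA : A.IsSingleMode)
    (hB : B.IsSingleMode) (F : Frame ν c₀ c₁ A) (G : Frame ν c₀ c₁ B) {d : Space3}
    (hd : A.NonOverlapping (B.translate d)) : (limitBlock F G d).PosDef := by
  rw [limitBlock_eq]
  refine posDef_overlap_add_diagonal ?_ ?_ ?_
  · rintro (i | i)
    · exact F.memLp_lim i
    · exact memLp_shift G.memLp_lim d i
  · rintro (i | i)
    · exact F.ε_nonneg i
    · exact G.ε_nonneg i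
  intro x hx hε
  obtain ⟨δ, hδ, hsep⟩ := exists_separated (isCompact_modeRegion hA)
    (isCompact_modeRegion_translate hB d) (disjoint_modeRegion hd) d
  simp only [Fintype.sum_sum_type, Sum.elim_inl, Sum.elim_inr] at hx hε
  set a : Fin 2 → ℝ := fun i => x (Sum.inl i) with ha
  set b : Fin 2 → ℝ := fun i => x (Sum.inr i) with hb
  have hGs : ∀ p, ∑ i, (b i : ℂ) * shift d G.lim i p =
      Complex.exp (Complex.I * ((inner ℝ p d : ℝ) : ℂ)) * ∑ i, (b i : ℂ) * G.lim i p := by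
    intro p
    rw [Finset.mul_sum]
    refine Finset.sum_congr rfl fun i _ => ?_
    rw [shift]; ring
  have hGr : ∀ i y, G.h i y ≠ 0 → y + d ∈ modeRegion (B.translate d) := fun i y hy =>
    G.mem_region_translate d i (y + d) (by rwa [add_sub_cancel_right])
  have hFi := ((F.tame 0).lincomb (F.tame 1) (a 0) (a 1)).1
  have hGi := ((G.tame 0).lincomb (G.tame 1) (-b 0) (-b 1)).1
  have hFl : ∀ x, a 0 * F.h 0 x + a 1 * F.h 1 x ≠ 0 → x ∈ modeRegion A :=
    mem_of_lincomb_ne_zero (τ := id) (F.mem_region 0) (F.mem_region 1) _ _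
  have hGl : ∀ x, -b 0 * G.h 0 x + -b 1 * G.h 1 x ≠ 0 → x + d ∈ modeRegion (B.translate d) :=
    mem_of_lincomb_ne_zero (hGr 0) (hGr 1) _ _
  have hkey := symb_ae_eq_zero_of_separated (a := c₀) (a' := c₀) (b := (a 1 * F.θ 1 : ℝ) * c₁)
    (b' := (-b 1 * G.θ 1 : ℝ) * c₁) hFi (F.tame 0).1 hGi (G.tame 0).1 hδ
    (hsep _ _ hFl hGl) (hsep _ _ hFl (hGr 0))
    (hsep _ _ (F.mem_region 0) hGl) (hsep _ _ (F.mem_region 0) (hGr 0)) (by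
      filter_upwards [hx, ae_ne_zero] with p hp hp0
      have hpn : ((‖p‖ ^ (-ν) : ℝ) : ℂ) ≠ 0 := by
        exact_mod_cast (Real.rpow_pos_of_pos (norm_pos_iff.2 hp0) _).ne'
      rw [hGs, F.sum_lim] at hp
      have h2 := G.sum_lim (fun i => -b i) p
      have h3 : ∑ i, ((-b i : ℝ) : ℂ) * G.lim i p = -∑ i, (b i : ℂ) * G.lim i p := by
        rw [← Finset.sum_neg_distrib]
        refine Finset.sum_congr rfl fun i _ => ?_
        push_cast; ring
      rw [h3] at h2
      apply mul_left_cancel₀ hpn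
      rw [mul_left_comm _ (Complex.exp _), ← h2]
      linear_combination hp)
  have hF0 : ∀ᵐ p, ∑ i, (a i : ℂ) * F.lim i p = 0 := by
    filter_upwards [hkey] with p hp
    rw [F.sum_lim, hp, mul_zero]
  have hG0 : ∀ᵐ p, ∑ i, (b i : ℂ) * G.lim i p = 0 := by
    filter_upwards [hF0, hx] with p h1 h2
    rw [h1, zero_add, hGs] at h2
    exact (mul_eq_zero.1 h2).resolve_left (Complex.exp_ne_zero _)
  have hεF : 0 ≤ ∑ i, F.ε i * a i ^ 2 :=
    Finset.sum_nonneg fun i _ => mul_nonneg (F.ε_nonneg i) (sq_nonneg _)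
  have hεG : 0 ≤ ∑ i, G.ε i * b i ^ 2 :=
    Finset.sum_nonneg fun i _ => mul_nonneg (G.ε_nonneg i) (sq_nonneg _)
  have h1 := F.indep a hF0 (by linarith)
  have h2 := G.indep b hG0 (by linarith)
  ext i
  rcases i with i | i
  · exact congrFun h1 i
  · exact congrFun h2 i

end Frame

end BunchDavies

/-! ### The limit of the mutual information. -/

namespace BunchDavies

/-- Determinants of covariance matrices grow: `λ(L)² Δ(L) → ∞` for `λ ∝ L^{2ν+1}` when
`t(L)² Δ(L)` has a positive limit for some `t = O(L³)`. -/
theorem tendsto_det_atTop {ν k : ℝ} (hν : 1 < ν) (hk : 0 < k) {t Δ S : ℝ → ℝ} {S₀ : ℝ}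
    (hS₀ : 0 < S₀) (hS : Tendsto S atTop (𝓝 S₀)) (ht : ∀ᶠ L in atTop, t L ≠ 0)
    (hC : ∃ C : ℝ, ∀ᶠ L in atTop, |t L| ≤ C * L ^ 3)
    (hΔ : ∀ᶠ L in atTop, S L = t L ^ 2 * Δ L) :
    Tendsto (fun L => (k * L ^ (2 * ν + 1)) ^ 2 * Δ L) atTop atTop := by
  obtain ⟨C, hC⟩ := hC
  -- The exponent is `2(2ν + 1) - 6`, positive exactly because `ν > 1`.
  have h1 : Tendsto (fun L : ℝ => k ^ 2 / (|C| + 1) ^ 2 * (S₀ / 2) * L ^ (4 * ν - 4)) atTop atTop :=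
    (tendsto_rpow_atTop (by linarith)).const_mul_atTop (by positivity)
  refine tendsto_atTop_mono' _ ?_ h1
  filter_upwards [ht, hC, hΔ, hS.eventually (lt_mem_nhds (half_lt_self hS₀)),
    eventually_gt_atTop 0] with L h2 h3 h4 h5 hL
  have h6 : Δ L = S L / t L ^ 2 := by field_simp; linarith
  have h7 : t L ^ 2 ≤ ((|C| + 1) * L ^ 3) ^ 2 := by
    rw [← sq_abs]
    refine pow_le_pow_left₀ (abs_nonneg _) (h3.trans ?_) 2
    exact mul_le_mul_of_nonneg_right (by linarith [le_abs_self C]) (by positivity)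
  have ht2 : 0 < t L ^ 2 := by positivity
  have e : k ^ 2 / (|C| + 1) ^ 2 * (S₀ / 2) * L ^ (4 * ν - 4) =
      (k * L ^ (2 * ν + 1)) ^ 2 * ((S₀ / 2) / ((|C| + 1) * L ^ 3) ^ 2) := by
    have e1 : (L ^ (2 * ν + 1)) ^ 2 = L ^ (4 * ν - 4) * L ^ 6 := by
      rw [← Real.rpow_natCast, ← Real.rpow_natCast, ← Real.rpow_mul hL.le, ← Real.rpow_add hL]
      congr 1; push_cast; ring
    rw [mul_pow, e1]
    field_simp
  rw [e, h6]
  refine mul_le_mul_of_nonneg_left ?_ (by positivity)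
  exact div_le_div₀ (by linarith) h5.le ht2 h7

theorem covMatrix_dilate (q : ℝ) {R H : ℝ} (hR : 0 < R) (hH : 0 < H) (A B : ModePair) :
    covMatrix (q * H) H (A.dilate R) (B.dilate R) =
      (((2 * Real.pi) ^ 3)⁻¹ * (Real.pi / 2) * (R * H) ^ (2 * √(9 / 4 - q ^ 2) + 1)) •
        overlap (fun i => redAmp (√(9 / 4 - q ^ 2)) (R * H) (A i))
          (fun i => redAmp (√(9 / 4 - q ^ 2)) (R * H) (B i)) := by
  ext i j
  exact sigma_dilate q hR hH (A i) (B j)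

theorem redAmp_translate_pair (ν L : ℝ) (d : Space3) (B : ModePair) :
    (fun i => redAmp ν L (B.translate d i)) = Frame.shift d (fun i => redAmp ν L (B i)) := by
  ext i p
  exact redAmp_translate ν L d (B i) p

namespace Frame

variable {ν K : ℝ} {c₀ c₁ : ℂ} {A B : ModePair}

theorem overlap_amp (H : HankelData ν K c₀ c₁) (hA : A.IsSingleMode) (F : Frame ν c₀ c₁ A) {L : ℝ}
    (hL : 1 ≤ L) : overlap (F.amp L) (F.amp L) =
      F.T L * overlap (fun i => redAmp ν L (A i)) (fun i => redAmp ν L (A i)) *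
        (F.T L).transpose :=
  overlap_lincomb (fun i => H.memLp_redAmp (hA.admissible i) hL)
    (fun i => H.memLp_redAmp (hA.admissible i) hL) _ _

theorem overlap_amp_shift (H : HankelData ν K c₀ c₁) (hA : A.IsSingleMode) (hB : B.IsSingleMode)
    (F : Frame ν c₀ c₁ A) (G : Frame ν c₀ c₁ B) (d : Space3) {L : ℝ} (hL : 1 ≤ L) :
    overlap (F.amp L) (shift d (G.amp L)) =
      F.T L * overlap (fun i => redAmp ν L (A i)) (shift d fun i => redAmp ν L (B i)) *
        (G.T L).transpose := by
  rw [← overlap_lincomb (fun i => H.memLp_redAmp (hA.admissible i) hL)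
    (memLp_shift (fun i => H.memLp_redAmp (hB.admissible i) hL) d)]
  congr 1
  ext i p
  simp only [shift, amp, Finset.mul_sum]
  refine Finset.sum_congr rfl fun j _ => ?_
  ring

/-- The limit of the mutual information, as a function of the displacement. -/
def limitInfo (F : Frame ν c₀ c₁ A) (G : Frame ν c₀ c₁ B) (d : Space3) : ℝ :=
  -(1 / 2) * Real.logb 2 ((limitBlock F G d).det /
    ((overlap F.lim F.lim + Matrix.diagonal F.ε).det *
      (overlap G.lim G.lim + Matrix.diagonal G.ε).det))

theorem limitInfo_nonneg (hA : A.IsSingleMode) (hB : B.IsSingleMode) (F : Frame ν c₀ c₁ A)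
    (G : Frame ν c₀ c₁ B) {d : Space3} (hd : A.NonOverlapping (B.translate d)) :
    0 ≤ limitInfo F G d := by
  have h1 := posDef_limitBlock hA hB F G hd
  have h2 := det_fromBlocks_le_mul h1
  have h3 := mul_pos F.posDef_self.det_pos G.posDef_self.det_pos
  have h4 : Real.logb 2 ((limitBlock F G d).det /
    ((overlap F.lim F.lim + Matrix.diagonal F.ε).det *
      (overlap G.lim G.lim + Matrix.diagonal G.ε).det)) ≤ 0 :=
    Real.logb_nonpos (by norm_num) (div_nonneg h1.det_pos.le h3.le) (div_le_one_of_le₀ h2 h3.le)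
  rw [limitInfo]
  linarith

/-- The determinant quotient is computed in the frames, where every block converges; both the basis
changes and the common scale `k L^{2ν+1}` cancel from it. The single determinants must diverge in
the original basis, which is where the bound on `det T` enters. -/
theorem tendsto_gaussianMutualInfo_scaled (H : HankelData ν K c₀ c₁) (hA : A.IsSingleMode)
    (hB : B.IsSingleMode) (F : Frame ν c₀ c₁ A) (G : Frame ν c₀ c₁ B) {d : Space3}
    (hd : A.NonOverlapping (B.translate d)) {k : ℝ} (hk : 0 < k) :
    Tendsto (fun L : ℝ => gaussianMutualInfo
      ((k * L ^ (2 * ν + 1)) • overlap (fun i => redAmp ν L (A i)) (fun i => redAmp ν L (A i)))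
      ((k * L ^ (2 * ν + 1)) • overlap (fun i => redAmp ν L (B i)) (fun i => redAmp ν L (B i)))
      ((k * L ^ (2 * ν + 1)) • overlap (fun i => redAmp ν L (A i))
        (shift d fun i => redAmp ν L (B i)))) atTop (𝓝 (limitInfo F G d)) := by
  have hFp := F.posDef_self.det_pos
  have hGp := G.posDef_self.det_pos
  have hMp := (posDef_limitBlock hA hB F G hd).det_pos
  have hdet : ∀ {n : Type} [Fintype n] [DecidableEq n] {f : ℝ → Matrix n n ℝ} {M : Matrix n n ℝ},
      Tendsto f atTop (𝓝 M) → Tendsto (fun L => (f L).det) atTop (𝓝 M.det) :=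
    fun h => ((continuous_id.matrix_det).tendsto _).comp h
  have hSA := F.tendsto_overlap_self H
  have hSB := G.tendsto_overlap_self H
  have hSC := tendsto_overlap_shift H hA hB F G hd
  have hblock : Tendsto (fun L => Matrix.fromBlocks (overlap (F.amp L) (F.amp L))
      (overlap (F.amp L) (shift d (G.amp L))) (overlap (F.amp L) (shift d (G.amp L))).transpose
      (overlap (G.amp L) (G.amp L))) atTop (𝓝 (limitBlock F G d)) := by
    refine tendsto_pi_nhds.2 fun i => tendsto_pi_nhds.2 fun j => ?_
    rcases i with i | i <;> rcases j with j | j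
    · exact tendsto_pi_nhds.1 (tendsto_pi_nhds.1 hSA i) j
    · exact tendsto_pi_nhds.1 (tendsto_pi_nhds.1 hSC i) j
    · exact tendsto_pi_nhds.1 (tendsto_pi_nhds.1 hSC j) i
    · exact tendsto_pi_nhds.1 (tendsto_pi_nhds.1 hSB i) j
  have hfb : ∀ (s : ℝ) (P Q C : Matrix (Fin 2) (Fin 2) ℝ),
      Matrix.fromBlocks (s • P) (s • C) (s • C).transpose (s • Q) =
        s • Matrix.fromBlocks P C C.transpose Q := by
    intro s P Q C
    rw [Matrix.transpose_smul, Matrix.fromBlocks_smul]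
  refine tendsto_gaussianMutualInfo (div_pos hMp (mul_pos hFp hGp)) ?_ ?_ ?_ ?_
  · filter_upwards [eventually_ge_atTop 1] with L hL
    have h1 : overlap (fun i => redAmp ν L (B i)) (fun i => redAmp ν L (B i)) =
        overlap (shift d fun i => redAmp ν L (B i)) (shift d fun i => redAmp ν L (B i)) :=
      (overlap_phase _ _ d).symm
    rw [hfb, h1, fromBlocks_overlap]
    refine (posSemidef_overlap ?_).smul (by positivity)
    rintro (i | i)
    · exact H.memLp_redAmp (hA.admissible i) hL
    · exact memLp_shift (fun i => H.memLp_redAmp (hB.admissible i) hL) d i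
  · simp_rw [Matrix.det_smul, Fintype.card_fin]
    refine tendsto_det_atTop H.one_lt hk hFp (hdet hSA) F.det_ne F.det_le ?_
    filter_upwards [eventually_ge_atTop 1] with L hL
    rw [F.overlap_amp H hA hL, Matrix.det_mul, Matrix.det_mul, Matrix.det_transpose]
    ring
  · simp_rw [Matrix.det_smul, Fintype.card_fin]
    refine tendsto_det_atTop H.one_lt hk hGp (hdet hSB) G.det_ne G.det_le ?_
    filter_upwards [eventually_ge_atTop 1] with L hL
    rw [G.overlap_amp H hB hL, Matrix.det_mul, Matrix.det_mul, Matrix.det_transpose]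
    ring
  · refine ((hdet hblock).div ((hdet hSA).mul (hdet hSB)) (mul_pos hFp hGp).ne').congr' ?_
    filter_upwards [eventually_ge_atTop 1, F.det_ne, G.det_ne] with L hL h1 h2
    have hs : k * L ^ (2 * ν + 1) ≠ 0 := by positivity
    rw [Pi.div_apply]
    rw [hfb, Matrix.det_smul, Matrix.det_smul, Matrix.det_smul, F.overlap_amp H hA hL,
      G.overlap_amp H hB hL, overlap_amp_shift H hA hB F G d hL, det_fromBlocks_conj,
      Matrix.det_mul, Matrix.det_mul, Matrix.det_transpose, Matrix.det_mul, Matrix.det_mul,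
      Matrix.det_transpose]
    simp only [Fintype.card_fin, Fintype.card_sum]
    have e : ∀ s a b x y z : ℝ, s ≠ 0 → a ≠ 0 → b ≠ 0 →
        (a * b) ^ 2 * x / (a * y * a * (b * z * b)) = s ^ (2 + 2) * x / (s ^ 2 * y * (s ^ 2 * z)) := by
      intro s a b x y z hs ha hb
      rw [show (a * b) ^ 2 * x / (a * y * a * (b * z * b)) =
        (a * b) ^ 2 * x / ((a * b) ^ 2 * (y * z)) by ring,
        mul_div_mul_left _ _ (by positivity), show s ^ 2 * y * (s ^ 2 * z) =
        s ^ (2 + 2) * (y * z) by ring, mul_div_mul_left _ _ (by positivity)]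
    exact e _ _ _ _ _ _ hs h1 h2

theorem tendsto_mutualInfo {q : ℝ} (hν : ν = √(9 / 4 - q ^ 2)) (H : HankelData ν K c₀ c₁)
    (hA : A.IsSingleMode) (hB : B.IsSingleMode) (F : Frame ν c₀ c₁ A) (G : Frame ν c₀ c₁ B)
    {d : Space3} (hd : A.NonOverlapping (B.translate d)) :
    Tendsto (fun p : ℝ × ℝ =>
      mutualInfo (q * p.2) p.2 (A.dilate p.1) ((B.translate d).dilate p.1))
      superHubble (𝓝 (limitInfo F G d)) := by
  have hk : 0 < ((2 * Real.pi) ^ 3)⁻¹ * (Real.pi / 2) := by positivity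
  have h1 := tendsto_gaussianMutualInfo_scaled H hA hB F G hd hk
  have h2 : Tendsto (fun p : ℝ × ℝ => p.1 * p.2) superHubble atTop :=
    tendsto_comap.mono_left inf_le_left
  refine (h1.comp h2).congr' ?_
  have h3 : ∀ᶠ p in superHubble, 0 < p.1 ∧ 0 < p.2 :=
    eventually_inf_principal.2 (Eventually.of_forall fun p hp => hp)
  filter_upwards [h3] with p hp
  rw [Function.comp_apply, mutualInfo, covMatrix_dilate q hp.1 hp.2, covMatrix_dilate q hp.1 hp.2,
    covMatrix_dilate q hp.1 hp.2, ← hν, redAmp_translate_pair]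
  congr 2
  exact (overlap_phase _ _ d).symm

end Frame

end BunchDavies

namespace BunchDavies

/-! ### Correlations at large displacement -/

section Moments

variable {h h' : Space3 → ℝ}

theorem integrable_rpow_mul_norm_hat {s t : ℝ}
    (hs : MemLp (fun p => ((‖p‖ ^ s : ℝ) : ℂ) * hat h p) 2 volume)
    (ht : MemLp (fun p => ((‖p‖ ^ t : ℝ) : ℂ) * hat h' p) 2 volume) :
    Integrable (fun p => ‖p‖ ^ (s + t) * (‖hat h p‖ * ‖hat h' p‖)) := by
  refine (hs.norm.integrable_mul ht.norm).congr ?_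
  filter_upwards [ae_ne_zero] with p hp
  rw [Pi.mul_apply, norm_mul, norm_mul, Complex.norm_real, Complex.norm_real,
    Real.norm_of_nonneg (by positivity), Real.norm_of_nonneg (by positivity),
    Real.rpow_add (norm_pos_iff.2 hp)]
  ring

theorem integrable_rpow_mul_crossSpec (hh : Integrable h) (hh' : Integrable h') {s t : ℝ}
    (hs : MemLp (fun p => ((‖p‖ ^ s : ℝ) : ℂ) * hat h p) 2 volume)
    (ht : MemLp (fun p => ((‖p‖ ^ t : ℝ) : ℂ) * hat h' p) 2 volume) (d : Space3) :
    Integrable (fun p => ((‖p‖ ^ (s + t) : ℝ) : ℂ) * crossSpec h h' d p) := by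
  refine (integrable_rpow_mul_norm_hat hs ht).mono' ?_ ?_
  · exact ((Complex.measurable_ofReal.comp (measurable_norm.pow_const _)).mul
      (continuous_crossSpec hh hh' d).measurable).aestronglyMeasurable
  · filter_upwards with p
    rw [norm_mul, norm_crossSpec, Complex.norm_real, Real.norm_of_nonneg (by positivity)]

/-- The spectral integral `∫ |p|^s ĥ(p) conj (e^{ip·d} ĥ'(p))`. -/
def spectral (s : ℝ) (h h' : Space3 → ℝ) (d : Space3) : ℂ :=
  ∫ p : Space3, ((‖p‖ ^ s : ℝ) : ℂ) * crossSpec h h' d p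

theorem tendsto_norm_rpow_cobounded {a : ℝ} (ha : 0 < a) :
    Tendsto (fun d : Space3 => ‖d‖ ^ (-a)) (Bornology.cobounded Space3) (𝓝 0) :=
  (tendsto_rpow_neg_atTop ha).comp tendsto_norm_cobounded

/-- This is the Riesz kernel `|d|^{2ν-3}` of `|p|^{-2ν}`. It is the slowest decay among the four
spectral integrals and sets the normalisation of the others. -/
theorem tendsto_spectral_leading {ν : ℝ} (h1 : 1 < ν) (h2 : ν < 3 / 2) (hh : Integrable h)
    (hh' : Integrable h') {ρ : ℝ} (hρ : ∀ x, h x ≠ 0 → ‖x‖ ≤ ρ) (hρ' : ∀ x, h' x ≠ 0 → ‖x‖ ≤ ρ)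
    (hs : MemLp (fun p => ((‖p‖ ^ (-ν) : ℝ) : ℂ) * hat h p) 2 volume)
    (hs' : MemLp (fun p => ((‖p‖ ^ (-ν) : ℝ) : ℂ) * hat h' p) 2 volume) :
    Tendsto (fun d => ((‖d‖ ^ (3 - 2 * ν) : ℝ) : ℂ) * spectral (-ν + -ν) h h' d)
      (Bornology.cobounded Space3)
      (𝓝 (((Real.Gamma ν)⁻¹ * (rieszConst ν * ((∫ x, h x) * ∫ x, h' x)) : ℝ) : ℂ)) := by
  have hint := integrable_rpow_mul_norm_hat hs hs'
  rw [show -ν + -ν = -2 * ν by ring] at hint ⊢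
  have h3 := (tendsto_gaussMoment h2 hh hh' hρ hρ').const_mul (Real.Gamma ν)⁻¹
  refine ((Complex.continuous_ofReal.tendsto _).comp h3).congr fun d => ?_
  rw [spectral, integral_neg_rpow_crossSpec (by linarith) hh hh' d hint]
  simp only [Function.comp_apply]
  push_cast; ring

/-- The extra `|p|²` acts as a Laplacian on the kernel and improves the decay by `|d|⁻²`. The
exponent `2 - 2ν` is still negative, so the Γ-function representation applies with `τ = ν - 1`. -/
theorem tendsto_spectral_mixed {ν : ℝ} (h1 : 1 < ν) (h2 : ν < 3 / 2) (hh : Integrable h)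
    (hh' : Integrable h') {ρ : ℝ} (hρ : ∀ x, h x ≠ 0 → ‖x‖ ≤ ρ) (hρ' : ∀ x, h' x ≠ 0 → ‖x‖ ≤ ρ)
    {s t : ℝ} (hst : s + t = 2 - 2 * ν)
    (hs : MemLp (fun p => ((‖p‖ ^ s : ℝ) : ℂ) * hat h p) 2 volume)
    (hs' : MemLp (fun p => ((‖p‖ ^ t : ℝ) : ℂ) * hat h' p) 2 volume) :
    Tendsto (fun d => ((‖d‖ ^ (3 - 2 * ν) : ℝ) : ℂ) * spectral (s + t) h h' d)
      (Bornology.cobounded Space3) (𝓝 0) := by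
  have hint := integrable_rpow_mul_norm_hat hs hs'
  rw [hst, show 2 - 2 * ν = -2 * (ν - 1) by ring] at hint
  rw [hst, show 2 - 2 * ν = -2 * (ν - 1) by ring]
  have h3 := ((tendsto_norm_rpow_cobounded (a := 2) (by norm_num)).mul
    (tendsto_gaussMoment (σ := ν - 1) (by linarith) hh hh' hρ hρ')).const_mul
    (Real.Gamma (ν - 1))⁻¹
  rw [zero_mul, mul_zero] at h3
  have h4 := (Complex.continuous_ofReal.tendsto _).comp h3
  rw [Complex.ofReal_zero] at h4
  refine h4.congr' ?_
  filter_upwards [tendsto_norm_cobounded.eventually_gt_atTop 0] with d hd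
  rw [spectral, integral_neg_rpow_crossSpec (by linarith) hh hh' d hint, Function.comp_apply,
    show 3 - 2 * ν = -2 + (3 - 2 * (ν - 1)) by ring, Real.rpow_add hd]
  push_cast; ring

/-- Two factors `|p|²` improve the decay by `|d|⁻⁴`. The exponent `2(2 - ν)` is now positive, so
separated supports and the representation by `1 - exp(-t|p|²)` are needed. -/
theorem tendsto_spectral_high {ν : ℝ} (h1 : 1 < ν) (h2 : ν < 3 / 2) (hh : Integrable h)
    (hh' : Integrable h') {ρ : ℝ} (hρ : ∀ x, h x ≠ 0 → ‖x‖ ≤ ρ) (hρ' : ∀ x, h' x ≠ 0 → ‖x‖ ≤ ρ)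
    (hs0 : Integrable fun p => ‖hat h p‖ * ‖hat h' p‖)
    (hs : MemLp (fun p => ((‖p‖ ^ (2 - ν) : ℝ) : ℂ) * hat h p) 2 volume)
    (hs' : MemLp (fun p => ((‖p‖ ^ (2 - ν) : ℝ) : ℂ) * hat h' p) 2 volume) :
    Tendsto (fun d => ((‖d‖ ^ (3 - 2 * ν) : ℝ) : ℂ) * spectral (2 - ν + (2 - ν)) h h' d)
      (Bornology.cobounded Space3) (𝓝 0) := by
  have hint := integrable_rpow_mul_norm_hat hs hs'
  rw [show 2 - ν + (2 - ν) = 2 * (2 - ν) by ring] at hint ⊢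
  have h3 := ((tendsto_norm_rpow_cobounded (a := 4) (by norm_num)).mul
    (tendsto_gaussMoment (σ := -(2 - ν)) (by linarith) hh hh' hρ hρ')).const_mul
    (-(bernsteinConst (2 - ν))⁻¹)
  rw [zero_mul, mul_zero] at h3
  have h4 := (Complex.continuous_ofReal.tendsto _).comp h3
  rw [Complex.ofReal_zero] at h4
  refine h4.congr' ?_
  filter_upwards [tendsto_norm_cobounded.eventually_gt_atTop (max 0 (ρ + ρ + 1))] with d hd
  have hd0 : 0 < ‖d‖ := lt_of_le_of_lt (le_max_left _ _) hd
  have hd1 : ρ + ρ + 1 < ‖d‖ := lt_of_le_of_lt (le_max_right _ _) hd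
  have hsep : Separated h h' d 1 := by
    intro x y hx hy
    have h5 : ‖d‖ ≤ ‖x - y - d‖ + (‖x‖ + ‖y‖) := by
      have h6 := norm_sub_le (x - y) (x - y - d)
      rw [sub_sub_cancel] at h6
      have h7 := norm_sub_le x y
      linarith
    linarith [hρ x hx, hρ' y hy]
  rw [spectral, integral_pos_rpow_crossSpec (by linarith) (by linarith) hh hh' one_pos hsep hs0 hint,
    Function.comp_apply, show 3 - 2 * ν = -4 + (3 - 2 * -(2 - ν)) by ring, Real.rpow_add hd0]
  push_cast; ring

end Moments

namespace Frame

variable {ν K : ℝ} {c₀ c₁ : ℂ} {A B : ModePair}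

theorem memLp_θ' (F : Frame ν c₀ c₁ A) {i : Fin 2} (hi : F.θ i ≠ 0) :
    MemLp (fun p => ((‖p‖ ^ (2 - ν) : ℝ) : ℂ) * hat (F.h 0) p) 2 volume := by
  fin_cases i
  · exact absurd F.θ_zero hi
  · exact F.memLp_θ hi

theorem memLp_h (H : HankelData ν K c₀ c₁) (F : Frame ν c₀ c₁ A) (i : Fin 2) :
    MemLp (fun p => ((‖p‖ ^ (-ν) : ℝ) : ℂ) * hat (F.h i) p) 2 volume := by
  have := H.one_lt
  have := H.lt
  exact (F.tame i).memLp_rpow (by linarith) (by linarith)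

theorem memLp_hat (F : Frame ν c₀ c₁ A) : MemLp (hat (F.h 0)) 2 volume := by
  have h1 := integrable_rpow_mul_sq_hat F.strong.1 (s := 2 * 0) (t := 1) (by norm_num) (by norm_num)
    (by simpa using F.strong.2)
  rw [← memLp_rpow_mul_hat_iff F.strong.1] at h1
  simpa using h1

/-- The splits on `θ` are needed for integrability: `|p|^{2-ν} ĥ₀` is known to be square integrable
only when some `θ` is nonzero. -/
theorem integral_lim (H : HankelData ν K c₀ c₁) (F : Frame ν c₀ c₁ A) (G : Frame ν c₀ c₁ B)
    (i j : Fin 2) (d : Space3) :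
    ∫ p, F.lim i p * conj (shift d G.lim j p) =
      (c₀ * conj c₀) * spectral (-ν + -ν) (F.h i) (G.h j) d +
      (G.θ j * (c₀ * conj c₁)) * spectral (-ν + (2 - ν)) (F.h i) (G.h 0) d +
      (F.θ i * (c₁ * conj c₀)) * spectral ((2 - ν) + -ν) (F.h 0) (G.h j) d +
      (F.θ i * G.θ j * (c₁ * conj c₁)) * spectral ((2 - ν) + (2 - ν)) (F.h 0) (G.h 0) d := by
  have t1 := integrable_rpow_mul_crossSpec (F.tame i).1 (G.tame j).1 (F.memLp_h H i)
    (G.memLp_h H j) d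
  have i1 := t1.const_mul (c₀ * conj c₀)
  have i2 : Integrable fun p => (G.θ j * (c₀ * conj c₁)) *
      (((‖p‖ ^ (-ν + (2 - ν)) : ℝ) : ℂ) * crossSpec (F.h i) (G.h 0) d p) := by
    by_cases hj : G.θ j = 0
    · simp [hj]
    · exact (integrable_rpow_mul_crossSpec (F.tame i).1 (G.tame 0).1 (F.memLp_h H i)
        (G.memLp_θ' hj) d).const_mul _
  have i3 : Integrable fun p => (F.θ i * (c₁ * conj c₀)) *
      (((‖p‖ ^ ((2 - ν) + -ν) : ℝ) : ℂ) * crossSpec (F.h 0) (G.h j) d p) := by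
    by_cases hi : F.θ i = 0
    · simp [hi]
    · exact (integrable_rpow_mul_crossSpec (F.tame 0).1 (G.tame j).1 (F.memLp_θ' hi)
        (G.memLp_h H j) d).const_mul _
  have i4 : Integrable fun p => (F.θ i * G.θ j * (c₁ * conj c₁)) *
      (((‖p‖ ^ ((2 - ν) + (2 - ν)) : ℝ) : ℂ) * crossSpec (F.h 0) (G.h 0) d p) := by
    by_cases hi : F.θ i = 0
    · simp [hi]
    by_cases hj : G.θ j = 0
    · simp [hj]
    exact (integrable_rpow_mul_crossSpec (F.tame 0).1 (G.tame 0).1 (F.memLp_θ' hi)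
        (G.memLp_θ' hj) d).const_mul _
  rw [spectral, spectral, spectral, spectral, ← integral_const_mul, ← integral_const_mul,
    ← integral_const_mul, ← integral_const_mul, ← integral_add i1 i2, ← integral_add (i1.fun_add i2) i3,
    ← integral_add ((i1.fun_add i2).fun_add i3) i4]
  refine integral_congr_ae ?_
  filter_upwards [ae_ne_zero] with p hp
  have hp0 : 0 < ‖p‖ := norm_pos_iff.2 hp
  have e : ‖p‖ ^ (2 - ν) = ‖p‖ ^ (-ν) * ‖p‖ ^ 2 := by
    rw [← Real.rpow_natCast, ← Real.rpow_add hp0]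
    congr 1; push_cast; ring
  simp only [lim, shift, symb, crossSpec, map_mul, map_add, Complex.conj_ofReal,
    Real.rpow_add hp0, e]
  push_cast; ring

/-- The coefficient of the leading correlations. -/
def leadConst (ν : ℝ) (c₀ : ℂ) : ℝ := ‖c₀‖ ^ 2 * ((Real.Gamma ν)⁻¹ * rieszConst ν)

theorem leadConst_pos (H : HankelData ν K c₀ c₁) : 0 < leadConst ν c₀ := by
  have h1 := rieszConst_pos H.lt
  have h2 := Real.Gamma_pos_of_pos (by linarith [H.one_lt] : 0 < ν)
  have h3 := norm_pos_iff.2 H.ne₀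
  rw [leadConst]; positivity

/-- Every term containing a factor `|p|²` decays faster. At leading order the kernel is constant
over the supports, so only the averages of the profiles remain and the limit has rank one. -/
theorem tendsto_scaled_overlap (H : HankelData ν K c₀ c₁) (hA : A.IsSingleMode)
    (hB : B.IsSingleMode) (F : Frame ν c₀ c₁ A) (G : Frame ν c₀ c₁ B) :
    Tendsto (fun d => ‖d‖ ^ (3 - 2 * ν) • overlap F.lim (shift d G.lim))
      (Bornology.cobounded Space3)
      (𝓝 (leadConst ν c₀ • Matrix.vecMulVec (fun i => ∫ x, F.h i x) fun j => ∫ x, G.h j x)) := by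
  obtain ⟨ρ, hρ⟩ := (isCompact_modeRegion hA).isBounded.exists_norm_le
  obtain ⟨ρ', hρ'⟩ := (isCompact_modeRegion hB).isBounded.exists_norm_le
  have hF : ∀ i x, F.h i x ≠ 0 → ‖x‖ ≤ max ρ ρ' := fun i x hx =>
    (hρ x (F.mem_region i x hx)).trans (le_max_left _ _)
  have hG : ∀ i x, G.h i x ≠ 0 → ‖x‖ ≤ max ρ ρ' := fun i x hx =>
    (hρ' x (G.mem_region i x hx)).trans (le_max_right _ _)
  refine tendsto_pi_nhds.2 fun i => tendsto_pi_nhds.2 fun j => ?_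
  have l1 := (tendsto_spectral_leading H.one_lt H.lt (F.tame i).1 (G.tame j).1 (hF i) (hG j)
    (F.memLp_h H i) (G.memLp_h H j)).const_mul (c₀ * conj c₀)
  have l2 : Tendsto (fun d => (G.θ j * (c₀ * conj c₁)) * (((‖d‖ ^ (3 - 2 * ν) : ℝ) : ℂ) *
      spectral (-ν + (2 - ν)) (F.h i) (G.h 0) d)) (Bornology.cobounded Space3) (𝓝 0) := by
    by_cases hj : G.θ j = 0
    · simp [hj]
    · simpa using (tendsto_spectral_mixed H.one_lt H.lt (F.tame i).1 (G.tame 0).1 (hF i) (hG 0)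
        (by ring) (F.memLp_h H i) (G.memLp_θ' hj)).const_mul (G.θ j * (c₀ * conj c₁))
  have l3 : Tendsto (fun d => (F.θ i * (c₁ * conj c₀)) * (((‖d‖ ^ (3 - 2 * ν) : ℝ) : ℂ) *
      spectral ((2 - ν) + -ν) (F.h 0) (G.h j) d)) (Bornology.cobounded Space3) (𝓝 0) := by
    by_cases hi : F.θ i = 0
    · simp [hi]
    · simpa using (tendsto_spectral_mixed H.one_lt H.lt (F.tame 0).1 (G.tame j).1 (hF 0) (hG j)
        (by ring) (F.memLp_θ' hi) (G.memLp_h H j)).const_mul (F.θ i * (c₁ * conj c₀))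
  have l4 : Tendsto (fun d => (F.θ i * G.θ j * (c₁ * conj c₁)) * (((‖d‖ ^ (3 - 2 * ν) : ℝ) : ℂ) *
      spectral ((2 - ν) + (2 - ν)) (F.h 0) (G.h 0) d)) (Bornology.cobounded Space3) (𝓝 0) := by
    by_cases hi : F.θ i = 0
    · simp [hi]
    by_cases hj : G.θ j = 0
    · simp [hj]
    simpa using (tendsto_spectral_high H.one_lt H.lt (F.tame 0).1 (G.tame 0).1 (hF 0) (hG 0)
        (F.memLp_hat.norm.integrable_mul G.memLp_hat.norm)
        (F.memLp_θ' hi) (G.memLp_θ' hj)).const_mul (F.θ i * G.θ j * (c₁ * conj c₁))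
  have hall := (Complex.continuous_re.tendsto _).comp (((l1.add l2).add l3).add l4)
  convert! hall using 1
  · ext d
    rw [Function.comp_apply, Matrix.smul_apply, overlap, Matrix.of_apply, integral_lim H,
      smul_eq_mul, ← Complex.re_ofReal_mul]
    congr 1
    ring
  · congr 1
    rw [add_zero, add_zero, add_zero, Complex.mul_conj, Complex.normSq_eq_norm_sq,
      ← Complex.ofReal_mul, Complex.ofReal_re, Matrix.smul_apply, Matrix.vecMulVec_apply, leadConst,
      smul_eq_mul]
    ring

end Frame

end BunchDavies

/-- A function `-log₂(1 - u)` is asymptotic to `u / log 2` as `u → 0`. -/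
theorem isEquivalent_neg_logb {ι : Type*} {l : Filter ι} {u : ι → ℝ} (hu : Tendsto u l (𝓝 0)) :
    (fun i => -Real.logb 2 (1 - u i)) ~[l] fun i => u i / Real.log 2 := by
  have h1 : HasDerivAt (fun x : ℝ => -Real.log (1 - x)) 1 0 := by
    have h2 : HasDerivAt (fun x : ℝ => 1 - x) (-1) 0 := by
      simpa using (hasDerivAt_id (0 : ℝ)).const_sub 1
    exact (h2.log (by norm_num)).neg.congr_deriv (by norm_num)
  have h2 : (fun x : ℝ => -Real.log (1 - x)) ~[𝓝 0] fun x => x := by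
    have h3 := h1.isLittleO
    simp only [sub_zero, Real.log_one, neg_zero, smul_eq_mul, mul_one] at h3
    exact h3
  have h3 := (h2.comp_tendsto hu).div (IsEquivalent.refl (u := fun _ : ι => Real.log 2))
  refine h3.congr_left (Eventually.of_forall fun i => ?_)
  simp [Real.logb, neg_div]

/-- The adjugate of a 2×2 matrix is its conjugate by a quarter turn for symmetric matrices, so the
expression is the form of `S` at the rotated vector `(-a₁, a₀)`. -/
theorem adjugate_quadratic_pos {S : Matrix (Fin 2) (Fin 2) ℝ} (hS : S.PosDef) {a : Fin 2 → ℝ}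
    (ha : a 0 ≠ 0) : 0 < S 1 1 * a 0 ^ 2 - (S 0 1 + S 1 0) * (a 0 * a 1) + S 0 0 * a 1 ^ 2 := by
  have h := hS.dotProduct_mulVec_pos (x := ![-a 1, a 0]) (by
    intro h
    exact ha (by simpa using congrFun h 1))
  simp [Matrix.mulVec, dotProduct, Fin.sum_univ_two] at h
  linarith

theorem trace_adjugate_vecMulVec (S T : Matrix (Fin 2) (Fin 2) ℝ) (a b : Fin 2 → ℝ) (k : ℝ) :
    (S.adjugate * (k • Matrix.vecMulVec a b) * T.adjugate *
      (k • Matrix.vecMulVec a b).transpose).trace =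
      k ^ 2 * ((S 1 1 * a 0 ^ 2 - (S 0 1 + S 1 0) * (a 0 * a 1) + S 0 0 * a 1 ^ 2) *
        (T 1 1 * b 0 ^ 2 - (T 0 1 + T 1 0) * (b 0 * b 1) + T 0 0 * b 1 ^ 2)) := by
  rw [Matrix.adjugate_fin_two, Matrix.adjugate_fin_two]
  simp only [Matrix.trace_fin_two, Matrix.mul_apply, Fin.sum_univ_two, Matrix.of_apply,
    Matrix.smul_apply, Matrix.transpose_apply, Matrix.vecMulVec_apply, smul_eq_mul,
    Matrix.cons_val', Matrix.cons_val_zero, Matrix.cons_val_one, Matrix.cons_val_fin_one]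
  ring

theorem trace_mul_smul_mul (P Q M : Matrix (Fin 2) (Fin 2) ℝ) (s : ℝ) :
    (P * (s • M) * Q * (s • M).transpose).trace = s ^ 2 * (P * M * Q * M.transpose).trace := by
  simp only [Matrix.mul_smul, Matrix.smul_mul, Matrix.transpose_smul, Matrix.trace_smul, smul_eq_mul]
  ring

/-! ### Long-distance expansion of the limiting mutual information. -/

namespace BunchDavies.Frame

variable {ν K : ℝ} {c₀ c₁ : ℂ} {A B : ModePair}

/-- Long-distance behaviour of the limiting mutual information. -/
theorem limitInfo_asymptotics (H : HankelData ν K c₀ c₁) (hA : A.IsSingleMode)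
    (hB : B.IsSingleMode) (F : Frame ν c₀ c₁ A) (G : Frame ν c₀ c₁ B)
    (ha : ∫ x, F.h 0 x ≠ 0) (hb : ∫ x, G.h 0 x ≠ 0) :
    ∃ β : ℝ, 0 < β ∧
      (∀ᶠ d in Bornology.cobounded Space3, 0 < β * ‖d‖ ^ (-4 * (3 / 2 - ν)) ∧
        β * ‖d‖ ^ (-4 * (3 / 2 - ν)) < 1) ∧
      limitInfo F G ~[Bornology.cobounded Space3]
        fun d => -Real.logb 2 (1 - β * ‖d‖ ^ (-4 * (3 / 2 - ν))) := by
  have hν := H.lt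
  have hFp := F.posDef_self
  have hGp := G.posDef_self
  set S := overlap F.lim F.lim + Matrix.diagonal F.ε with hS
  set T := overlap G.lim G.lim + Matrix.diagonal G.ε with hT
  set a : Fin 2 → ℝ := fun i => ∫ x, F.h i x with ha'
  set b : Fin 2 → ℝ := fun i => ∫ x, G.h i x with hb'
  set k := leadConst ν c₀ with hk'
  have hk : 0 < k := leadConst_pos H
  have hdet : 0 < S.det * T.det := mul_pos hFp.det_pos hGp.det_pos
  set q₀ := (S.adjugate * (k • Matrix.vecMulVec a b) * T.adjugate *
      (k • Matrix.vecMulVec a b).transpose).trace / (S.det * T.det) with hq₀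
  -- For a rank-one block the trace factorises into the adjugate forms of `S` and `T` at the two
  -- vectors of averages, both nonzero by assumption.
  have hq : 0 < q₀ := by
    rw [hq₀, trace_adjugate_vecMulVec]
    have h1 := adjugate_quadratic_pos hFp (a := a) ha
    have h2 := adjugate_quadratic_pos hGp (a := b) hb
    positivity
  set Γ : Space3 → Matrix (Fin 2) (Fin 2) ℝ := fun d => overlap F.lim (shift d G.lim) with hΓ
  set Γs : Space3 → Matrix (Fin 2) (Fin 2) ℝ := fun d => ‖d‖ ^ (3 - 2 * ν) • Γ d with hΓs
  have hlim : Tendsto Γs (Bornology.cobounded Space3) (𝓝 (k • Matrix.vecMulVec a b)) :=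
    tendsto_scaled_overlap H hA hB F G
  set t : Space3 → ℝ := fun d => ‖d‖ ^ (-4 * (3 / 2 - ν)) with ht
  have ht0 : Tendsto t (Bornology.cobounded Space3) (𝓝 0) := by
    have := tendsto_norm_rpow_cobounded (a := 4 * (3 / 2 - ν)) (by linarith)
    simpa only [ht, neg_mul] using this
  set y : Space3 → ℝ := fun d => ((S.adjugate * Γs d * T.adjugate * (Γs d).transpose).trace -
    t d * (Γs d).det ^ 2) / (S.det * T.det) with hy
  have hylim : Tendsto y (Bornology.cobounded Space3) (𝓝 q₀) := by
    have h1 : Tendsto (fun d => (S.adjugate * Γs d * T.adjugate * (Γs d).transpose).trace)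
        (Bornology.cobounded Space3) (𝓝 (S.adjugate * (k • Matrix.vecMulVec a b) * T.adjugate *
          (k • Matrix.vecMulVec a b).transpose).trace) := by
      have hc : Continuous fun M : Matrix (Fin 2) (Fin 2) ℝ =>
          (S.adjugate * M * T.adjugate * M.transpose).trace := by fun_prop
      exact (hc.tendsto _).comp hlim
    have h2 : Tendsto (fun d => (Γs d).det) (Bornology.cobounded Space3) (𝓝 _) :=
      ((continuous_id.matrix_det).tendsto _).comp hlim
    have h3 := (h1.sub (ht0.mul (h2.pow 2))).div_const (S.det * T.det)
    simpa only [zero_mul, sub_zero] using h3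
  -- The quadratic term in the cross block is of order `t = |d|^{-2(3-2ν)} = |d|^{-4μ²}`, and the
  -- squared determinant is of order `t²`.
  have hratio : ∀ᶠ d in Bornology.cobounded Space3,
      (limitBlock F G d).det / (S.det * T.det) = 1 - t d * y d := by
    filter_upwards [tendsto_norm_cobounded.eventually_gt_atTop 0] with d hd
    have e1 : Γ d = ‖d‖ ^ (-(3 - 2 * ν)) • Γs d := by
      rw [hΓs, smul_smul, ← Real.rpow_add hd]; simp
    have e2 : t d = (‖d‖ ^ (-(3 - 2 * ν))) ^ 2 := by
      rw [← Real.rpow_natCast, ← Real.rpow_mul hd.le, ht]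
      simp only
      congr 1; push_cast; ring
    have e3 : (limitBlock F G d).det = S.det * T.det -
        (S.adjugate * Γ d * T.adjugate * (Γ d).transpose).trace + (Γ d).det ^ 2 :=
      det_fromBlocks_fin_two S T (Γ d)
    rw [e3, e1, Matrix.det_smul, trace_mul_smul_mul, hy]
    simp only [Fintype.card_fin, e2]
    have hS0 : S.det ≠ 0 := hFp.det_pos.ne'
    have hT0 : T.det ≠ 0 := hGp.det_pos.ne'
    field_simp
    ring
  have hx0 : Tendsto (fun d => t d * y d) (Bornology.cobounded Space3) (𝓝 0) := by
    simpa using ht0.mul hylim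
  have hβ0 : Tendsto (fun d => q₀ / 2 * t d) (Bornology.cobounded Space3) (𝓝 0) := by
    simpa using ht0.const_mul (q₀ / 2)
  -- The prefactor `½` in the limiting information halves `q₀`. Both sides are compared with `q₀ t /
  -- (2 log 2)`.
  refine ⟨q₀ / 2, by positivity, ?_, ?_⟩
  · filter_upwards [hβ0.eventually_lt_const one_pos,
      tendsto_norm_cobounded.eventually_gt_atTop 0] with d h1 hd
    exact ⟨by positivity, h1⟩
  · have h1 := (isEquivalent_neg_logb hx0).mul (IsEquivalent.refl (u := fun _ : Space3 => (1 / 2 : ℝ)))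
    have h2 : limitInfo F G =ᶠ[Bornology.cobounded Space3]
        ((fun d => -Real.logb 2 (1 - t d * y d)) * fun _ => (1 / 2 : ℝ)) := by
      filter_upwards [hratio] with d hd
      rw [limitInfo, hd, Pi.mul_apply]
      ring
    have h3 : ((fun d => t d * y d / Real.log 2) * fun _ => (1 / 2 : ℝ))
        ~[Bornology.cobounded Space3] fun d => q₀ / 2 * t d / Real.log 2 := by
      have h4 : y ~[Bornology.cobounded Space3] fun _ => q₀ :=
        (isEquivalent_const_iff_tendsto hq.ne').2 hylim
      have h5 := (IsEquivalent.refl (u := fun d => t d / Real.log 2 * (1 / 2))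
        (l := Bornology.cobounded Space3)).mul h4
      refine (h5.congr_left (Eventually.of_forall fun d => ?_)).congr_right
        (Eventually.of_forall fun d => ?_)
      · simp only [Pi.mul_apply]; ring
      · simp only [Pi.mul_apply]; ring
    exact ((h1.congr_left h2.symm).trans h3).trans (isEquivalent_neg_logb hβ0).symm

end BunchDavies.Frame

/-! ### Existence of adapted frames -/

/-- Linear independence of two functions modulo null sets. -/
def AeIndep (u v : Space3 → ℝ) : Prop :=
  ∀ a b : ℝ, (fun x => a * u x + b * v x) =ᵐ[volume] 0 → a = 0 ∧ b = 0

theorem ae_eq_mul_of_not_aeIndep {u v : Space3 → ℝ} (h : ¬ AeIndep u v)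
    (hu : ¬ u =ᵐ[volume] 0) : ∃ c : ℝ, v =ᵐ[volume] fun x => c * u x := by
  rw [AeIndep] at h
  push Not at h
  obtain ⟨a, b, h1, h2⟩ := h
  have hb : b ≠ 0 := by
    rintro rfl
    have ha : a ≠ 0 := fun ha => h2 ha rfl
    apply hu
    filter_upwards [h1] with x hx
    simpa [ha] using hx
  refine ⟨-a / b, ?_⟩
  filter_upwards [h1] with x hx
  rw [Pi.zero_apply] at hx
  field_simp
  linarith

theorem hat_const_mul (h : Space3 → ℝ) (c : ℝ) (p : Space3) :
    hat (fun x => c * h x) p = c * hat h p := by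
  rw [hat_eq, hat_eq, ← integral_const_mul]
  congr 1
  ext x
  push_cast; ring

theorem hat_eq_zero_of_ae {h : Space3 → ℝ} (hh : Integrable h) (h0 : ∀ᵐ p, hat h p = 0) :
    h =ᵐ[volume] 0 := by
  have h1 : hat h = 0 := (Continuous.ae_eq_iff_eq volume (continuous_hat hh) continuous_zero).1 h0
  exact ae_eq_zero_of_hat_eq_zero hh fun p => congrFun h1 p

namespace BunchDavies

variable {ν K : ℝ} {c₀ c₁ : ℂ} {A : ModePair}

theorem Dominated.congr {Y Z : ℝ → Space3 → ℂ} {y z : Space3 → ℂ} (hY : Dominated Y y)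
    (h1 : ∀ᶠ L in atTop, Y L = Z L) (h2 : y = z) : Dominated Z z := by
  subst h2
  obtain ⟨D, hD, hev⟩ := hY.bound
  refine ⟨⟨D, hD, ?_⟩, ?_⟩
  · filter_upwards [h1, hev] with L h3 h4
    rwa [← h3]
  · filter_upwards [hY.lim] with p hp
    refine hp.congr' ?_
    filter_upwards [h1] with L h3
    rw [h3]

theorem weighted_eq_zero {p : Space3} (hp : p ≠ 0) {z : ℂ}
    (h : ((‖p‖ ^ (-ν) : ℝ) : ℂ) * z = 0) : z = 0 := by
  refine (mul_eq_zero.1 h).resolve_left ?_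
  exact_mod_cast (Real.rpow_pos_of_pos (norm_pos_iff.2 hp) _).ne'

/-- Independent profiles give independent limiting amplitudes. -/
theorem eq_zero_of_aeIndep (hc₀ : c₀ ≠ 0) {h : Fin 2 → Space3 → ℝ} (hh : ∀ i, Integrable (h i))
    (hind : AeIndep (h 0) (h 1)) (x : Fin 2 → ℝ)
    (hx : ∀ᵐ p, ∑ i, (x i : ℂ) * (((‖p‖ ^ (-ν) : ℝ) : ℂ) *
      symb c₀ ((0 : ℝ) * c₁) (h i) (h 0) p) = 0) : x = 0 := by
  have h1 : ∀ᵐ p, hat (fun y => x 0 * h 0 y + x 1 * h 1 y) p = 0 := by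
    filter_upwards [hx, ae_ne_zero] with p hp hp0
    rw [hat_lincomb (hh 0) (hh 1)]
    have h2 : ((‖p‖ ^ (-ν) : ℝ) : ℂ) * (c₀ * (x 0 * hat (h 0) p + x 1 * hat (h 1) p)) = 0 := by
      rw [← hp, Fin.sum_univ_two, symb, symb]
      push_cast; ring
    exact (mul_eq_zero.1 (weighted_eq_zero hp0 h2)).resolve_left hc₀
  have h2 := hind _ _ (hat_eq_zero_of_ae (((hh 0).const_mul _).add ((hh 1).const_mul _)) h1)
  ext i
  fin_cases i
  · exact h2.1
  · exact h2.2

/-- `ĥ` and `|p|² ĥ` are linearly independent unless `h` vanishes. -/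
theorem eq_zero_of_laplacian (hc₀ : c₀ ≠ 0) (hc₁ : c₁ ≠ 0) {h : Space3 → ℝ} (hh : Integrable h)
    (h0 : ¬ h =ᵐ[volume] 0) {a b : ℝ}
    (hx : ∀ᵐ p, (a * c₀ + b * c₁ * ((‖p‖ ^ 2 : ℝ) : ℂ)) * hat h p = 0) : a = 0 ∧ b = 0 := by
  have hcont := continuous_hat hh
  have h1 : (fun p => (a * c₀ + b * c₁ * ((‖p‖ ^ 2 : ℝ) : ℂ)) * hat h p) = 0 :=
    (Continuous.ae_eq_iff_eq volume (by fun_prop) continuous_zero).1 hx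
  obtain ⟨p, hp, hpn⟩ : ∃ p : Space3, p ≠ 0 ∧ hat h p ≠ 0 := by
    by_contra hcon
    push Not at hcon
    exact h0 (hat_eq_zero_of_ae hh (ae_ne_zero.mono hcon))
  -- By continuity the transform is nonzero at two different radii on the ray through `p`, and an
  -- affine function of `|p|²` vanishing at both has zero coefficients.
  have hev : ∀ᶠ t : ℝ in 𝓝 1, hat h (t • p) ≠ 0 := by
    have : Continuous fun t : ℝ => hat h (t • p) := by fun_prop
    exact (this.tendsto 1).eventually_ne (by rwa [one_smul])
  have hroot : ∀ t : ℝ, hat h (t • p) ≠ 0 → (a * c₀ + b * c₁ * ((t ^ 2 * ‖p‖ ^ 2 : ℝ) : ℂ)) = 0 := by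
    intro t ht
    have h3 := congrFun h1 (t • p)
    rw [norm_smul, mul_pow, Real.norm_eq_abs, sq_abs] at h3
    exact (mul_eq_zero.1 h3).resolve_right ht
  obtain ⟨t, ht, ht1⟩ : ∃ t : ℝ, hat h (t • p) ≠ 0 ∧ 1 < t :=
    ((hev.filter_mono nhdsWithin_le_nhds).and self_mem_nhdsWithin :
      ∀ᶠ t : ℝ in 𝓝[>] 1, hat h (t • p) ≠ 0 ∧ 1 < t).exists
  have e1 := hroot 1 (by rwa [one_smul])
  have e2 := hroot t ht
  have hp0 : 0 < ‖p‖ := norm_pos_iff.2 hp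
  have e3 : (b : ℂ) * (c₁ * (((t ^ 2 - 1) * ‖p‖ ^ 2 : ℝ) : ℂ)) = 0 := by
    push_cast at e1 e2 ⊢
    linear_combination e2 - e1
  have hb : b = 0 := by
    have h5 : (((t ^ 2 - 1) * ‖p‖ ^ 2 : ℝ) : ℂ) ≠ 0 := by
      have : 0 < t ^ 2 - 1 := by nlinarith
      exact_mod_cast (by positivity : (t ^ 2 - 1) * ‖p‖ ^ 2 ≠ 0)
    exact_mod_cast (mul_eq_zero.1 e3).resolve_right (mul_ne_zero hc₁ h5)
  refine ⟨?_, hb⟩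
  rw [hb] at e1
  simpa [hc₀] using e1

namespace Frame

/-- A frame of a basis obtained by a constant linear transformation is a frame of the mode. -/
def ofCombination {A' : ModePair} (F : Frame ν c₀ c₁ A') (U : Matrix (Fin 2) (Fin 2) ℝ)
    (hU : U.det ≠ 0)
    (hred : ∀ i L p, redAmp ν L (A' i) p = ∑ j, (U i j : ℂ) * redAmp ν L (A j) p)
    (hsupp : ∀ i x, (A' i).g x ≠ 0 ∨ (A' i).f x ≠ 0 → ∃ j, (A j).g x ≠ 0 ∨ (A j).f x ≠ 0) :
    Frame ν c₀ c₁ A where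
  h := F.h
  θ := F.θ
  ε := F.ε
  T := fun L => F.T L * U
  strong := F.strong
  tame := F.tame
  supp := fun i x hx => by
    obtain ⟨j, hj⟩ := F.supp i x hx
    exact hsupp j x hj
  θ_zero := F.θ_zero
  memLp_θ := F.memLp_θ
  det_ne := by
    filter_upwards [F.det_ne] with L hL
    rw [Matrix.det_mul]
    exact mul_ne_zero hL hU
  det_le := by
    obtain ⟨C, hC⟩ := F.det_le
    refine ⟨C * |U.det|, ?_⟩
    filter_upwards [hC] with L hL
    rw [Matrix.det_mul, abs_mul]
    have := mul_le_mul_of_nonneg_right hL (abs_nonneg U.det)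
    linarith
  ε_zero := F.ε_zero
  limit := fun i => by
    have e : ∀ L p, ∑ j, ((F.T L * U) i j : ℂ) * redAmp ν L (A j) p =
        ∑ j, (F.T L i j : ℂ) * redAmp ν L (A' j) p := by
      intro L p
      simp only [hred, Matrix.mul_apply, Fin.sum_univ_two]
      push_cast; ring
    simp only [e]
    exact F.limit i
  indep := F.indep

end Frame

/-- The first amplitude of a basis whose field profile does not vanish. -/
theorem HankelData.dominated_redAmp (H : HankelData ν K c₀ c₁) {γ : PhaseVec} (hg : Strong γ.g)
    (hf : Tame γ.f) : Dominated (fun L p => (((3 / 2 - ν)⁻¹ : ℝ) : ℂ) * redAmp ν L γ p)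
      (fun p => ((‖p‖ ^ (-ν) : ℝ) : ℂ) * (c₀ * hat γ.g p)) := by
  have hν : (3 / 2 - ν) ≠ 0 := by linarith [H.lt]
  have hν' : ((3 / 2 - ν : ℝ) : ℂ) ≠ 0 := by exact_mod_cast hν
  have hinv : Tendsto (fun L : ℝ => (3 / 2 - ν)⁻¹ * L⁻¹) atTop (𝓝 0) := by
    simpa using tendsto_inv_atTop_zero.const_mul (3 / 2 - ν)⁻¹
  have d1 := H.dominated_aFun hg.tame
  have d2 := (H.dominated_aFun hf).smul hinv
  have d3 := (H.dominated_inv_bFun hg).smul hinv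
  refine ((d1.add d2).add d3).congr (Eventually.of_forall fun L => ?_) ?_
  · ext p
    rw [redAmp]
    have e : ((3 / 2 - ν : ℝ) : ℂ) * (((3 / 2 - ν)⁻¹ : ℝ) : ℂ) = 1 := by
      rw [Complex.ofReal_inv, mul_inv_cancel₀ hν']
    simp only [Complex.ofReal_mul, Complex.ofReal_inv, Complex.ofReal_pow] at e ⊢
    linear_combination -(aFun ν L p * hat γ.g p) * e
  · ext p
    simp

end BunchDavies

/-! ### Frames in the four cases of linear dependence. -/

namespace BunchDavies

variable {ν K : ℝ} {c₀ c₁ : ℂ} {A : ModePair}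

/-- The frame of a mode with independent field profiles. -/
theorem exists_frame_of_indep (H : HankelData ν K c₀ c₁) (hg : ∀ i, Strong (A i).g)
    (hf : ∀ i, Tame (A i).f) (hind : AeIndep (A 0).g (A 1).g) :
    ∃ F : Frame ν c₀ c₁ A, F.h 0 = (A 0).g := by
  have hν : (3 / 2 - ν)⁻¹ ≠ 0 := inv_ne_zero (by linarith [H.lt])
  refine ⟨{
    h := fun i => (A i).g
    θ := fun _ => 0
    ε := fun _ => 0
    T := fun _ => (3 / 2 - ν)⁻¹ • 1
    strong := hg 0
    tame := fun i => (hg i).tame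
    supp := fun i x hx => ⟨i, Or.inl hx⟩
    θ_zero := rfl
    memLp_θ := fun h => absurd rfl h
    det_ne := Eventually.of_forall fun L => by simpa using hν
    det_le := ⟨|((3 / 2 - ν)⁻¹ • (1 : Matrix (Fin 2) (Fin 2) ℝ)).det|, by
      filter_upwards [eventually_ge_atTop 1] with L hL
      exact le_mul_of_one_le_right (abs_nonneg _) (one_le_pow₀ hL)⟩
    ε_zero := rfl
    limit := fun i => Or.inl ⟨rfl, ?_⟩
    indep := fun x hx _ => eq_zero_of_aeIndep H.ne₀ (fun i => (hg i).1) hind x hx }, rfl⟩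
  refine (H.dominated_redAmp (hg i) (hf i)).congr (Eventually.of_forall fun L => ?_) ?_
  · ext p
    fin_cases i <;> simp [Fin.sum_univ_two]
  · ext p
    simp [symb]

theorem redAmp_of_field_eq_zero {γ : PhaseVec} (h : γ.g =ᵐ[volume] 0) (L : ℝ) (p : Space3) :
    redAmp ν L γ p = ((L⁻¹ : ℝ) : ℂ) * (aFun ν L p * hat γ.f p) := by
  have : hat γ.g = 0 := by rw [hat_congr h, hat_zero_left]
  rw [redAmp, this]
  simp only [Pi.zero_apply]
  ring

/-- With `g₁ = 0` the second amplitude is exactly `L⁻¹ a_L f̂₁`, so multiplying it by `L` gives the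
profile `f₁`. -/
theorem exists_frame_of_indep_momentum (H : HankelData ν K c₀ c₁) (hg : ∀ i, Strong (A i).g)
    (hf : ∀ i, Tame (A i).f) (hg1 : (A 1).g =ᵐ[volume] 0) (hind : AeIndep (A 0).g (A 1).f) :
    ∃ F : Frame ν c₀ c₁ A, F.h 0 = (A 0).g := by
  have hν : (3 / 2 - ν)⁻¹ ≠ 0 := inv_ne_zero (by linarith [H.lt])
  have hlim : ∀ i : Fin 2, Dominated
      (fun L p => ∑ j, ((!![(3 / 2 - ν)⁻¹, 0; 0, L] : Matrix (Fin 2) (Fin 2) ℝ) i j : ℂ) *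
        redAmp ν L (A j) p)
      (fun p => ((‖p‖ ^ (-ν) : ℝ) : ℂ) *
        symb c₀ ((0 : ℝ) * c₁) ((![(A 0).g, (A 1).f] : Fin 2 → Space3 → ℝ) i)
          ((![(A 0).g, (A 1).f] : Fin 2 → Space3 → ℝ) 0) p) := by
    intro i
    fin_cases i
    · refine (H.dominated_redAmp (hg 0) (hf 0)).congr (Eventually.of_forall fun L => ?_) ?_
      · ext p; simp [Fin.sum_univ_two]
      · ext p; simp [symb]
    · refine (H.dominated_aFun (hf 1)).congr ?_ ?_
      · filter_upwards [eventually_gt_atTop 0] with L hL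
        have hL' : (L : ℂ) ≠ 0 := by exact_mod_cast hL.ne'
        ext p
        simp [Fin.sum_univ_two, redAmp_of_field_eq_zero hg1, hL']
      · ext p; simp [symb]
  exact ⟨{
    h := ![(A 0).g, (A 1).f]
    θ := fun _ => 0
    ε := fun _ => 0
    T := fun L => !![(3 / 2 - ν)⁻¹, 0; 0, L]
    strong := hg 0
    tame := fun i => by
      fin_cases i
      · exact (hg 0).tame
      · exact hf 1
    supp := fun i x hx => by
      fin_cases i
      · exact ⟨0, Or.inl hx⟩
      · exact ⟨1, Or.inr hx⟩
    θ_zero := rfl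
    memLp_θ := fun h => absurd rfl h
    det_ne := by
      filter_upwards [eventually_gt_atTop 0] with L hL
      rw [Matrix.det_fin_two_of, mul_zero, sub_zero]
      exact mul_ne_zero hν hL.ne'
    det_le := ⟨|(3 / 2 - ν)⁻¹|, by
      filter_upwards [eventually_ge_atTop 1] with L hL
      rw [Matrix.det_fin_two_of, mul_zero, sub_zero, abs_mul, abs_of_pos (by linarith : 0 < L)]
      exact mul_le_mul_of_nonneg_left (le_self_pow₀ hL (by norm_num)) (abs_nonneg _)⟩
    ε_zero := rfl
    limit := fun i => Or.inl ⟨rfl, hlim i⟩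
    indep := fun x hx _ => eq_zero_of_aeIndep H.ne₀ (by
      intro i
      fin_cases i
      · exact (hg 0).1
      · exact (hf 1).1) hind x hx }, rfl⟩

/-- As `f₁ = c g₀`, the second observable supplies `a_L ĝ₀` and can cancel the leading term of the
first. There remains `L⁻¹ (a_L f̂₀ + L⁻¹ b_L ĝ₀)`, and rescaling by `L` exposes the profile `f₀`. -/
theorem exists_frame_of_indep_conjugate (H : HankelData ν K c₀ c₁) (hg : ∀ i, Strong (A i).g)
    (hf : ∀ i, Tame (A i).f) (hg1 : (A 1).g =ᵐ[volume] 0) {c : ℝ} (hc : c ≠ 0)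
    (hf1 : (A 1).f =ᵐ[volume] fun x => c * (A 0).g x) (hind : AeIndep (A 0).g (A 0).f) :
    ∃ F : Frame ν c₀ c₁ A, F.h 0 = (A 0).g := by
  have hc' : (c : ℂ) ≠ 0 := by exact_mod_cast hc
  have hgz : hat (A 1).g = 0 := by rw [hat_congr hg1, hat_zero_left]
  have hfh : ∀ p, hat (A 1).f p = c * hat (A 0).g p := fun p => by
    rw [hat_congr hf1, hat_const_mul]
  have hlim : ∀ i : Fin 2, Dominated
      (fun L p => ∑ j, ((!![0, L / c; L, -(L ^ 2 * (3 / 2 - ν) / c)] : Matrix (Fin 2) (Fin 2) ℝ) i j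
        : ℂ) * redAmp ν L (A j) p)
      (fun p => ((‖p‖ ^ (-ν) : ℝ) : ℂ) *
        symb c₀ ((0 : ℝ) * c₁) ((![(A 0).g, (A 0).f] : Fin 2 → Space3 → ℝ) i)
          ((![(A 0).g, (A 0).f] : Fin 2 → Space3 → ℝ) 0) p) := by
    intro i
    fin_cases i
    · refine (H.dominated_aFun (hg 0).tame).congr ?_ ?_
      · filter_upwards [eventually_gt_atTop 0] with L hL
        have hL' : (L : ℂ) ≠ 0 := by exact_mod_cast hL.ne'
        ext p
        simp [Fin.sum_univ_two, redAmp_of_field_eq_zero hg1, hfh]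
        field_simp
      · ext p; simp [symb]
    · refine ((H.dominated_aFun (hf 0)).add (H.dominated_inv_bFun (hg 0))).congr ?_ ?_
      · filter_upwards [eventually_gt_atTop 0] with L hL
        have hL' : (L : ℂ) ≠ 0 := by exact_mod_cast hL.ne'
        ext p
        simp [Fin.sum_univ_two, hgz, hfh, redAmp]
        field_simp
        ring
      · ext p; simp [symb]
  have hdet : ∀ L : ℝ, (!![0, L / c; L, -(L ^ 2 * (3 / 2 - ν) / c)] : Matrix (Fin 2) (Fin 2) ℝ).det =
      -(c⁻¹ * L ^ 2) := by
    intro L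
    rw [Matrix.det_fin_two_of]; ring
  exact ⟨{
    h := ![(A 0).g, (A 0).f]
    θ := fun _ => 0
    ε := fun _ => 0
    T := fun L => !![0, L / c; L, -(L ^ 2 * (3 / 2 - ν) / c)]
    strong := hg 0
    tame := fun i => by
      fin_cases i
      · exact (hg 0).tame
      · exact hf 0
    supp := fun i x hx => by
      fin_cases i
      · exact ⟨0, Or.inl hx⟩
      · exact ⟨0, Or.inr hx⟩
    θ_zero := rfl
    memLp_θ := fun h => absurd rfl h
    det_ne := by
      filter_upwards [eventually_gt_atTop 0] with L hL
      rw [hdet]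
      exact neg_ne_zero.2 (mul_ne_zero (inv_ne_zero hc) (by positivity))
    det_le := ⟨|c⁻¹|, by
      filter_upwards [eventually_ge_atTop 1] with L hL
      rw [hdet, abs_neg, abs_mul, abs_of_nonneg (by positivity : 0 ≤ L ^ 2)]
      exact mul_le_mul_of_nonneg_left (pow_le_pow_right₀ hL (by norm_num)) (abs_nonneg _)⟩
    ε_zero := rfl
    limit := fun i => Or.inl ⟨rfl, hlim i⟩
    indep := fun x hx _ => eq_zero_of_aeIndep H.ne₀ (by
      intro i
      fin_cases i
      · exact (hg 0).1
      · exact (hf 0).1) hind x hx }, rfl⟩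

/-- The basis transformation for a mode all of whose smearing functions are proportional. -/
def proportionalBasis (ν c e r L : ℝ) : Matrix (Fin 2) (Fin 2) ℝ :=
  !![0, L / c; r * L ^ 2, -(r * L ^ 2 * (L / c) * (3 / 2 - ν + e / L))]

theorem det_proportionalBasis (ν c e r L : ℝ) :
    (proportionalBasis ν c e r L).det = -(c⁻¹ * r * L ^ 3) := by
  rw [proportionalBasis, Matrix.det_fin_two_of]; ring

theorem sum_proportionalBasis (hg1 : (A 1).g =ᵐ[volume] 0) {c e : ℝ} (hc : c ≠ 0)
    (hf1 : (A 1).f =ᵐ[volume] fun x => c * (A 0).g x)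
    (hf0 : (A 0).f =ᵐ[volume] fun x => e * (A 0).g x) {L : ℝ} (hL : 0 < L) (r : ℝ) (p : Space3) :
    ∑ j, (proportionalBasis ν c e r L 0 j : ℂ) * redAmp ν L (A j) p = aFun ν L p * hat (A 0).g p ∧
    ∑ j, (proportionalBasis ν c e r L 1 j : ℂ) * redAmp ν L (A j) p =
      (r : ℂ) * (bFun ν L p * hat (A 0).g p) := by
  have hc' : (c : ℂ) ≠ 0 := by exact_mod_cast hc
  have hgz : hat (A 1).g = 0 := by rw [hat_congr hg1, hat_zero_left]
  have hL' : (L : ℂ) ≠ 0 := by exact_mod_cast hL.ne'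
  have hfh : ∀ p, hat (A 1).f p = c * hat (A 0).g p := fun p => by
    rw [hat_congr hf1, hat_const_mul]
  have hfh0 : ∀ p, hat (A 0).f p = e * hat (A 0).g p := fun p => by
    rw [hat_congr hf0, hat_const_mul]
  constructor
  · simp [proportionalBasis, Fin.sum_univ_two, redAmp_of_field_eq_zero hg1, hfh]
    field_simp
  · simp [proportionalBasis, Fin.sum_univ_two, hgz, hfh, hfh0, redAmp]
    field_simp
    ring

/-- When `f₀` is proportional to `g₀` as well, the whole `a_L` part cancels and the second direction
is `L⁻² b_L ĝ₀`. If `|p|^{2-ν} ĝ₀` is square integrable this has a limit after rescaling, recorded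
by `θ = 1`; otherwise it is normalised and escapes, recorded by `ε = 1`. -/
theorem exists_frame_of_proportional (H : HankelData ν K c₀ c₁) (hg : ∀ i, Strong (A i).g)
    (hg1 : (A 1).g =ᵐ[volume] 0) (hg0 : ¬ (A 0).g =ᵐ[volume] 0) {c e : ℝ} (hc : c ≠ 0)
    (hf1 : (A 1).f =ᵐ[volume] fun x => c * (A 0).g x)
    (hf0 : (A 0).f =ᵐ[volume] fun x => e * (A 0).g x) :
    ∃ F : Frame ν c₀ c₁ A, F.h 0 = (A 0).g := by
  have htame : ∀ i, Tame ((![(A 0).g, 0] : Fin 2 → Space3 → ℝ) i) := by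
    intro i
    fin_cases i
    · exact (hg 0).tame
    · exact tame_zero
  have hsupp : ∀ (i : Fin 2) (x : Space3), (![(A 0).g, 0] : Fin 2 → Space3 → ℝ) i x ≠ 0 →
      ∃ j, (A j).g x ≠ 0 ∨ (A j).f x ≠ 0 := by
    intro i x hx
    fin_cases i
    · exact ⟨0, Or.inl hx⟩
    · exact absurd rfl hx
  have hfirst : ∀ r : ℝ → ℝ, Dominated
      (fun L p => ∑ j, (proportionalBasis ν c e (r L) L 0 j : ℂ) * redAmp ν L (A j) p)
      (fun p => ((‖p‖ ^ (-ν) : ℝ) : ℂ) * symb c₀ ((0 : ℝ) * c₁) (A 0).g (A 0).g p) := by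
    intro r
    refine (H.dominated_aFun (hg 0).tame).congr ?_ ?_
    · filter_upwards [eventually_gt_atTop 0] with L hL
      ext p
      exact ((sum_proportionalBasis hg1 hc hf1 hf0 hL (r L) p).1).symm
    · ext p; simp [symb]
  by_cases hL2 : MemLp (fun p => ((‖p‖ ^ (2 - ν) : ℝ) : ℂ) * hat (A 0).g p) 2 volume
  · refine ⟨{
      h := ![(A 0).g, 0]
      θ := ![0, 1]
      ε := fun _ => 0
      T := fun L => proportionalBasis ν c e 1 L
      strong := hg 0
      tame := htame
      supp := hsupp
      θ_zero := rfl
      memLp_θ := fun _ => hL2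
      det_ne := ?_
      det_le := ⟨|c⁻¹|, ?_⟩
      ε_zero := rfl
      limit := fun i => Or.inl ⟨rfl, ?_⟩
      indep := fun x hx _ => ?_ }, rfl⟩
    · filter_upwards [eventually_gt_atTop 0] with L hL
      rw [det_proportionalBasis]
      exact neg_ne_zero.2 (mul_ne_zero (mul_ne_zero (inv_ne_zero hc) one_ne_zero) (by positivity))
    · filter_upwards [eventually_ge_atTop 1] with L hL
      rw [det_proportionalBasis, abs_neg, mul_one, abs_mul, abs_of_nonneg (by positivity : 0 ≤ L ^ 3)]
    · fin_cases i
      · exact hfirst fun _ => 1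
      · refine (H.dominated_bFun (hg 0).1 hL2).congr ?_ ?_
        · filter_upwards [eventually_gt_atTop 0] with L hL
          ext p
          have := (sum_proportionalBasis (ν := ν) hg1 hc hf1 hf0 hL 1 p).2
          rw [Complex.ofReal_one, one_mul] at this
          exact this.symm
        · refine funext fun p => ?_
          rcases eq_or_ne p 0 with rfl | hp
          · have h1 : 2 - ν ≠ 0 := by linarith [H.lt]
            simp [symb, hat_zero_left, Real.zero_rpow h1]
          · have h1 : ‖p‖ ^ (2 - ν) = ‖p‖ ^ (-ν) * ‖p‖ ^ 2 := by
              rw [← Real.rpow_natCast, ← Real.rpow_add (norm_pos_iff.2 hp)]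
              congr 1; push_cast; ring
            rw [h1]
            simp [symb, hat_zero_left]
            ring
    · have h1 := eq_zero_of_laplacian (a := x 0) (b := x 1) H.ne₀ H.ne₁ (hg 0).1 hg0 (by
        filter_upwards [hx, ae_ne_zero] with p hp hp0
        refine weighted_eq_zero (ν := ν) hp0 ?_
        rw [← hp, Fin.sum_univ_two]
        simp [symb, hat_zero_left]
        ring)
      ext i
      fin_cases i
      · exact h1.1
      · exact h1.2
  · have hN := H.tendsto_bNormSq (hg 0) hL2
    refine ⟨{
      h := ![(A 0).g, 0]
      θ := fun _ => 0
      ε := ![0, 1]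
      T := fun L => proportionalBasis ν c e (√(bNormSq ν L (A 0).g))⁻¹ L
      strong := hg 0
      tame := htame
      supp := hsupp
      θ_zero := rfl
      memLp_θ := fun h => absurd rfl h
      det_ne := ?_
      det_le := ⟨|c⁻¹|, ?_⟩
      ε_zero := rfl
      limit := fun i => ?_
      indep := fun x hx hε => ?_ }, rfl⟩
    · filter_upwards [eventually_gt_atTop 0, hN.eventually_gt_atTop 0] with L hL hN
      rw [det_proportionalBasis]
      have := Real.sqrt_pos.2 hN
      exact neg_ne_zero.2 (mul_ne_zero (mul_ne_zero (inv_ne_zero hc) (by positivity))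
        (by positivity))
    · filter_upwards [eventually_ge_atTop 1, hN.eventually_ge_atTop 1] with L hL hN
      rw [det_proportionalBasis, abs_neg, abs_mul, abs_mul, abs_of_nonneg (by positivity : 0 ≤ L ^ 3),
        abs_of_nonneg (by positivity : 0 ≤ (√(bNormSq ν L (A 0).g))⁻¹)]
      refine mul_le_mul_of_nonneg_right ?_ (by positivity)
      exact mul_le_of_le_one_right (abs_nonneg _) (inv_le_one_of_one_le₀ (Real.one_le_sqrt.2 hN))
    · fin_cases i
      · exact Or.inl ⟨rfl, hfirst _⟩
      · refine Or.inr ⟨rfl, rfl, rfl, ?_, hL2⟩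
        filter_upwards [eventually_gt_atTop 0] with L hL
        ext p
        exact (sum_proportionalBasis hg1 hc hf1 hf0 hL _ p).2
    · have hx1 : x 1 = 0 := by simpa using hε
      have h1 := eq_zero_of_laplacian (a := x 0) (b := 0) H.ne₀ H.ne₁ (hg 0).1 hg0 (by
        filter_upwards [hx, ae_ne_zero] with p hp hp0
        refine weighted_eq_zero (ν := ν) hp0 ?_
        rw [← hp, Fin.sum_univ_two]
        simp [symb, hx1]
        ring)
      ext i
      fin_cases i
      · exact h1.1
      · exact hx1

end BunchDavies

/-! ### Reduction of an arbitrary mode to the four cases. -/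

namespace BunchDavies

variable {ν K : ℝ} {c₀ c₁ : ℂ} {A : ModePair}

/-- A constant linear transformation of the basis of a mode. -/
def combination (U : Matrix (Fin 2) (Fin 2) ℝ) (A : ModePair) : ModePair := fun i =>
  { g := fun x => U i 0 * (A 0).g x + U i 1 * (A 1).g x
    f := fun x => U i 0 * (A 0).f x + U i 1 * (A 1).f x }

theorem redAmp_combination (hA : A.IsSingleMode) (U : Matrix (Fin 2) (Fin 2) ℝ) (i : Fin 2)
    (L : ℝ) (p : Space3) :
    redAmp ν L (combination U A i) p = ∑ j, (U i j : ℂ) * redAmp ν L (A j) p := by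
  have h1 : hat (combination U A i).g p = U i 0 * hat (A 0).g p + U i 1 * hat (A 1).g p :=
    hat_lincomb (hA.admissible 0).integrable_g (hA.admissible 1).integrable_g _ _ p
  have h2 : hat (combination U A i).f p = U i 0 * hat (A 0).f p + U i 1 * hat (A 1).f p :=
    hat_lincomb (hA.admissible 0).integrable_f (hA.admissible 1).integrable_f _ _ p
  rw [Fin.sum_univ_two, redAmp, redAmp, redAmp, h1, h2]
  ring

theorem combination_supp (U : Matrix (Fin 2) (Fin 2) ℝ) (i : Fin 2) (x : Space3)
    (h : (combination U A i).g x ≠ 0 ∨ (combination U A i).f x ≠ 0) :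
    ∃ j, (A j).g x ≠ 0 ∨ (A j).f x ≠ 0 := by
  by_contra hcon
  push Not at hcon
  rcases h with h | h
  · apply h
    simp [combination, (hcon 0).1, (hcon 1).1]
  · apply h
    simp [combination, (hcon 0).2, (hcon 1).2]

/-- The symplectic form is non-degenerate on a mode. -/
theorem omega_ne_zero_absurd (hA : A.IsSingleMode)
    (h : ∀ᵐ x, (A 1).f x * (A 0).g x - (A 1).g x * (A 0).f x = 0) : False := by
  have h1 := hA.symplectic
  rw [PhaseVec.omega, integral_eq_zero_of_ae h] at h1
  exact zero_ne_one h1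

/-- Every single mode has an adapted frame. -/
theorem exists_frame (H : HankelData ν K c₀ c₁) (hA : A.IsSingleMode) :
    ∃ F : Frame ν c₀ c₁ A, A.Typical → ∫ x, F.h 0 x ≠ 0 := by
  have hg : ∀ i, Strong (A i).g := fun i => PhaseVec.Admissible.strong_g (hA.admissible i)
  have hf : ∀ i, Tame (A i).f := fun i => PhaseVec.Admissible.tame_f (hA.admissible i)
  by_cases hind : AeIndep (A 0).g (A 1).g
  · obtain ⟨F, hF⟩ := exists_frame_of_indep H hg hf hind
    refine ⟨F, fun hT => ?_⟩
    rw [hF]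
    refine (hT 0).1.resolve_left fun h0 => ?_
    have := (hind 1 0 (by
      filter_upwards [h0] with x hx
      simpa using hx)).1
    exact one_ne_zero this
  rw [AeIndep] at hind
  push Not at hind
  obtain ⟨s, t, hst, hne⟩ := hind
  have hdet0 : s ^ 2 + t ^ 2 ≠ 0 := by
    intro h
    have hs : s = 0 := by nlinarith [sq_nonneg s, sq_nonneg t]
    have ht : t = 0 := by nlinarith [sq_nonneg s, sq_nonneg t]
    exact hne hs ht
  -- The second row is the vanishing combination of the field profiles and the first row is
  -- orthogonal to it, so the determinant is `-(s² + t²)`.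
  set U : Matrix (Fin 2) (Fin 2) ℝ := !![-t, s; s, t] with hU
  have hUdet : U.det ≠ 0 := by
    rw [hU, Matrix.det_fin_two_of]
    intro h
    exact hdet0 (by linarith)
  set A' := combination U A with hA'
  have hg' : ∀ i, Strong (A' i).g := fun i => (hg 0).lincomb (hg 1) _ _
  have hf' : ∀ i, Tame (A' i).f := fun i => (hf 0).lincomb (hf 1) _ _
  have hg0 : (A' 0).g = fun x => -t * (A 0).g x + s * (A 1).g x := rfl
  have hg1 : (A' 1).g =ᵐ[volume] 0 := hst
  have hf1 : (A' 1).f = fun x => s * (A 0).f x + t * (A 1).f x := rfl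
  have hsolve : ∀ {x y : ℝ}, -t * x + s * y = 0 → s * x + t * y = 0 → x = 0 ∧ y = 0 := by
    intro x y h1 h2
    constructor
    · have : (s ^ 2 + t ^ 2) * x = 0 := by linear_combination s * h2 - t * h1
      exact (mul_eq_zero.1 this).resolve_left hdet0
    · have : (s ^ 2 + t ^ 2) * y = 0 := by linear_combination t * h2 + s * h1
      exact (mul_eq_zero.1 this).resolve_left hdet0
  have hboth : ¬ ((A 0).g =ᵐ[volume] 0 ∧ (A 1).g =ᵐ[volume] 0) := by
    rintro ⟨h1, h2⟩
    apply omega_ne_zero_absurd hA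
    filter_upwards [h1, h2] with x h3 h4
    rw [h3, h4]; simp
  have hg0' : ¬ (A' 0).g =ᵐ[volume] 0 := by
    intro h
    refine hboth ⟨?_, ?_⟩
    · filter_upwards [h, hst] with x h1 h2
      exact (hsolve h1 h2).1
    · filter_upwards [h, hst] with x h1 h2
      exact (hsolve h1 h2).2
  -- Otherwise the second vector of the new basis would vanish, and the symplectic form of the mode
  -- with it.
  have hf1' : ¬ (A' 1).f =ᵐ[volume] 0 := by
    intro h
    apply omega_ne_zero_absurd hA
    filter_upwards [h, hst] with x h1 h2
    rw [hf1, Pi.zero_apply] at h1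
    rw [Pi.zero_apply] at h2
    refine (mul_eq_zero.1 (?_ : (s ^ 2 + t ^ 2) * _ = 0)).resolve_left hdet0
    linear_combination (t * (A 0).g x - s * (A 1).g x) * h1 +
      (s * (A 1).f x - t * (A 0).f x) * h2
  have hmain : ∃ F : Frame ν c₀ c₁ A', F.h 0 = (A' 0).g := by
    by_cases h1 : AeIndep (A' 0).g (A' 1).f
    · exact exists_frame_of_indep_momentum H hg' hf' hg1 h1
    obtain ⟨c, hc⟩ := ae_eq_mul_of_not_aeIndep h1 hg0'
    have hc0 : c ≠ 0 := by
      rintro rfl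
      apply hf1'
      filter_upwards [hc] with x hx
      simpa using hx
    by_cases h2 : AeIndep (A' 0).g (A' 0).f
    · exact exists_frame_of_indep_conjugate H hg' hf' hg1 hc0 hc h2
    obtain ⟨e, he⟩ := ae_eq_mul_of_not_aeIndep h2 hg0'
    exact exists_frame_of_proportional H hg' hg1 hg0' hc0 hc he
  obtain ⟨F, hF⟩ := hmain
  refine ⟨F.ofCombination U hUdet (redAmp_combination hA U) (combination_supp U), fun hT h0 => ?_⟩
  -- If the average of the new first profile vanished, then, as that of the second does, both
  -- original profiles would have zero average. Typicality would make both vanish, against the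
  -- symplectic normalisation.
  have h1 : -t * (∫ x, (A 0).g x) + s * (∫ x, (A 1).g x) = 0 := by
    rw [← integral_const_mul, ← integral_const_mul,
      ← integral_add ((hg 0).1.const_mul _) ((hg 1).1.const_mul _), ← h0]
    exact integral_congr_ae (Eventually.of_forall fun x => (congrFun hF x).symm)
  have h2 : s * (∫ x, (A 0).g x) + t * (∫ x, (A 1).g x) = 0 := by
    rw [← integral_const_mul, ← integral_const_mul,
      ← integral_add ((hg 0).1.const_mul _) ((hg 1).1.const_mul _)]
    exact integral_eq_zero_of_ae hst
  have h3 := hsolve h1 h2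
  exact hboth ⟨(hT 0).1.resolve_right (not_not.2 h3.1), (hT 1).1.resolve_right (not_not.2 h3.2)⟩

end BunchDavies

end

/-! ### The proposition. -/

theorem proposition4 (q : ℝ) (hq0 : 0 < q) (hq : q ^ 2 < 5 / 4)
    (A B : ModePair) (hA : A.IsSingleMode) (hB : B.IsSingleMode) :
    ∃ Ilim : Space3 → ℝ,
      (∀ d : Space3, A.NonOverlapping (B.translate d) →
        0 ≤ Ilim d ∧
        Tendsto
          (fun p : ℝ × ℝ =>
            BunchDavies.mutualInfo (q * p.2) p.2 (A.dilate p.1) ((B.translate d).dilate p.1))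
          superHubble (𝓝 (Ilim d))) ∧
      (A.Typical → B.Typical →
        ∃ β : ℝ, 0 < β ∧
          (∀ᶠ d in Bornology.cobounded Space3,
            0 < β * ‖d‖ ^ (-4 * BunchDavies.muSq q 1) ∧
              β * ‖d‖ ^ (-4 * BunchDavies.muSq q 1) < 1) ∧
          Ilim ~[Bornology.cobounded Space3]
            fun d => -Real.logb 2 (1 - β * ‖d‖ ^ (-4 * BunchDavies.muSq q 1))) := by
  set ν := √(9 / 4 - q ^ 2) with hν
  -- The lightness condition `q² < 5/4` is exactly `ν > 1`, and a positive mass gives `ν < 3/2`.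
  have h1 : 1 < ν := by
    rw [hν, Real.lt_sqrt (by norm_num)]
    linarith
  have h2 : ν < 3 / 2 := by
    rw [hν, Real.sqrt_lt' (by norm_num)]
    nlinarith [sq_pos_of_pos hq0]
  obtain ⟨K, c₀, c₁, H⟩ := BunchDavies.exists_hankelData h1 h2
  obtain ⟨F, hF⟩ := BunchDavies.exists_frame H hA
  obtain ⟨G, hG⟩ := BunchDavies.exists_frame H hB
  refine ⟨F.limitInfo G, fun d hd => ⟨F.limitInfo_nonneg hA hB G hd,
    F.tendsto_mutualInfo hν H hA hB G hd⟩, fun hTA hTB => ?_⟩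
  have hμ : BunchDavies.muSq q 1 = 3 / 2 - ν := by
    rw [BunchDavies.muSq, hν, one_pow, div_one]
  rw [hμ]
  exact F.limitInfo_asymptotics H hA hB G (hF hTA) (hG hTB)
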